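/- Let $K$ be an algebraically closed field of characteristic $2$. For a shearing vector $\underline N=(N_1,\dots,N_m)$ with $1\le N_i\le\infty$, let $\mathcal O(m;\underline N)$ be the divided power algebra with basis $u^{(r)}=\prod_i u_i^{(r_i)}$, $0\le r_i<2^{N_i}$, multiplication $u^{(r)}u^{(s)}=\prod_i\binom{r_i+s_i}{r_i}\,u^{(r+s)}$, and distinguished derivations $\partial_{u_i}$, $\partial_{u_i}u_j^{(k)}=\delta_{ij}u_j^{(k-1)}$. Let $\mathfrak{vect}(m;\underline N)=\{\sum f_i\partial_{u_i}: f_i\in\mathcal O(m;\underline N)\}$ and $\mathfrak{svect}(m;\underline N)=\{\sum f_i\partial_{u_i}:\sum\partial_{u_i}f_i=0\}$. We put $\partial_i=\partial_{u_i}$. Let $\underline N=(N_1,\dots,N_5)$ be any shearing vector with $1\le N_i\le\infty$. Consider $11$ indeterminates $u_1,u_2,u_3,u_4=\chi_1,u_5=\chi_2,\eta_1,\eta_2,\eta_3,\xi_1,\xi_2,\xi_3$, all regarded as even, with shearing vector equal to $\underline N$ on $u_1,\dots,u_5$ and to $1$ on the $\eta_i,\xi_i$. For every cyclic permutation $(i,j,k)$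 of $(1,2,3)$ put $$Y_{\xi_i}=\partial_{\xi_i},\qquad Y_{\eta_i}=\partial_{\eta_i}+\xi_k\partial_{u_j}-\xi_j\partial_{u_k}+(\xi_k\eta_j-\xi_j\eta_k)\partial_{\chi_1}-\xi_j\xi_k\partial_{\chi_2}.$$ The desuperization $\mathbf F(\mathfrak{mb}(3;\underline N|8))$ is the Lie algebra of those vector fields in these $11$ indeterminates that preserve the distribution (the module over the functions) spanned by the $Y_{\xi_i}$ and $Y_{\eta_i}$. For a field $X=\sum_i(g_{u_i}\partial_{u_i}+g_{\eta_i}\partial_{\eta_i}+g_{\xi_i}\partial_{\xi_i})+g_{\chi_1}\partial_{\chi_1}+g_{\chi_2}\partial_{\chi_2}$ in it (sums over $i=1,2,3$), set $$F_1=g_{\chi_1}-\sum_i g_{u_i}\eta_i,\qquad F_2=g_{\chi_2}-\sum_i g_{u_i}\xi_i-\sum_{(i,j,k)\text{ cyclic}} g_{\eta_i}\xi_j\xi_k,$$ and let $f=(f_1,\dots,f_5)$, a tuple of functions of $u_1,\dots,u_5$, be given as follows: $f_i$ ($i=1,2,3$) is the coefficient of $\eta_i$ in $F_1$, that is, the value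 of $\partial_{\eta_i}F_1$ at $\eta=\xi=0$, while $f_4$ and $f_5$ are the values of $F_1$ and $F_2$ at $\eta=\xi=0$. Write $X=X^f$ and $D^f=\sum_{i=1}^5 f_i\partial_{u_i}$. For $D^f,D^g\in\mathfrak{svect}(5;\underline N)$ put $$c(D^f,D^g)=\sum_{(i,j,k)\in S_3}\left(\partial_i f_4\,\partial_j g_5+\partial_i f_5\,\partial_j g_4\right)\partial_k ,$$ where the sum runs over all permutations of $(1,2,3)$. Let $\mathbf F(\mathfrak{kle})=\mathfrak{svect}(5;\underline N)\oplus d\Omega^1(5;\underline N)$, where $d\Omega^1$ is the space of exact differential $2$-forms, be the Lie algebra with the usual bracket on $\mathfrak{svect}(5;\underline N)$, the bracket $[D,\omega]=L_D\omega$ (Lie derivative), and the bracket of two forms $\omega,\omega'\in d\Omega^1$ equal to the divergence-free vector field which corresponds to $(\omega\wedge\omega')/\mathrm{vol}$. Put $Z_i(D)=du_i\wedge df_i$ for $D=\sum f_i\partial_{u_i}$, and $\psi(D)=D+Z_4(D)+Z_5(D)$. Then, for every $\underline N$ as above: 1. The map $\varphi: X^f\mapsto D^f$ is a linear bijection from $\mathbf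 F(\mathfrak{mb}(3;\underline N|8))$ onto $\mathfrak{svect}(5;\underline N)$. 2. $\varphi([X^f,X^g])=[D^f,D^g]+c(D^f,D^g)$ for all $X^f,X^g$; the map $c$ is a $2$-cocycle of $\mathfrak{svect}(5;\underline N)$ with coefficients in the adjoint module, and it is not a coboundary. 3. The linear map $\psi:\mathfrak{svect}(5;\underline N)\to\mathbf F(\mathfrak{kle})$ is injective, and $[\psi(D),\psi(E)]=\psi([D,E]+c(D,E))$ for all $D,E\in\mathfrak{svect}(5;\underline N)$; thus $\psi\circ\varphi$ is an injective homomorphism of Lie algebras $\mathbf F(\mathfrak{mb}(3;\underline N|8))\to\mathbf F(\mathfrak{kle})$. Moreover, for $\underline N=\underline N_\infty=(\infty,\dots,\infty)$: 4. $\mathbf F(\mathfrak{mb}(3;\underline N_\infty|8))$ has no maximal subalgebra of codimension $5$, whereas $\mathfrak{svect}(5;\underline N_\infty)$ has one. Hence these two Lie algebras are not isomorphic, and $\mathbf F(\mathfrak{mb}(3;\underline N_\infty|8))$ is a true deform of $\mathfrak{svect}(5;\underline N_\infty)$: the cocycle $c$ is not a coboundary, and the deformed algebra is not isomorphic to the initial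 one. -/

import Mathlib

set_option linter.unusedSectionVars false
set_option linter.unusedSimpArgs false

namespace CharTwo5

noncomputable section

/-- Divided power polynomials over `K` in indeterminates indexed by `ι` (all exponents allowed):
`f` stands for `∑ r, f r • u^(r)` with `u^(r) = ∏ i, u_i^(r i)`. -/
def DivPow (K ι : Type*) [Field K] : Type _ := (ι → ℕ) →₀ K

namespace DivPow

variable {K ι : Type*} [Field K]

instance : AddCommGroup (DivPow K ι) := inferInstanceAs (AddCommGroup ((ι → ℕ) →₀ K))

instance : Module K (DivPow K ι) := inferInstanceAs (Module K ((ι → ℕ) →₀ K))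

/-- The coefficient of `u^(r)`. -/
def coeff (r : ι → ℕ) : DivPow K ι →ₗ[K] K := Finsupp.lapply r

/-- The divided monomial `u^(r)`. -/
def mon (r : ι → ℕ) : DivPow K ι := Finsupp.single r (1 : K)

/-- Linear maps out of the divided power algebra, by their values on divided monomials. -/
def lift {M : Type*} [AddCommGroup M] [Module K M] (v : (ι → ℕ) → M) : DivPow K ι →ₗ[K] M :=
  Finsupp.linearCombination K v

theorem lift_mon {M : Type*} [AddCommGroup M] [Module K M] (v : (ι → ℕ) → M) (r : ι → ℕ) :
    lift v (mon r : DivPow K ι) = v r := by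
  exact (Finsupp.linearCombination_single K (1 : K) r).trans (one_smul K (v r))

theorem coeff_mon [DecidableEq (ι → ℕ)] (r s : ι → ℕ) :
    coeff s (mon r : DivPow K ι) = if r = s then 1 else 0 := by
  simp only [coeff, mon]
  exact Finsupp.single_apply

theorem hom_ext {M : Type*} [AddCommGroup M] [Module K M] {f g : DivPow K ι →ₗ[K] M}
    (h : ∀ r, f (mon r) = g (mon r)) : f = g :=
  Finsupp.lhom_ext' fun r => LinearMap.ext_ring (h r)

theorem span_mon : Submodule.span K (Set.range (mon : (ι → ℕ) → DivPow K ι)) = ⊤ := by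
  rw [eq_top_iff]
  intro f _
  have h : f = Finsupp.linearCombination K (mon : (ι → ℕ) → DivPow K ι) f := by
    have : (LinearMap.id : DivPow K ι →ₗ[K] DivPow K ι) = lift mon := hom_ext fun r => by
      rw [lift_mon]; rfl
    exact LinearMap.congr_fun this f
  rw [h]
  exact (Finsupp.mem_span_range_iff_exists_finsupp).2 ⟨f, rfl⟩

variable [Fintype ι]

/-- The multiplication: `u^(r) * u^(s) = ∏ i, (r i + s i choose r i) • u^(r + s)`. -/
def mulHom : DivPow K ι →ₗ[K] DivPow K ι →ₗ[K] DivPow K ι :=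
  lift fun r => lift fun s => ((∏ i, (r i + s i).choose (r i) : ℕ) : K) • mon (r + s)

instance : Mul (DivPow K ι) := ⟨fun f g => mulHom f g⟩

instance : One (DivPow K ι) := ⟨mon 0⟩

theorem mul_def (f g : DivPow K ι) : f * g = mulHom f g := rfl

theorem one_def : (1 : DivPow K ι) = mon 0 := rfl

theorem mon_mul_mon (r s : ι → ℕ) : (mon r * mon s : DivPow K ι) =
    ((∏ i, (r i + s i).choose (r i) : ℕ) : K) • mon (r + s) := by
  rw [mul_def, mulHom, lift_mon, lift_mon]

theorem mul_comm' (f g : DivPow K ι) : f * g = g * f := by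
  have : (mulHom : DivPow K ι →ₗ[K] _) = mulHom.flip := by
    refine hom_ext fun r => hom_ext fun s => ?_
    change mon r * mon s = mon s * mon r
    rw [mon_mul_mon, mon_mul_mon, add_comm s r]
    congr 2
    refine Finset.prod_congr rfl fun i _ => ?_
    rw [add_comm (s i), ← Nat.choose_symm_add]
  exact LinearMap.congr_fun (LinearMap.congr_fun this f) g

theorem one_mul' (f : DivPow K ι) : 1 * f = f := by
  have : mulHom (1 : DivPow K ι) = LinearMap.id := by
    refine hom_ext fun r => ?_
    change mon 0 * mon r = mon r
    rw [mon_mul_mon]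
    simp
  exact LinearMap.congr_fun this f

theorem choose_assoc (a b c : ℕ) : (a + b).choose a * (a + b + c).choose (a + b) =
    (b + c).choose b * (a + (b + c)).choose a := by
  have h := Nat.choose_mul (n := a + b + c) (k := a + b) (s := a) (by omega)
  rw [mul_comm, h, mul_comm, show a + b + c - a = b + c by omega, show a + b - a = b by omega,
    add_assoc]

theorem mul_assoc' (f g h : DivPow K ι) : f * g * h = f * (g * h) := by
  have key : ∀ r s t : ι → ℕ, (mon r * mon s * mon t : DivPow K ι) = mon r * (mon s * mon t) := by
    intro r s t
    rw [mon_mul_mon, mon_mul_mon, mul_def, map_smul, LinearMap.smul_apply, ← mul_def, mon_mul_mon,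
      mul_def (mon r), map_smul, ← mul_def, mon_mul_mon, smul_smul, smul_smul, add_assoc]
    congr 1
    rw [← Nat.cast_mul, ← Nat.cast_mul, ← Finset.prod_mul_distrib, ← Finset.prod_mul_distrib]
    congr 1
    exact Finset.prod_congr rfl fun i _ => choose_assoc _ _ _
  have h1 : ∀ r s, mulHom (mon r * mon s : DivPow K ι) =
      (mulHom (mon r)).comp (mulHom (mon s)) := fun r s => hom_ext fun t => key r s t
  have h2 : ∀ r, mulHom.comp (mulHom (mon r : DivPow K ι)) =
      (LinearMap.llcomp K _ _ _ (mulHom (mon r))).comp mulHom := fun r => hom_ext fun s => h1 r s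
  have h3 : mulHom.compr₂ (mulHom (K := K) (ι := ι)) =
      (LinearMap.lcomp K _ mulHom).comp ((LinearMap.llcomp K _ _ _).comp mulHom) :=
    hom_ext fun r => h2 r
  exact LinearMap.congr_fun (LinearMap.congr_fun (LinearMap.congr_fun h3 f) g) h

instance : CommRing (DivPow K ι) where
  __ := (inferInstance : AddCommGroup (DivPow K ι))
  mul := (· * ·)
  one := 1
  mul_assoc := mul_assoc'
  one_mul := one_mul'
  mul_one f := by rw [mul_comm', one_mul']
  left_distrib f g h := map_add (mulHom f) g h
  right_distrib f g h := by rw [mul_def, map_add]; rfl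
  zero_mul f := by rw [mul_def, map_zero]; rfl
  mul_zero f := map_zero (mulHom f)
  mul_comm := mul_comm'

instance : Algebra K (DivPow K ι) :=
  Algebra.ofModule (fun a f g => by rw [mul_def, map_smul]; rfl) (fun a f g => map_smul (mulHom f) a g)

variable [DecidableEq ι]

/-- The linear map `u^(r) ↦ u^(r - e_i)`, read as `0` if `r i = 0`. -/
def pdHom (i : ι) : DivPow K ι →ₗ[K] DivPow K ι :=
  lift fun r => if r i = 0 then 0 else mon (r - Pi.single i 1)

theorem pdHom_mon (i : ι) (r : ι → ℕ) : pdHom i (mon r : DivPow K ι) =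
    if r i = 0 then 0 else mon (r - Pi.single i 1) := lift_mon _ _

theorem pd_leibniz_mon (i : ι) (r s : ι → ℕ) : pdHom i (mon r * mon s : DivPow K ι) =
    mon r * pdHom i (mon s) + mon s * pdHom i (mon r) := by
  have hsplit : ∀ r s : ι → ℕ, (∏ j, (r j + s j).choose (r j)) =
      (r i + s i).choose (r i) * ∏ j ∈ Finset.univ.erase i, (r j + s j).choose (r j) :=
    fun r s => (Finset.mul_prod_erase _ _ (Finset.mem_univ i)).symm
  have hoff : ∀ r s : ι → ℕ, ∏ j ∈ Finset.univ.erase i,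
      (r j + (s - Pi.single i 1 : ι → ℕ) j).choose (r j) =
      ∏ j ∈ Finset.univ.erase i, (r j + s j).choose (r j) := by
    intro r s
    refine Finset.prod_congr rfl fun j hj => ?_
    simp [Pi.single_eq_of_ne (Finset.ne_of_mem_erase hj)]
  have hadd : ∀ r s : ι → ℕ, s i ≠ 0 → r + (s - Pi.single i 1) = r + s - Pi.single i 1 := by
    intro r s h
    funext j
    by_cases hj : j = i
    · subst hj; simp; omega
    · simp [Pi.single_eq_of_ne hj]
  have hterm : ∀ r s : ι → ℕ, (mon r * pdHom i (mon s) : DivPow K ι) =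
      (((if s i = 0 then 0 else (r i + (s i - 1)).choose (r i)) *
        ∏ j ∈ Finset.univ.erase i, (r j + s j).choose (r j) : ℕ) : K) •
        mon (r + s - Pi.single i 1) := by
    intro r s
    rw [pdHom_mon]
    split_ifs with h
    · rw [mul_def, map_zero]; simp
    · rw [mon_mul_mon, hadd r s h, hsplit, hoff]
      simp
  rw [hterm, hterm, mon_mul_mon, map_smul, pdHom_mon, add_comm s r, ← add_smul, hsplit]
  have hsymm : ∏ j ∈ Finset.univ.erase i, (s j + r j).choose (s j) =
      ∏ j ∈ Finset.univ.erase i, (r j + s j).choose (r j) :=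
    Finset.prod_congr rfl fun j _ => by rw [add_comm (s j), ← Nat.choose_symm_add]
  rw [hsymm, ← Nat.cast_add, ← add_mul]
  have hpas : ∀ a b : ℕ, a + b ≠ 0 → (a + b).choose a =
      (if b = 0 then 0 else (a + (b - 1)).choose a) +
      (if a = 0 then 0 else (b + (a - 1)).choose b) := by
    intro a b h
    rcases a with _ | a
    · rcases b with _ | b
      · simp at h
      · simp
    · rcases b with _ | b
      · simp
      · have e := Nat.choose_symm_add (a := a) (b := b + 1)
        have e1 : a + 1 + (b + 1) = (a + (b + 1)) + 1 := by ring
        rw [e1, Nat.choose_succ_succ', e]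
        simp only [Nat.add_eq_zero_iff, one_ne_zero, and_false, if_false, Nat.add_sub_cancel]
        rw [show a + 1 + b = a + (b + 1) by ring, show b + 1 + a = a + (b + 1) by ring]
        ring
  by_cases h : r i + s i = 0
  · have h1 : r i = 0 := by omega
    have h2 : s i = 0 := by omega
    simp [h1, h2]
  · rw [hpas _ _ h, if_neg (show ¬ (r + s) i = 0 from h)]

/-- The distinguished partial derivative `∂_i`, with `∂_i (u_j^(k)) = δ_ij u_j^(k-1)`. -/
def pd (i : ι) : Derivation K (DivPow K ι) (DivPow K ι) :=
  Derivation.mk' (pdHom i) fun f g => by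
    have h : mulHom.compr₂ (pdHom i : DivPow K ι →ₗ[K] _) =
        mulHom.compl₂ (pdHom i) + (mulHom.compl₂ (pdHom i)).flip :=
      hom_ext fun r => hom_ext fun s => pd_leibniz_mon i r s
    exact LinearMap.congr_fun (LinearMap.congr_fun h f) g

theorem pd_mon (i : ι) (r : ι → ℕ) : pd i (mon r : DivPow K ι) =
    if r i = 0 then 0 else mon (r - Pi.single i 1) := pdHom_mon i r

theorem pd_comm (i j : ι) (f : DivPow K ι) : pd i (pd j f) = pd j (pd i f) := by
  have h : (pdHom i : DivPow K ι →ₗ[K] DivPow K ι).comp (pdHom j) =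
      (pdHom j).comp (pdHom i) := by
    refine hom_ext fun r => ?_
    change pd i (pd j (mon r)) = pd j (pd i (mon r))
    by_cases hij : i = j
    · subst hij; rfl
    · rw [pd_mon, pd_mon]
      split_ifs with h1 h2 h2
      · simp
      · rw [map_zero, pd_mon, if_pos]
        simp [h1]
      · rw [map_zero, pd_mon, if_pos]
        simp [h2]
      · rw [pd_mon, pd_mon, if_neg, if_neg, tsub_right_comm]
        · simpa [Pi.single_eq_of_ne (Ne.symm hij)] using h1
        · simpa [Pi.single_eq_of_ne hij] using h2
  exact LinearMap.congr_fun h f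

variable (K)

/-- The exponents `r` with `r i < 2 ^ N i` for all `i` (no condition at `i` if `N i = ∞`). -/
def Bounded (N : ι → WithTop ℕ+) : Set (ι → ℕ) :=
  {r | ∀ i, ∀ n : ℕ+, N i = n → r i < 2 ^ (n : ℕ)}

theorem even_choose {n a b : ℕ} (ha : a < 2 ^ n) (hb : b < 2 ^ n) (hab : 2 ^ n ≤ a + b) :
    2 ∣ (a + b).choose a := by
  have hn : n ≠ 0 := by
    rintro rfl
    simp at ha hb
    subst ha; subst hb
    simp at hab
  refine Nat.dvd_of_factorization_pos ?_
  rw [add_comm a b, Nat.factorization_choose' Nat.prime_two (b := Nat.log 2 (b + a) + 1) (by omega)]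
  refine (Finset.card_pos.2 ⟨n, ?_⟩).ne'
  rw [Finset.mem_filter, Finset.mem_Ico, Nat.mod_eq_of_lt ha, Nat.mod_eq_of_lt hb]
  refine ⟨⟨by omega, Nat.lt_succ_of_le ?_⟩, hab⟩
  exact (Nat.le_log_iff_pow_le (by norm_num) (by omega)).2 (by omega)

variable [CharP K 2]

/-- The divided power algebra `O(N)`: the span of the `u^(r)` with `r i < 2 ^ N i`. -/
def trunc (N : ι → WithTop ℕ+) : Subalgebra K (DivPow K ι) :=
  (Submodule.span K (mon '' Bounded N)).toSubalgebra
    (Submodule.subset_span ⟨0, fun i n _ => by simp, rfl⟩)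
    (fun f g hf hg => by
      induction hf using Submodule.span_induction with
      | zero => rw [zero_mul]; exact Submodule.zero_mem _
      | add f f' _ _ h h' => rw [add_mul]; exact Submodule.add_mem _ h h'
      | smul a f _ h => rw [smul_mul_assoc]; exact Submodule.smul_mem _ _ h
      | mem f hf =>
        obtain ⟨r, hr, rfl⟩ := hf
        induction hg using Submodule.span_induction with
        | zero => rw [mul_zero]; exact Submodule.zero_mem _
        | add f f' _ _ h h' => rw [mul_add]; exact Submodule.add_mem _ h h'
        | smul a f _ h => rw [mul_smul_comm]; exact Submodule.smul_mem _ _ h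
        | mem g hg =>
          obtain ⟨s, hs, rfl⟩ := hg
          rw [mon_mul_mon]
          by_cases h : r + s ∈ Bounded N
          · exact Submodule.smul_mem _ _ (Submodule.subset_span ⟨_, h, rfl⟩)
          · simp only [Bounded, Set.mem_ofPred_eq, not_forall] at h
            obtain ⟨i, n, hN, hlt⟩ := h
            have h2 : 2 ∣ ∏ j, (r j + s j).choose (r j) :=
              (even_choose (hr i n hN) (hs i n hN) (not_lt.1 hlt)).trans
                (Finset.dvd_prod_of_mem _ (Finset.mem_univ i))
            rw [(CharP.cast_eq_zero_iff K 2 _).2 h2, zero_smul]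
            exact Submodule.zero_mem _)

theorem mon_mem_trunc {N : ι → WithTop ℕ+} {r : ι → ℕ} (h : r ∈ Bounded N) :
    (mon r : DivPow K ι) ∈ trunc K N := Submodule.subset_span ⟨r, h, rfl⟩

theorem map_trunc_le {M : Type*} [AddCommGroup M] [Module K M] {N : ι → WithTop ℕ+}
    (l : DivPow K ι →ₗ[K] M) (P : Submodule K M) (h : ∀ r ∈ Bounded N, l (mon r) ∈ P)
    {f : DivPow K ι} (hf : f ∈ trunc K N) : l f ∈ P := by
  have : Submodule.span K (mon '' Bounded N) ≤ P.comap l := by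
    rw [Submodule.span_le]
    rintro _ ⟨r, hr, rfl⟩
    exact h r hr
  exact this hf

end DivPow

section Fields

variable (K : Type*) [Field K] [CharP K 2] {ι : Type*} [Fintype ι] [DecidableEq ι]

/-- `O(N)`, the divided power algebra with shearing vector `N`. -/
def O (N : ι → WithTop ℕ+) : Type _ := ↥(DivPow.trunc K N)

instance (N : ι → WithTop ℕ+) : CommRing (O K N) := inferInstanceAs (CommRing ↥(DivPow.trunc K N))

instance (N : ι → WithTop ℕ+) : Algebra K (O K N) :=
  inferInstanceAs (Algebra K ↥(DivPow.trunc K N))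

/-- The derivations of `O(N)`. -/
abbrev Der (N : ι → WithTop ℕ+) : Type _ := Derivation K (O K N) (O K N)

variable {K}
variable {N : ι → WithTop ℕ+}

/-- The inclusion of `O(N)` into the algebra of all divided power polynomials. -/
def O.val : O K N →ₐ[K] DivPow K ι := (DivPow.trunc K N).val

theorem O.val_mem (f : O K N) : O.val f ∈ DivPow.trunc K N := Subtype.property f

theorem O.ext {f g : O K N} (h : O.val f = O.val g) : f = g := Subtype.ext h

/-- An element of `O(N)`, from a divided power polynomial that lies in `O(N)`. -/
def O.mk (f : DivPow K ι) (hf : f ∈ DivPow.trunc K N) : O K N := ⟨f, hf⟩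

theorem O.val_mk (f : DivPow K ι) (hf : f ∈ DivPow.trunc K N) : O.val (O.mk f hf) = f := rfl

theorem O.induction {P : O K N → Prop}
    (hm : ∀ (r : ι → ℕ) (h : r ∈ DivPow.Bounded N), P (O.mk (DivPow.mon r) (DivPow.mon_mem_trunc K h)))
    (ha : ∀ f g, P f → P g → P (f + g)) (hs : ∀ (a : K) f, P f → P (a • f)) (f : O K N) : P f := by
  obtain ⟨f, hf⟩ := f
  have hf' : f ∈ Submodule.span K (DivPow.mon '' DivPow.Bounded N) := hf
  induction hf' using Submodule.span_induction with
  | zero =>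
    have h0 : (0 : ι → ℕ) ∈ DivPow.Bounded N := fun i n _ => by simp
    have := hs 0 _ (hm 0 h0)
    rwa [zero_smul] at this
  | add f g h1 h2 ih1 ih2 => exact ha (O.mk f h1) (O.mk g h2) (ih1 h1) (ih2 h2)
  | smul a f h ih => exact hs a (O.mk f h) (ih h)
  | mem f h =>
    obtain ⟨r, hr, rfl⟩ := h
    exact hm r hr

theorem DivPow.pd_mem_trunc (i : ι) {f : DivPow K ι} (hf : f ∈ DivPow.trunc K N) :
    DivPow.pd i f ∈ DivPow.trunc K N := by
  refine DivPow.map_trunc_le K (DivPow.pd i).toLinearMap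
    (Subalgebra.toSubmodule (DivPow.trunc K N)) (fun r hr => ?_) hf
  change DivPow.pd i (DivPow.mon r) ∈ DivPow.trunc K N
  rw [DivPow.pd_mon]
  split_ifs
  · exact Subalgebra.zero_mem _
  · refine DivPow.mon_mem_trunc K fun j n hn => lt_of_le_of_lt ?_ (hr j n hn)
    simp

/-- The underlying linear map of `∂_i` on `O(N)`. -/
def pdLin (i : ι) : O K N →ₗ[K] O K N where
  toFun f := O.mk (DivPow.pd i (O.val f)) (DivPow.pd_mem_trunc i (O.val_mem f))
  map_add' f g := O.ext (by
    rw [O.val_mk, map_add O.val, map_add O.val, O.val_mk, O.val_mk, map_add (DivPow.pd i)])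
  map_smul' a f := O.ext (by
    rw [O.val_mk, map_smul O.val, RingHom.id_apply, map_smul O.val, O.val_mk,
      Derivation.map_smul (DivPow.pd i)])

theorem pdLin_val (i : ι) (f : O K N) : O.val (pdLin i f) = DivPow.pd i (O.val f) := rfl

/-- The distinguished partial derivative `∂_i` on `O(N)`. -/
def pd (i : ι) : Der K N :=
  Derivation.mk' (pdLin i) fun f g => O.ext (by
    rw [pdLin_val, map_mul O.val, Derivation.leibniz (DivPow.pd i), map_add O.val, smul_eq_mul,
      smul_eq_mul, smul_eq_mul, smul_eq_mul, map_mul O.val, map_mul O.val, pdLin_val, pdLin_val])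

theorem pd_val (i : ι) (f : O K N) : O.val (pd i f) = DivPow.pd i (O.val f) := rfl

theorem pd_comm (i j : ι) (f : O K N) : pd i (pd j f) = pd j (pd i f) :=
  O.ext (by rw [pd_val, pd_val, pd_val, pd_val, DivPow.pd_comm])

theorem single_mem_bounded (N : ι → WithTop ℕ+) (i : ι) :
    (Pi.single i 1 : ι → ℕ) ∈ DivPow.Bounded N := by
  intro j n _
  refine lt_of_le_of_lt ?_ (Nat.one_lt_two_pow n.ne_zero)
  by_cases h : j = i
  · subst h; simp
  · simp [Pi.single_eq_of_ne h]

/-- The indeterminate `u_i`. -/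
def X (i : ι) : O K N :=
  O.mk (DivPow.mon (Pi.single i 1)) (DivPow.mon_mem_trunc K (single_mem_bounded N i))

theorem pd_X (i j : ι) : pd i (X j : O K N) = if i = j then 1 else 0 := by
  refine O.ext ?_
  rw [pd_val, X, O.val_mk, DivPow.pd_mon]
  by_cases h : i = j
  · subst h
    rw [if_pos rfl, map_one, DivPow.one_def]
    simp
  · rw [if_pos (by simp [Pi.single_eq_of_ne h]), if_neg h, map_zero]

theorem sum_smul_pd_apply (f : ι → O K N) (a : O K N) :
    (∑ i, f i • (pd i : Der K N)) a = ∑ i, f i * pd i a := by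
  have h := map_sum (Derivation.coeFnAddMonoidHom (R := K) (A := O K N) (M := O K N))
    (fun i => f i • (pd i : Der K N)) Finset.univ
  have h' := congrFun h a
  rw [Finset.sum_apply] at h'
  exact h'

theorem sum_smul_pd_X (f : ι → O K N) (j : ι) : (∑ i, f i • (pd i : Der K N)) (X j) = f j := by
  rw [sum_smul_pd_apply]
  simp [pd_X]

variable (K N) in
/-- `vect(N)`: the Lie algebra of vector fields `∑ f_i ∂_i` with `f_i ∈ O(N)`. -/
def vect : LieSubalgebra K (Der K N) where
  carrier := {D | ∃ f : ι → O K N, D = ∑ i, f i • pd i}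
  add_mem' := by
    rintro _ _ ⟨f, rfl⟩ ⟨g, rfl⟩
    exact ⟨f + g, by simp [add_smul, Finset.sum_add_distrib]⟩
  zero_mem' := ⟨0, by simp⟩
  smul_mem' := by
    rintro a _ ⟨f, rfl⟩
    exact ⟨a • f, by simp [Finset.smul_sum]⟩
  lie_mem' := by
    rintro D E ⟨f, hf⟩ ⟨g, hg⟩
    refine ⟨fun k => D (g k) - E (f k), ?_⟩
    refine Derivation.ext fun a => ?_
    have hD : ∀ a, D a = ∑ i, f i * pd i a := fun a => by rw [hf, sum_smul_pd_apply]
    have hE : ∀ a, E a = ∑ i, g i * pd i a := fun a => by rw [hg, sum_smul_pd_apply]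
    rw [sum_smul_pd_apply, Derivation.commutator_apply]
    have h1 : D (E a) = ∑ k, (D (g k) * pd k a + g k * D (pd k a)) := by
      rw [hE a, map_sum]
      refine Finset.sum_congr rfl fun k _ => ?_
      rw [Derivation.leibniz, smul_eq_mul, smul_eq_mul]; ring
    have h2 : E (D a) = ∑ k, (E (f k) * pd k a + f k * E (pd k a)) := by
      rw [hD a, map_sum]
      refine Finset.sum_congr rfl fun k _ => ?_
      rw [Derivation.leibniz, smul_eq_mul, smul_eq_mul]; ring
    have h3 : ∑ k, g k * D (pd k a) = ∑ k, f k * E (pd k a) := by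
      simp only [hD, hE, Finset.mul_sum]
      rw [Finset.sum_comm]
      refine Finset.sum_congr rfl fun k _ => Finset.sum_congr rfl fun l _ => ?_
      rw [pd_comm k l]; ring
    rw [h1, h2, Finset.sum_add_distrib, Finset.sum_add_distrib, h3, add_sub_add_right_eq_sub,
      ← Finset.sum_sub_distrib]
    exact Finset.sum_congr rfl fun k _ => by ring

theorem vect_apply {D : Der K N} (hD : D ∈ vect K N) (a : O K N) :
    D a = ∑ i, D (X i) * pd i a := by
  obtain ⟨f, rfl⟩ := hD
  rw [sum_smul_pd_apply]
  exact Finset.sum_congr rfl fun i _ => by rw [sum_smul_pd_X]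

theorem pd_vect {D : Der K N} (hD : D ∈ vect K N) (i : ι) (a : O K N) :
    pd i (D a) = D (pd i a) + ∑ k, pd i (D (X k)) * pd k a := by
  rw [vect_apply hD a, vect_apply hD (pd i a), map_sum, ← Finset.sum_add_distrib]
  refine Finset.sum_congr rfl fun k _ => ?_
  rw [Derivation.leibniz, smul_eq_mul, smul_eq_mul, pd_comm i k]; ring

/-- The divergence `∑ ∂_i f_i` of `D = ∑ f_i ∂_i`; note `f_i = D u_i`. -/
def div (D : Der K N) : O K N := ∑ i, pd i (D (X i))

theorem div_lie {D E : Der K N} (hD : D ∈ vect K N) (hE : E ∈ vect K N) :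
    div ⁅D, E⁆ = D (div E) - E (div D) := by
  have h1 : ∀ {D E : Der K N}, D ∈ vect K N → ∑ i, pd i (D (E (X i))) =
      D (div E) + ∑ i, ∑ k, pd i (D (X k)) * pd k (E (X i)) := by
    intro D E hD
    rw [div, map_sum, ← Finset.sum_add_distrib]
    exact Finset.sum_congr rfl fun i _ => pd_vect hD i _
  have h2 : div ⁅D, E⁆ = ∑ i, pd i (D (E (X i))) - ∑ i, pd i (E (D (X i))) := by
    rw [div, ← Finset.sum_sub_distrib]
    exact Finset.sum_congr rfl fun i _ => by rw [Derivation.commutator_apply, map_sub]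
  rw [h2, h1 hD, h1 hE, Finset.sum_comm]
  have h3 : ∑ y, ∑ x, pd x (D (X y)) * pd y (E (X x)) =
      ∑ i, ∑ k, pd i (E (X k)) * pd k (D (X i)) :=
    Finset.sum_congr rfl fun i _ => Finset.sum_congr rfl fun k _ => mul_comm _ _
  rw [h3]; ring

variable (K N) in
/-- `svect(N)`: the Lie algebra of divergence-free vector fields. -/
def svect : LieSubalgebra K (Der K N) where
  carrier := {D | D ∈ vect K N ∧ div D = 0}
  add_mem' := by
    rintro D E ⟨hD, hD'⟩ ⟨hE, hE'⟩
    refine ⟨(vect K N).add_mem hD hE, ?_⟩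
    have : div (D + E) = div D + div E := by simp [div, Finset.sum_add_distrib]
    rw [this, hD', hE', add_zero]
  zero_mem' := ⟨(vect K N).zero_mem, by simp [div]⟩
  smul_mem' := by
    rintro a D ⟨hD, hD'⟩
    refine ⟨(vect K N).smul_mem a hD, ?_⟩
    have : div (a • D) = a • div D := by simp [div, Finset.smul_sum]
    rw [this, hD', smul_zero]
  lie_mem' := by
    rintro D E ⟨hD, hD'⟩ ⟨hE, hE'⟩
    exact ⟨(vect K N).lie_mem hD hE, by rw [div_lie hD hE, hD', hE', map_zero, map_zero, sub_zero]⟩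

end Fields

/-! ### Dimension five -/

section Algebra5

variable {A : Type*} [CommRing A]

/-- The coefficient of `∂_m` in the vector field corresponding to the 4-form `ω ∧ ω'` divided by
the volume form, where `du_a ∧ du_b ∧ du_c ∧ du_d` corresponds to `sign (a b c d m) ∂_m`. A 2-form is
given by its array of coefficients. -/
def wedgeCoeff (ω ω' : Fin 5 → Fin 5 → A) (m : Fin 5) : A :=
  let a := m.succAbove 0
  let b := m.succAbove 1
  let c := m.succAbove 2
  let d := m.succAbove 3
  (-1) ^ (m : ℕ) * (ω a b * ω' c d - ω a c * ω' b d + ω a d * ω' b c + ω b c * ω' a d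
    - ω b d * ω' a c + ω c d * ω' a b)

theorem wedgeCoeff_comm (ω ω' : Fin 5 → Fin 5 → A) (m : Fin 5) :
    wedgeCoeff ω ω' m = wedgeCoeff ω' ω m := by
  simp only [wedgeCoeff]; ring

theorem wedgeCoeff_self (h2 : (2 : A) = 0) (ω : Fin 5 → Fin 5 → A) (m : Fin 5) :
    wedgeCoeff ω ω m = 0 := by
  simp only [wedgeCoeff]
  linear_combination ((-1) ^ (m : ℕ) * (ω (m.succAbove 0) (m.succAbove 1) *
    ω (m.succAbove 2) (m.succAbove 3) - ω (m.succAbove 0) (m.succAbove 2) *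
    ω (m.succAbove 1) (m.succAbove 3) + ω (m.succAbove 0) (m.succAbove 3) *
    ω (m.succAbove 1) (m.succAbove 2))) * h2

theorem wedgeCoeff_values (ω ω' : Fin 5 → Fin 5 → A) :
    wedgeCoeff ω ω' 0 = ω 1 2 * ω' 3 4 - ω 1 3 * ω' 2 4 + ω 1 4 * ω' 2 3 + ω 2 3 * ω' 1 4
      - ω 2 4 * ω' 1 3 + ω 3 4 * ω' 1 2 ∧
    wedgeCoeff ω ω' 1 = -(ω 0 2 * ω' 3 4 - ω 0 3 * ω' 2 4 + ω 0 4 * ω' 2 3 + ω 2 3 * ω' 0 4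
      - ω 2 4 * ω' 0 3 + ω 3 4 * ω' 0 2) ∧
    wedgeCoeff ω ω' 2 = ω 0 1 * ω' 3 4 - ω 0 3 * ω' 1 4 + ω 0 4 * ω' 1 3 + ω 1 3 * ω' 0 4
      - ω 1 4 * ω' 0 3 + ω 3 4 * ω' 0 1 ∧
    wedgeCoeff ω ω' 3 = -(ω 0 1 * ω' 2 4 - ω 0 2 * ω' 1 4 + ω 0 4 * ω' 1 2 + ω 1 2 * ω' 0 4
      - ω 1 4 * ω' 0 2 + ω 2 4 * ω' 0 1) ∧
    wedgeCoeff ω ω' 4 = ω 0 1 * ω' 2 3 - ω 0 2 * ω' 1 3 + ω 0 3 * ω' 1 2 + ω 1 2 * ω' 0 3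
      - ω 1 3 * ω' 0 2 + ω 2 3 * ω' 0 1 := by
  have e0 : (0 : Fin 5).succAbove (0 : Fin 4) = 1 ∧ (0 : Fin 5).succAbove (1 : Fin 4) = 2 ∧
    (0 : Fin 5).succAbove (2 : Fin 4) = 3 ∧ (0 : Fin 5).succAbove (3 : Fin 4) = 4 := by decide
  have e1 : (1 : Fin 5).succAbove (0 : Fin 4) = 0 ∧ (1 : Fin 5).succAbove (1 : Fin 4) = 2 ∧
    (1 : Fin 5).succAbove (2 : Fin 4) = 3 ∧ (1 : Fin 5).succAbove (3 : Fin 4) = 4 := by decide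
  have e2 : (2 : Fin 5).succAbove (0 : Fin 4) = 0 ∧ (2 : Fin 5).succAbove (1 : Fin 4) = 1 ∧
    (2 : Fin 5).succAbove (2 : Fin 4) = 3 ∧ (2 : Fin 5).succAbove (3 : Fin 4) = 4 := by decide
  have e3 : (3 : Fin 5).succAbove (0 : Fin 4) = 0 ∧ (3 : Fin 5).succAbove (1 : Fin 4) = 1 ∧
    (3 : Fin 5).succAbove (2 : Fin 4) = 2 ∧ (3 : Fin 5).succAbove (3 : Fin 4) = 4 := by decide
  have e4 : (4 : Fin 5).succAbove (0 : Fin 4) = 0 ∧ (4 : Fin 5).succAbove (1 : Fin 4) = 1 ∧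
    (4 : Fin 5).succAbove (2 : Fin 4) = 2 ∧ (4 : Fin 5).succAbove (3 : Fin 4) = 3 := by decide
  obtain ⟨a0, a1, a2, a3⟩ := e0
  obtain ⟨b0, b1, b2, b3⟩ := e1
  obtain ⟨c0, c1, c2, c3⟩ := e2
  obtain ⟨d0, d1, d2, d3⟩ := e3
  obtain ⟨f0, f1, f2, f3⟩ := e4
  refine ⟨?_, ?_, ?_, ?_, ?_⟩
  · simp only [wedgeCoeff, a0, a1, a2, a3]; simp
  · simp only [wedgeCoeff, b0, b1, b2, b3]; simp
  · simp only [wedgeCoeff, c0, c1, c2, c3]; simp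
  · simp only [wedgeCoeff, d0, d1, d2, d3]; norm_num
  · simp only [wedgeCoeff, f0, f1, f2, f3]; norm_num

/-- Antisymmetric arrays with zero diagonal. -/
def IsAlt (ω : Fin 5 → Fin 5 → A) : Prop := (∀ i, ω i i = 0) ∧ ∀ i j, ω i j = -ω j i

theorem IsAlt.lower {ω : Fin 5 → Fin 5 → A} (h : IsAlt ω) :
    (ω 0 0 = 0 ∧ ω 1 1 = 0 ∧ ω 2 2 = 0 ∧ ω 3 3 = 0 ∧ ω 4 4 = 0) ∧
    (ω 1 0 = -ω 0 1 ∧ ω 2 0 = -ω 0 2 ∧ ω 3 0 = -ω 0 3 ∧ ω 4 0 = -ω 0 4 ∧ ω 2 1 = -ω 1 2) ∧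
    (ω 3 1 = -ω 1 3 ∧ ω 4 1 = -ω 1 4 ∧ ω 3 2 = -ω 2 3 ∧ ω 4 2 = -ω 2 4 ∧ ω 4 3 = -ω 3 4) :=
  ⟨⟨h.1 _, h.1 _, h.1 _, h.1 _, h.1 _⟩, ⟨h.2 _ _, h.2 _ _, h.2 _ _, h.2 _ _, h.2 _ _⟩,
    ⟨h.2 _ _, h.2 _ _, h.2 _ _, h.2 _ _, h.2 _ _⟩⟩

theorem contract_cyclic {x y z : Fin 5 → Fin 5 → A} (hx : IsAlt x) (hy : IsAlt y) (hz : IsAlt z)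
    (j : Fin 5) : ∑ k, wedgeCoeff y z k * x k j + ∑ k, wedgeCoeff z x k * y k j +
      ∑ k, wedgeCoeff x y k * z k j = 0 := by
  obtain ⟨⟨x1, x2, x3, x4, x5⟩, ⟨x6, x7, x8, x9, x10⟩, ⟨x11, x12, x13, x14, x15⟩⟩ := hx.lower
  obtain ⟨⟨y1, y2, y3, y4, y5⟩, ⟨y6, y7, y8, y9, y10⟩, ⟨y11, y12, y13, y14, y15⟩⟩ := hy.lower
  obtain ⟨⟨z1, z2, z3, z4, z5⟩, ⟨z6, z7, z8, z9, z10⟩, ⟨z11, z12, z13, z14, z15⟩⟩ := hz.lower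
  simp only [Fin.sum_univ_five]
  obtain ⟨p0, p1, p2, p3, p4⟩ := wedgeCoeff_values y z
  obtain ⟨q0, q1, q2, q3, q4⟩ := wedgeCoeff_values z x
  obtain ⟨r0, r1, r2, r3, r4⟩ := wedgeCoeff_values x y
  rw [p0, p1, p2, p3, p4, q0, q1, q2, q3, q4, r0, r1, r2, r3, r4]
  fin_cases j <;>
  simp only [Fin.zero_eta, Fin.mk_one, Fin.reduceFinMk, x1, x2, x3, x4, x5, x6, x7, x8, x9, x10,
    x11, x12, x13, x14, x15, y1, y2, y3, y4, y5, y6, y7, y8, y9, y10, y11, y12, y13, y14, y15,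
    z1, z2, z3, z4, z5, z6, z7, z8, z9, z10, z11, z12, z13, z14, z15] <;>
  ring

/-- The infinitesimal action of a matrix `J` on arrays. -/
def matAct (J : Fin 5 → Fin 5 → A) (ω : Fin 5 → Fin 5 → A) (i j : Fin 5) : A :=
  ∑ k, (J i k * ω k j + J j k * ω i k)

theorem wedge_matAct {x y J : Fin 5 → Fin 5 → A} (hx : IsAlt x) (hy : IsAlt y)
    (hJ : ∑ i, J i i = 0) (m : Fin 5) :
    wedgeCoeff (matAct J x) y m + wedgeCoeff x (matAct J y) m = -∑ k, wedgeCoeff x y k * J k m := by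
  obtain ⟨⟨x1, x2, x3, x4, x5⟩, ⟨x6, x7, x8, x9, x10⟩, ⟨x11, x12, x13, x14, x15⟩⟩ := hx.lower
  obtain ⟨⟨y1, y2, y3, y4, y5⟩, ⟨y6, y7, y8, y9, y10⟩, ⟨y11, y12, y13, y14, y15⟩⟩ := hy.lower
  rw [Fin.sum_univ_five] at hJ
  obtain ⟨p0, p1, p2, p3, p4⟩ := wedgeCoeff_values (matAct J x) y
  obtain ⟨q0, q1, q2, q3, q4⟩ := wedgeCoeff_values x (matAct J y)
  obtain ⟨r0, r1, r2, r3, r4⟩ := wedgeCoeff_values x y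
  have key : wedgeCoeff (matAct J x) y m + wedgeCoeff x (matAct J y) m +
      ∑ k, wedgeCoeff x y k * J k m =
      wedgeCoeff x y m * (J 0 0 + J 1 1 + J 2 2 + J 3 3 + J 4 4) := by
    rw [Fin.sum_univ_five, r0, r1, r2, r3, r4]
    fin_cases m <;>
    simp only [Fin.zero_eta, Fin.mk_one, Fin.reduceFinMk, p0, p1, p2, p3, p4, q0, q1, q2, q3, q4,
      r0, r1, r2, r3, r4] <;>
    simp only [matAct, Fin.sum_univ_five,
      x1, x2, x3, x4, x5, x6, x7, x8, x9, x10,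
      x11, x12, x13, x14, x15, y1, y2, y3, y4, y5, y6, y7, y8, y9, y10, y11, y12, y13, y14, y15] <;>
    ring
  rw [hJ, mul_zero] at key
  exact eq_neg_of_add_eq_zero_left key

theorem perm3_sum {M : Type*} [AddCommMonoid M] (F : Fin 3 → Fin 3 → Fin 3 → M) :
    ∑ σ : Equiv.Perm (Fin 3), F (σ 0) (σ 1) (σ 2) =
      F 0 1 2 + F 0 2 1 + F 1 0 2 + F 1 2 0 + F 2 0 1 + F 2 1 0 := by
  have h : (Finset.univ : Finset (Equiv.Perm (Fin 3))) =
      {1, Equiv.swap 1 2, Equiv.swap 0 1, Equiv.swap 0 1 * Equiv.swap 1 2,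
        Equiv.swap 1 2 * Equiv.swap 0 1, Equiv.swap 0 2} := by decide
  have v : (Equiv.swap 1 2 : Equiv.Perm (Fin 3)) 0 = 0 ∧ (Equiv.swap 0 1 : Equiv.Perm (Fin 3)) 2 = 2 ∧
      (Equiv.swap 0 2 : Equiv.Perm (Fin 3)) 1 = 1 := by decide
  rw [h, Finset.sum_insert (by decide), Finset.sum_insert (by decide), Finset.sum_insert (by decide),
    Finset.sum_insert (by decide), Finset.sum_insert (by decide), Finset.sum_singleton]
  simp only [Equiv.Perm.mul_apply, Equiv.Perm.one_apply, Equiv.swap_apply_left,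
    Equiv.swap_apply_right, v.1, v.2.1, v.2.2, add_assoc]

end Algebra5

section

variable {K : Type*} [Field K] [CharP K 2] {ι : Type*} [Fintype ι] [DecidableEq ι]
variable {N : ι → WithTop ℕ+}

theorem two_eq_zero : (2 : O K N) = 0 := by
  have h : ((2 : K) • (1 : O K N)) = 0 := by rw [CharTwo.two_eq_zero, zero_smul]
  rw [← h, two_smul, one_add_one_eq_two]

theorem smul_pd_mem_vect (f : O K N) (i : ι) : f • (pd i : Der K N) ∈ vect K N := by
  refine ⟨Pi.single i f, ?_⟩
  rw [Finset.sum_eq_single i]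
  · rw [Pi.single_eq_same]
  · intro j _ hj
    rw [Pi.single_eq_of_ne hj, zero_smul]
  · intro h
    exact absurd (Finset.mem_univ i) h

theorem smul_pd_X (f : O K N) (i j : ι) : (f • (pd i : Der K N)) (X j) = if i = j then f else 0 := by
  rw [Derivation.smul_apply, pd_X]
  split_ifs <;> simp

theorem vect_ext {D E : Der K N} (hD : D ∈ vect K N) (hE : E ∈ vect K N)
    (h : ∀ k, D (X k) = E (X k)) : D = E :=
  Derivation.ext fun a => by
    rw [vect_apply hD, vect_apply hE]
    exact Finset.sum_congr rfl fun k _ => by rw [h]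

end

section Five

variable {K : Type*} [Field K] [CharP K 2] {N : Fin 5 → WithTop ℕ+}

/-- The vector field
`c(D, E) = ∑_{(i,j,k) ∈ S_3} (∂_i f_4 ∂_j g_5 + ∂_i f_5 ∂_j g_4) ∂_k` for `D = ∑ f_i ∂_i` and
`E = ∑ g_i ∂_i`; here `S_3` permutes the first three indices, and the indices of the five
indeterminates start at `0`. -/
def cField (D E : Der K N) : Der K N :=
  ∑ σ : Equiv.Perm (Fin 3),
    (pd ((σ 0).castLE (by norm_num)) (D (X 3)) * pd ((σ 1).castLE (by norm_num)) (E (X 4)) +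
      pd ((σ 0).castLE (by norm_num)) (D (X 4)) * pd ((σ 1).castLE (by norm_num)) (E (X 3))) •
    pd ((σ 2).castLE (by norm_num))

theorem cField_eq (D E : Der K N) : cField D E =
    (pd 1 (D (X 3)) * pd 2 (E (X 4)) + pd 1 (D (X 4)) * pd 2 (E (X 3)) +
      (pd 2 (D (X 3)) * pd 1 (E (X 4)) + pd 2 (D (X 4)) * pd 1 (E (X 3)))) • pd 0 +
    (pd 0 (D (X 3)) * pd 2 (E (X 4)) + pd 0 (D (X 4)) * pd 2 (E (X 3)) +
      (pd 2 (D (X 3)) * pd 0 (E (X 4)) + pd 2 (D (X 4)) * pd 0 (E (X 3)))) • pd 1 +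
    (pd 0 (D (X 3)) * pd 1 (E (X 4)) + pd 0 (D (X 4)) * pd 1 (E (X 3)) +
      (pd 1 (D (X 3)) * pd 0 (E (X 4)) + pd 1 (D (X 4)) * pd 0 (E (X 3)))) • pd 2 := by
  have h := perm3_sum (fun a b c : Fin 3 =>
    (pd (a.castLE (by norm_num)) (D (X 3)) * pd (b.castLE (by norm_num)) (E (X 4)) +
      pd (a.castLE (by norm_num)) (D (X 4)) * pd (b.castLE (by norm_num)) (E (X 3))) •
    (pd (c.castLE (by norm_num)) : Der K N))
  have c0 : Fin.castLE (show 3 ≤ 5 by norm_num) 0 = 0 := rfl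
  have c1 : Fin.castLE (show 3 ≤ 5 by norm_num) 1 = 1 := rfl
  have c2 : Fin.castLE (show 3 ≤ 5 by norm_num) 2 = 2 := rfl
  rw [cField, h]
  simp only [c0, c1, c2, add_smul]
  abel

theorem cField_mem (D E : Der K N) : cField D E ∈ svect K N := by
  rw [cField_eq]
  refine ⟨(vect K N).add_mem ((vect K N).add_mem (smul_pd_mem_vect _ _) (smul_pd_mem_vect _ _))
    (smul_pd_mem_vect _ _), ?_⟩
  have h2 : (2 : O K N) = 0 := two_eq_zero
  rw [div]
  simp only [Fin.sum_univ_five, Derivation.add_apply, smul_pd_X]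
  simp only [Fin.isValue, Fin.reduceEq, if_true, if_false, add_zero, zero_add, map_zero, map_add,
    Derivation.leibniz, smul_eq_mul]
  generalize D (X 3) = p
  generalize D (X 4) = q
  generalize E (X 3) = p'
  generalize E (X 4) = q'
  rw [pd_comm 1 0 p, pd_comm 1 0 q, pd_comm 1 0 p', pd_comm 1 0 q',
    pd_comm 2 0 p, pd_comm 2 0 q, pd_comm 2 0 p', pd_comm 2 0 q',
    pd_comm 2 1 p, pd_comm 2 1 q, pd_comm 2 1 p', pd_comm 2 1 q']
  linear_combination (pd 0 (pd 1 p) * pd 2 q' + pd 0 (pd 2 p) * pd 1 q' + pd 1 (pd 2 p) * pd 0 q' +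
    pd 0 (pd 1 q) * pd 2 p' + pd 0 (pd 2 q) * pd 1 p' + pd 1 (pd 2 q) * pd 0 p' +
    pd 0 (pd 1 p') * pd 2 q + pd 0 (pd 2 p') * pd 1 q + pd 1 (pd 2 p') * pd 0 q +
    pd 0 (pd 1 q') * pd 2 p + pd 0 (pd 2 q') * pd 1 p + pd 1 (pd 2 q') * pd 0 p) * h2

theorem cField_add_left (D D' E : Der K N) : cField (D + D') E = cField D E + cField D' E := by
  simp only [cField, Derivation.add_apply, map_add, ← Finset.sum_add_distrib, ← add_smul]
  refine Finset.sum_congr rfl fun σ _ => ?_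
  congr 1; ring

theorem cField_add_right (D E E' : Der K N) : cField D (E + E') = cField D E + cField D E' := by
  simp only [cField, Derivation.add_apply, map_add, ← Finset.sum_add_distrib, ← add_smul]
  refine Finset.sum_congr rfl fun σ _ => ?_
  congr 1; ring

theorem cField_smul_left (a : K) (D E : Der K N) : cField (a • D) E = a • cField D E := by
  simp only [cField, Derivation.smul_apply, Derivation.map_smul, Finset.smul_sum, smul_mul_assoc,
    ← smul_add, smul_assoc]

theorem cField_smul_right (a : K) (D E : Der K N) : cField D (a • E) = a • cField D E := by
  simp only [cField, Derivation.smul_apply, Derivation.map_smul, Finset.smul_sum, mul_smul_comm,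
    ← smul_add, smul_assoc]

theorem cField_self (D : Der K N) : cField D D = 0 := by
  have h2 : (2 : O K N) = 0 := two_eq_zero
  have h : ∀ a b c d : O K N, a * b + c * d + (d * c + b * a) = 0 := fun a b c d => by
    linear_combination (a * b + c * d) * h2
  rw [cField_eq, h, h, h, zero_smul, zero_smul, zero_smul, add_zero, add_zero]

variable (K N) in
/-- `c` as a 2-cochain of `svect(5; N)` with coefficients in the adjoint module. -/
def cCochain : LieModule.Cohomology.twoCochain K (svect K N) (svect K N) :=
  ⟨LinearMap.mk₂ K (fun D E => ⟨cField (D : Der K N) (E : Der K N), cField_mem _ _⟩)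
    (fun _ _ _ => Subtype.ext (cField_add_left _ _ _))
    (fun _ _ _ => Subtype.ext (cField_smul_left _ _ _))
    (fun _ _ _ => Subtype.ext (cField_add_right _ _ _))
    (fun _ _ _ => Subtype.ext (cField_smul_right _ _ _)),
  fun _ => Subtype.ext (cField_self _)⟩

variable (K N)

/-- Differential 1-forms `∑ α_i du_i`, given by their coefficients. -/
abbrev Form1 : Type _ := Fin 5 → O K N

/-- Arrays of coefficients `ω_ij` of 2-forms `∑_{i < j} ω_ij du_i ∧ du_j`. -/
abbrev Form2 : Type _ := Fin 5 → Fin 5 → O K N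

/-- The exterior differential of a 1-form. -/
def extD : Form1 K N →ₗ[K] Form2 K N where
  toFun α i j := pd i (α j) - pd j (α i)
  map_add' α β := by
    funext i j; simp only [Pi.add_apply, map_add]; ring
  map_smul' a α := by
    funext i j; simp only [Pi.smul_apply, Derivation.map_smul, RingHom.id_apply, smul_sub]

/-- `dΩ¹(5; N)`, the space of exact 2-forms. -/
def dOmega1 : Submodule K (Form2 K N) := LinearMap.range (extD K N)

variable {K N}

theorem extD_apply (α : Form1 K N) (i j : Fin 5) : extD K N α i j = pd i (α j) - pd j (α i) := rfl

theorem isAlt_of_mem {ω : Form2 K N} (h : ω ∈ dOmega1 K N) : IsAlt ω := by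
  obtain ⟨α, rfl⟩ := h
  exact ⟨fun i => by rw [extD_apply, sub_self], fun i j => by rw [extD_apply, extD_apply]; ring⟩

theorem closed_of_mem {ω : Form2 K N} (h : ω ∈ dOmega1 K N) (i j k : Fin 5) :
    pd i (ω j k) - pd j (ω i k) + pd k (ω i j) = 0 := by
  obtain ⟨α, rfl⟩ := h
  simp only [extD_apply, map_sub]
  rw [pd_comm j i, pd_comm k i, pd_comm k j]; ring

/-- The Lie derivative along `D = ∑ f_k ∂_k` of a 2-form:
`(L_D ω)_ij = D ω_ij + ∑_k (∂_i f_k ω_kj + ∂_j f_k ω_ik)`. -/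
def lieForm (D : Der K N) (ω : Form2 K N) : Form2 K N :=
  fun i j => D (ω i j) + ∑ k, (pd i (D (X k)) * ω k j + pd j (D (X k)) * ω i k)

/-- The vector field corresponding to `ω ∧ ω'` divided by the volume form. -/
def wedgeField (ω ω' : Form2 K N) : Der K N := ∑ m, wedgeCoeff ω ω' m • pd m

theorem lieForm_add_left (D E : Der K N) (ω : Form2 K N) :
    lieForm (D + E) ω = lieForm D ω + lieForm E ω := by
  funext i j
  simp only [lieForm, Pi.add_apply, Derivation.add_apply, map_add, Fin.sum_univ_five]; ring

theorem lieForm_add_right (D : Der K N) (ω ω' : Form2 K N) :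
    lieForm D (ω + ω') = lieForm D ω + lieForm D ω' := by
  funext i j
  simp only [lieForm, Pi.add_apply, map_add, Fin.sum_univ_five]; ring

theorem lieForm_smul_left (a : K) (D : Der K N) (ω : Form2 K N) :
    lieForm (a • D) ω = a • lieForm D ω := by
  funext i j
  simp only [lieForm, Pi.smul_apply, Derivation.smul_apply, Derivation.map_smul, smul_add,
    Finset.smul_sum, smul_mul_assoc]

theorem lieForm_smul_right (a : K) (D : Der K N) (ω : Form2 K N) :
    lieForm D (a • ω) = a • lieForm D ω := by
  funext i j
  simp only [lieForm, Pi.smul_apply, Derivation.map_smul, smul_add, Finset.smul_sum, mul_smul_comm]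

theorem lieForm_mem {D : Der K N} (hD : D ∈ vect K N) {ω : Form2 K N} (h : ω ∈ dOmega1 K N) :
    lieForm D ω ∈ dOmega1 K N := by
  obtain ⟨α, rfl⟩ := h
  refine ⟨fun j => D (α j) + ∑ k, pd j (D (X k)) * α k, ?_⟩
  funext i j
  simp only [lieForm, extD_apply, map_add, map_sub, map_sum, pd_vect hD i (α j), pd_vect hD j (α i),
    Derivation.leibniz,
    smul_eq_mul, Fin.sum_univ_five]
  simp only [pd_comm j i]
  ring

theorem lieForm_lie {D E : Der K N} (hD : D ∈ vect K N) (hE : E ∈ vect K N) (ω : Form2 K N) :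
    lieForm ⁅D, E⁆ ω = lieForm D (lieForm E ω) - lieForm E (lieForm D ω) := by
  funext i j
  simp only [lieForm, Pi.sub_apply, map_add, map_sub, map_sum, Derivation.commutator_apply,
    pd_vect hD (_ : Fin 5) (E _), pd_vect hE (_ : Fin 5) (D _), Derivation.leibniz,
    smul_eq_mul, Fin.sum_univ_five]
  ring

theorem wedgeField_X (ω ω' : Form2 K N) (m : Fin 5) :
    wedgeField ω ω' (X m) = wedgeCoeff ω ω' m := sum_smul_pd_X _ _

theorem wedgeField_mem_vect (ω ω' : Form2 K N) : wedgeField ω ω' ∈ vect K N := ⟨_, rfl⟩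

theorem wedgeField_mem {ω ω' : Form2 K N} (h : ω ∈ dOmega1 K N) (h' : ω' ∈ dOmega1 K N) :
    wedgeField ω ω' ∈ svect K N := by
  refine ⟨wedgeField_mem_vect _ _, ?_⟩
  simp only [div, Fin.sum_univ_five, wedgeField_X]
  obtain ⟨r0, r1, r2, r3, r4⟩ := wedgeCoeff_values ω ω'
  rw [r0, r1, r2, r3, r4]
  simp only [map_add, map_sub, map_neg, Derivation.leibniz, smul_eq_mul]
  have c := closed_of_mem h
  have c' := closed_of_mem h'
  linear_combination c 0 1 2 * ω' 3 4 - c 0 1 3 * ω' 2 4 + c 0 1 4 * ω' 2 3 + c 0 2 3 * ω' 1 4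
    - c 0 2 4 * ω' 1 3 + c 0 3 4 * ω' 1 2 - c 1 2 3 * ω' 0 4 + c 1 2 4 * ω' 0 3
    - c 1 3 4 * ω' 0 2 + c 2 3 4 * ω' 0 1
    + c' 0 1 2 * ω 3 4 - c' 0 1 3 * ω 2 4 + c' 0 1 4 * ω 2 3 + c' 0 2 3 * ω 1 4
    - c' 0 2 4 * ω 1 3 + c' 0 3 4 * ω 1 2 - c' 1 2 3 * ω 0 4 + c' 1 2 4 * ω 0 3
    - c' 1 3 4 * ω 0 2 + c' 2 3 4 * ω 0 1

theorem wedgeField_comm (ω ω' : Form2 K N) : wedgeField ω ω' = wedgeField ω' ω := by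
  simp only [wedgeField, wedgeCoeff_comm ω ω']

theorem wedgeField_self (ω : Form2 K N) : wedgeField ω ω = 0 := by
  simp only [wedgeField, wedgeCoeff_self two_eq_zero, zero_smul, Finset.sum_const_zero]

theorem wedgeField_add_left (x y z : Form2 K N) :
    wedgeField (x + y) z = wedgeField x z + wedgeField y z := by
  simp only [wedgeField, ← Finset.sum_add_distrib, ← add_smul]
  refine Finset.sum_congr rfl fun m _ => ?_
  congr 1
  simp only [wedgeCoeff, Pi.add_apply]; ring

theorem wedgeField_smul_left (a : K) (x z : Form2 K N) :
    wedgeField (a • x) z = a • wedgeField x z := by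
  simp only [wedgeField, Finset.smul_sum, ← smul_assoc]
  refine Finset.sum_congr rfl fun m _ => ?_
  congr 1
  simp only [wedgeCoeff, Pi.smul_apply, smul_mul_assoc, ← smul_add, ← smul_sub, mul_smul_comm]

theorem wedgeField_add_right (x y z : Form2 K N) :
    wedgeField z (x + y) = wedgeField z x + wedgeField z y := by
  rw [wedgeField_comm, wedgeField_add_left, wedgeField_comm x, wedgeField_comm y]

theorem wedgeField_smul_right (a : K) (x z : Form2 K N) :
    wedgeField z (a • x) = a • wedgeField z x := by
  rw [wedgeField_comm, wedgeField_smul_left, wedgeField_comm x]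

theorem lie_wedgeField {D : Der K N} (hD : D ∈ svect K N) {x y : Form2 K N} (hx : IsAlt x)
    (hy : IsAlt y) :
    ⁅D, wedgeField x y⁆ = wedgeField (lieForm D x) y + wedgeField x (lieForm D y) := by
  refine vect_ext ((vect K N).lie_mem hD.1 (wedgeField_mem_vect _ _))
    ((vect K N).add_mem (wedgeField_mem_vect _ _) (wedgeField_mem_vect _ _)) fun m => ?_
  rw [Derivation.commutator_apply, Derivation.add_apply, wedgeField_X, wedgeField_X, wedgeField_X,
    vect_apply (wedgeField_mem_vect x y)]
  simp only [wedgeField_X]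
  have h := wedge_matAct (J := fun i k => pd i (D (X k))) hx hy hD.2 m
  have e : ∀ x : Form2 K N, lieForm D x =
      (fun i j => D (x i j)) + matAct (fun i k => pd i (D (X k))) x := fun x => rfl
  have add1 : ∀ x y z : Form2 K N, wedgeCoeff (x + y) z m = wedgeCoeff x z m + wedgeCoeff y z m := by
    intro x y z; simp only [wedgeCoeff, Pi.add_apply]; ring
  have add2 : ∀ x y z : Form2 K N, wedgeCoeff z (x + y) m = wedgeCoeff z x m + wedgeCoeff z y m := by
    intro x y z; simp only [wedgeCoeff, Pi.add_apply]; ring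
  have leib : D (wedgeCoeff x y m) =
      wedgeCoeff (fun i j => D (x i j)) y m + wedgeCoeff x (fun i j => D (y i j)) m := by
    have hs : D ((-1) ^ (m : ℕ)) = 0 := by
      rcases neg_one_pow_eq_or (O K N) (m : ℕ) with h | h <;> rw [h] <;> simp
    simp only [wedgeCoeff, Derivation.leibniz, map_add, map_sub, smul_eq_mul, hs]; ring
  rw [e x, e y, add1, add2, leib]
  linear_combination -h

theorem lieForm_eq_extD {D : Der K N} (hD : D ∈ vect K N) {ω : Form2 K N} (h : ω ∈ dOmega1 K N) :
    lieForm D ω = extD K N fun j => ∑ k, D (X k) * ω k j := by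
  have c := closed_of_mem h
  have a := (isAlt_of_mem h).2
  funext i j
  have e : D (ω i j) = ∑ k, D (X k) * (pd i (ω k j) - pd j (ω k i)) := by
    rw [vect_apply hD]
    refine Finset.sum_congr rfl fun k _ => ?_
    have := c k i j
    linear_combination D (X k) * this
  have e' : ∀ k, ω i k = -ω k i := fun k => a i k
  simp only [lieForm, extD_apply, e, map_sum, Derivation.leibniz, smul_eq_mul]
  rw [← Finset.sum_add_distrib, ← Finset.sum_sub_distrib]
  refine Finset.sum_congr rfl fun k _ => ?_
  rw [e' k]; ring

theorem lieForm_wedge_cyclic {x y z : Form2 K N} (hx : x ∈ dOmega1 K N) (hy : y ∈ dOmega1 K N)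
    (hz : z ∈ dOmega1 K N) : lieForm (wedgeField y z) x + lieForm (wedgeField z x) y +
      lieForm (wedgeField x y) z = 0 := by
  rw [lieForm_eq_extD (wedgeField_mem_vect _ _) hx, lieForm_eq_extD (wedgeField_mem_vect _ _) hy,
    lieForm_eq_extD (wedgeField_mem_vect _ _) hz, ← map_add, ← map_add]
  have h : ((fun j => ∑ k, wedgeField y z (X k) * x k j) +
      (fun j => ∑ k, wedgeField z x (X k) * y k j) +
      fun j => ∑ k, wedgeField x y (X k) * z k j) = (0 : Form1 K N) := by
    funext j
    simp only [Pi.add_apply, wedgeField_X, Pi.zero_apply]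
    exact contract_cyclic (isAlt_of_mem hx) (isAlt_of_mem hy) (isAlt_of_mem hz) j
  rw [h, map_zero]

end Five

section FKle

variable (K : Type*) [Field K] [CharP K 2] (N : Fin 5 → WithTop ℕ+)

/-- The space `svect(5; N) ⊕ dΩ¹(5; N)` of the Lie algebra `F(kle(5; N | 10))`: the Lie superalgebra
with the even part `svect(5; N)` and the odd part `Π(dΩ¹(5; N))`, with its parity forgotten. -/
def FKle : Type _ := svect K N × dOmega1 K N

instance : AddCommGroup (FKle K N) := inferInstanceAs (AddCommGroup (svect K N × dOmega1 K N))

instance : Module K (FKle K N) := inferInstanceAs (Module K (svect K N × dOmega1 K N))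

variable {K N}

/-- The vector field in `svect(5; N)` given by the product of two exact 2-forms. -/
def wedgeS (x y : dOmega1 K N) : svect K N :=
  ⟨wedgeField (x : Form2 K N) (y : Form2 K N), wedgeField_mem x.2 y.2⟩

/-- The Lie derivative as the action of `svect(5; N)` on `dΩ¹(5; N)`. -/
def lieS (D : svect K N) (x : dOmega1 K N) : dOmega1 K N :=
  ⟨lieForm (D : Der K N) (x : Form2 K N), lieForm_mem D.2.1 x.2⟩

/-- The bracket of `F(kle(5; N | 10))`: the usual bracket of vector fields, the Lie derivative of
forms along fields, and the product of forms `ω ∧ ω'` divided by the volume form. -/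
instance : Bracket (FKle K N) (FKle K N) :=
  ⟨fun a b => (⁅a.1, b.1⁆ + wedgeS a.2 b.2, lieS a.1 b.2 - lieS b.1 a.2)⟩

theorem FKle.lie_def (a b : FKle K N) :
    ⁅a, b⁆ = ((⁅a.1, b.1⁆ + wedgeS a.2 b.2, lieS a.1 b.2 - lieS b.1 a.2) : FKle K N) := rfl

theorem wedgeS_add_left (x y z : dOmega1 K N) : wedgeS (x + y) z = wedgeS x z + wedgeS y z :=
  Subtype.ext (wedgeField_add_left _ _ _)

theorem wedgeS_comm (x y : dOmega1 K N) : wedgeS x y = wedgeS y x :=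
  Subtype.ext (wedgeField_comm _ _)

theorem wedgeS_add_right (x y z : dOmega1 K N) : wedgeS z (x + y) = wedgeS z x + wedgeS z y :=
  Subtype.ext (wedgeField_add_right _ _ _)

theorem wedgeS_smul_right (a : K) (x y : dOmega1 K N) : wedgeS x (a • y) = a • wedgeS x y :=
  Subtype.ext (wedgeField_smul_right _ _ _)

theorem wedgeS_self (x : dOmega1 K N) : wedgeS x x = 0 := Subtype.ext (wedgeField_self _)

theorem lieS_add_left (D E : svect K N) (x : dOmega1 K N) :
    lieS (D + E) x = lieS D x + lieS E x := Subtype.ext (lieForm_add_left _ _ _)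

theorem lieS_add_right (D : svect K N) (x y : dOmega1 K N) :
    lieS D (x + y) = lieS D x + lieS D y := Subtype.ext (lieForm_add_right _ _ _)

theorem lieS_smul_left (a : K) (D : svect K N) (x : dOmega1 K N) :
    lieS (a • D) x = a • lieS D x := Subtype.ext (lieForm_smul_left _ _ _)

theorem lieS_smul_right (a : K) (D : svect K N) (x : dOmega1 K N) :
    lieS D (a • x) = a • lieS D x := Subtype.ext (lieForm_smul_right _ _ _)

theorem lieS_lie (D E : svect K N) (x : dOmega1 K N) :
    lieS ⁅D, E⁆ x = lieS D (lieS E x) - lieS E (lieS D x) :=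
  Subtype.ext (lieForm_lie D.2.1 E.2.1 _)

theorem lie_wedgeS (D : svect K N) (x y : dOmega1 K N) :
    ⁅D, wedgeS x y⁆ = wedgeS (lieS D x) y + wedgeS x (lieS D y) :=
  Subtype.ext (lie_wedgeField D.2 (isAlt_of_mem x.2) (isAlt_of_mem y.2))

theorem lieS_wedgeS_cyclic (x y z : dOmega1 K N) :
    lieS (wedgeS y z) x + lieS (wedgeS z x) y + lieS (wedgeS x y) z = 0 :=
  Subtype.ext (lieForm_wedge_cyclic x.2 y.2 z.2)

theorem add_self_eq_zero_of_module (K : Type*) [Field K] [CharP K 2] {M : Type*} [AddCommGroup M] [Module K M] (x : M) :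
    x + x = 0 := by
  rw [← two_smul K, CharTwo.two_eq_zero, zero_smul]

theorem wedgeS_sub_left (x y z : dOmega1 K N) : wedgeS (x - y) z = wedgeS x z - wedgeS y z := by
  rw [eq_sub_iff_add_eq, ← wedgeS_add_left, sub_add_cancel]

theorem wedgeS_sub_right (x y z : dOmega1 K N) : wedgeS z (x - y) = wedgeS z x - wedgeS z y := by
  rw [eq_sub_iff_add_eq, ← wedgeS_add_right, sub_add_cancel]

theorem lieS_sub_right (D : svect K N) (x y : dOmega1 K N) :
    lieS D (x - y) = lieS D x - lieS D y := by
  rw [eq_sub_iff_add_eq, ← lieS_add_right, sub_add_cancel]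

theorem FKle.ext' {a b : FKle K N} (h1 : a.1 = b.1) (h2 : a.2 = b.2) : a = b := Prod.ext h1 h2

theorem FKle.jacobi_fst (D E F : svect K N) (x y z : dOmega1 K N) :
    ⁅D, ⁅E, F⁆ + wedgeS y z⁆ + wedgeS x (lieS E z - lieS F y) =
    (⁅⁅D, E⁆ + wedgeS x y, F⁆ + wedgeS (lieS D y - lieS E x) z) +
    (⁅E, ⁅D, F⁆ + wedgeS x z⁆ + wedgeS y (lieS D z - lieS F x)) := by
  have h := add_self_eq_zero_of_module K (wedgeS y (lieS F x))
  rw [lie_add, add_lie, lie_add, leibniz_lie D E F, lie_wedgeS, lie_wedgeS,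
    ← lie_skew (wedgeS x y) F, lie_wedgeS, wedgeS_sub_right, wedgeS_sub_left, wedgeS_sub_right,
    wedgeS_comm (lieS F x) y, wedgeS_comm (lieS E x) z, wedgeS_comm z (lieS E x)]
  rw [← sub_eq_zero]
  refine Eq.trans ?_ h
  abel

theorem FKle.jacobi_snd (D E F : svect K N) (x y z : dOmega1 K N) :
    lieS D (lieS E z - lieS F y) - lieS (⁅E, F⁆ + wedgeS y z) x =
    (lieS (⁅D, E⁆ + wedgeS x y) z - lieS F (lieS D y - lieS E x)) +
    (lieS E (lieS D z - lieS F x) - lieS (⁅D, F⁆ + wedgeS x z) y) := by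
  have h := lieS_wedgeS_cyclic x y z
  have h2 := add_self_eq_zero_of_module K (lieS (wedgeS z x) y)
  simp only [lieS_add_left, lieS_sub_right, lieS_lie]
  rw [wedgeS_comm x z]
  rw [← sub_eq_zero]
  have h3 : lieS (wedgeS z x) y + lieS (wedgeS z x) y -
    (lieS (wedgeS y z) x + lieS (wedgeS z x) y + lieS (wedgeS x y) z) = 0 := by rw [h, h2, sub_zero]
  refine Eq.trans ?_ h3
  abel

instance : LieRing (FKle K N) where
  add_lie a b c := FKle.ext'
    (by
      change ⁅a.1 + b.1, c.1⁆ + wedgeS (a.2 + b.2) c.2 =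
        (⁅a.1, c.1⁆ + wedgeS a.2 c.2) + (⁅b.1, c.1⁆ + wedgeS b.2 c.2)
      rw [add_lie, wedgeS_add_left]; abel)
    (by
      change lieS (a.1 + b.1) c.2 - lieS c.1 (a.2 + b.2) =
        (lieS a.1 c.2 - lieS c.1 a.2) + (lieS b.1 c.2 - lieS c.1 b.2)
      rw [lieS_add_left, lieS_add_right]; abel)
  lie_add a b c := FKle.ext'
    (by
      change ⁅a.1, b.1 + c.1⁆ + wedgeS a.2 (b.2 + c.2) =
        (⁅a.1, b.1⁆ + wedgeS a.2 b.2) + (⁅a.1, c.1⁆ + wedgeS a.2 c.2)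
      rw [lie_add, wedgeS_add_right]; abel)
    (by
      change lieS a.1 (b.2 + c.2) - lieS (b.1 + c.1) a.2 =
        (lieS a.1 b.2 - lieS b.1 a.2) + (lieS a.1 c.2 - lieS c.1 a.2)
      rw [lieS_add_left, lieS_add_right]; abel)
  lie_self a := FKle.ext'
    (by
      change ⁅a.1, a.1⁆ + wedgeS a.2 a.2 = 0
      rw [lie_self, wedgeS_self, add_zero])
    (sub_self _)
  leibniz_lie a b c := FKle.ext' (FKle.jacobi_fst _ _ _ _ _ _) (FKle.jacobi_snd _ _ _ _ _ _)

instance : LieAlgebra K (FKle K N) where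
  lie_smul t a b := FKle.ext'
    (by
      change ⁅a.1, t • b.1⁆ + wedgeS a.2 (t • b.2) = t • (⁅a.1, b.1⁆ + wedgeS a.2 b.2)
      rw [lie_smul, wedgeS_smul_right, smul_add])
    (by
      change lieS a.1 (t • b.2) - lieS (t • b.1) a.2 = t • (lieS a.1 b.2 - lieS b.1 a.2)
      rw [lieS_smul_right, lieS_smul_left, smul_sub])

/-- The 2-form `Z_i(D) = du_i ∧ df_i` for `D = ∑ f_k ∂_k`. -/
def Z (i : Fin 5) (D : Der K N) : Form2 K N :=
  fun a b => pd a (X i) * pd b (D (X i)) - pd b (X i) * pd a (D (X i))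

theorem Z_mem (i : Fin 5) (D : Der K N) : Z i D ∈ dOmega1 K N := by
  refine ⟨fun a => X i * pd a (D (X i)), ?_⟩
  funext a b
  simp only [Z, extD_apply, Derivation.leibniz, smul_eq_mul]
  rw [pd_comm a b]; ring

variable (K N) in
/-- The linear map `ψ : D ↦ D + Z_4(D) + Z_5(D)` (the indices start at `0` in the code). -/
def psi : svect K N →ₗ[K] FKle K N where
  toFun D := (D, (⟨Z 3 (D : Der K N), Z_mem _ _⟩ + ⟨Z 4 (D : Der K N), Z_mem _ _⟩ : dOmega1 K N))
  map_add' D E := FKle.ext' rfl (Subtype.ext (by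
    funext a b
    change Z 3 (D + E : Der K N) a b + Z 4 (D + E : Der K N) a b =
      (Z 3 (D : Der K N) a b + Z 4 (D : Der K N) a b) +
      (Z 3 (E : Der K N) a b + Z 4 (E : Der K N) a b)
    simp only [Z, Derivation.add_apply, map_add]; ring))
  map_smul' t D := FKle.ext' rfl (Subtype.ext (by
    funext a b
    change Z 3 (t • D : Der K N) a b + Z 4 (t • D : Der K N) a b =
      t • (Z 3 (D : Der K N) a b + Z 4 (D : Der K N) a b)
    simp only [Z, Derivation.smul_apply, Derivation.map_smul, mul_smul_comm, ← smul_sub, ← smul_add]))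

end FKle

section FMb

/-- The indices of the eleven indeterminates of `mb(3 | 8)`: `u_1, u_2, u_3, χ_1, χ_2` in the left
summand (so that `χ_s` is `u_{3+s}`), and `η_1, η_2, η_3, ξ_1, ξ_2, ξ_3` in the right one. -/
abbrev MbIdx : Type := Fin 5 ⊕ (Fin 3 ⊕ Fin 3)

/-- The index of `u_i` for `i = 1, 2, 3`. -/
def iu (i : Fin 3) : MbIdx := Sum.inl (i.castLE (by norm_num))

/-- The index of `χ_s = u_{3+s}` for `s = 1, 2`. -/
def ichi (s : Fin 2) : MbIdx := Sum.inl (s.natAdd 3)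

/-- The index of `η_i`. -/
def ieta (i : Fin 3) : MbIdx := Sum.inr (Sum.inl i)

/-- The index of `ξ_i`. -/
def ixi (i : Fin 3) : MbIdx := Sum.inr (Sum.inr i)

/-- The shearing vector in eleven indeterminates: `N` on `u_1, …, u_5` and `1` on the formerly odd
`η_i` and `ξ_i`. -/
def tildeN (N : Fin 5 → WithTop ℕ+) : MbIdx → WithTop ℕ+ := Sum.elim N fun _ => 1

variable (K : Type*) [Field K] [CharP K 2] (N : Fin 5 → WithTop ℕ+)

/-- `Y_{ξ_i} = ∂_{ξ_i}`. -/
def Yxi (i : Fin 3) : Der K (tildeN N) := pd (ixi i)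

/-- `Y_{η_i} = ∂_{η_i} + ξ_k ∂_{u_j} - ξ_j ∂_{u_k} + (ξ_k η_j - ξ_j η_k) ∂_{χ_1} - ξ_j ξ_k ∂_{χ_2}`,
where `(i, j, k)` is the cyclic permutation `(i, i + 1, i + 2)` modulo `3`. -/
def Yeta (i : Fin 3) : Der K (tildeN N) :=
  let j : Fin 3 := i + 1
  let k : Fin 3 := i + 2
  let p : MbIdx → Der K (tildeN N) := fun a => pd a
  let x : MbIdx → O K (tildeN N) := fun a => X a
  p (ieta i) + (x (ixi k) • p (iu j) - x (ixi j) • p (iu k))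
    + (x (ixi k) * x (ieta j) - x (ixi j) * x (ieta k)) • p (ichi 0)
    - (x (ixi j) * x (ixi k)) • p (ichi 1)

/-- The distribution spanned by the `Y_{ξ_i}` and `Y_{η_i}`. -/
def mbDistribution : Submodule (O K (tildeN N)) (Der K (tildeN N)) :=
  Submodule.span _ (Set.range (Yxi K N) ∪ Set.range (Yeta K N))

/-- `F(mb(3; N | 8))`: the vector fields in the eleven indeterminates, all regarded as even,
that preserve the distribution. -/
def FMb : LieSubalgebra K (Der K (tildeN N)) where
  carrier := {D | D ∈ vect K (tildeN N) ∧ ∀ Y ∈ mbDistribution K N, ⁅D, Y⁆ ∈ mbDistribution K N}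
  add_mem' := by
    rintro D E ⟨hD, hD'⟩ ⟨hE, hE'⟩
    refine ⟨(vect K (tildeN N)).add_mem hD hE, fun Y hY => ?_⟩
    have h : ⁅D + E, Y⁆ = ⁅D, Y⁆ + ⁅E, Y⁆ := add_lie D E Y
    rw [h]
    exact Submodule.add_mem _ (hD' Y hY) (hE' Y hY)
  zero_mem' := ⟨(vect K (tildeN N)).zero_mem, fun Y _ => by
    have h : ⁅(0 : Der K (tildeN N)), Y⁆ = 0 := zero_lie Y
    rw [h]
    exact Submodule.zero_mem _⟩
  smul_mem' := by
    rintro a D ⟨hD, hD'⟩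
    refine ⟨(vect K (tildeN N)).smul_mem a hD, fun Y hY => ?_⟩
    have h : ⁅a • D, Y⁆ = a • ⁅D, Y⁆ := smul_lie a D Y
    rw [h]
    exact Submodule.smul_of_tower_mem _ a (hD' Y hY)
  lie_mem' := by
    rintro D E ⟨hD, hD'⟩ ⟨hE, hE'⟩
    refine ⟨(vect K (tildeN N)).lie_mem hD hE, fun Y hY => ?_⟩
    have h : ⁅⁅D, E⁆, Y⁆ = ⁅D, ⁅E, Y⁆⁆ - ⁅E, ⁅D, Y⁆⁆ := lie_lie D E Y
    rw [h]
    exact Submodule.sub_mem _ (hD' _ (hE' Y hY)) (hE' _ (hD' Y hY))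

variable {K N}

variable (K) in
/-- The substitution `η = ξ = 0` in divided power polynomials of the eleven indeterminates. -/
def restrHom : DivPow K MbIdx →ₗ[K] DivPow K (Fin 5) :=
  DivPow.lift fun r => if ∀ a, r (Sum.inr a) = 0 then DivPow.mon fun i => r (Sum.inl i) else 0

theorem restrHom_mem {f : DivPow K MbIdx} (hf : f ∈ DivPow.trunc K (tildeN N)) :
    restrHom K f ∈ DivPow.trunc K N := by
  refine DivPow.map_trunc_le K (restrHom K) (Subalgebra.toSubmodule (DivPow.trunc K N))
    (fun r hr => ?_) hf
  rw [restrHom, DivPow.lift_mon]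
  split_ifs
  · exact DivPow.mon_mem_trunc K fun i n hn => hr (Sum.inl i) n hn
  · exact Submodule.zero_mem _

variable (K N) in
/-- The restriction of a function of the eleven indeterminates to `η = ξ = 0`. -/
def restr : O K (tildeN N) →ₗ[K] O K N where
  toFun f := O.mk (restrHom K (O.val f)) (restrHom_mem (O.val_mem f))
  map_add' f g := O.ext (by
    rw [O.val_mk, map_add O.val, map_add O.val, O.val_mk, O.val_mk, map_add (restrHom K)])
  map_smul' a f := O.ext (by
    rw [O.val_mk, map_smul O.val, RingHom.id_apply, map_smul O.val, O.val_mk,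
      map_smul (restrHom K)])

/-- The generating function `F_1 = g_{χ_1} - ∑ g_{u_i} η_i` of
`D = ∑ (g_{u_i} ∂_{u_i} + g_{η_i} ∂_{η_i} + g_{ξ_i} ∂_{ξ_i}) + ∑ g_{χ_s} ∂_{χ_s}`; it is the coefficient
of `Y_{χ_1}` in the decomposition of `D` with respect to the fields `Y`. -/
def mbF1 (D : Der K (tildeN N)) : O K (tildeN N) :=
  D (X (ichi 0)) - ∑ i, D (X (iu i)) * X (ieta i)

/-- The generating function `F_2 = g_{χ_2} - ∑ g_{u_i} ξ_i - ∑ g_{η_i} ξ_j ξ_k`, the coefficient of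
`Y_{χ_2}`. -/
def mbF2 (D : Der K (tildeN N)) : O K (tildeN N) :=
  D (X (ichi 1)) - ∑ i, D (X (iu i)) * X (ixi i) -
    ∑ i, D (X (ieta i)) * (X (ixi (i + 1)) * X (ixi (i + 2)))

/-- The defining functions `f = (f_1, …, f_5)` of `D = X^f`: `f_1, f_2, f_3` are the coefficients of
`η_1, η_2, η_3` in `F_1`, and `f_4`, `f_5` are the values of `F_1`, `F_2` at `η = ξ = 0`. -/
def mbFun (D : Der K (tildeN N)) : Fin 5 → O K N :=
  ![restr K N (pd (ieta 0) (mbF1 D)), restr K N (pd (ieta 1) (mbF1 D)),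
    restr K N (pd (ieta 2) (mbF1 D)), restr K N (mbF1 D), restr K N (mbF2 D)]

end FMb

/-- The shearing vector `N_∞`: no bound on the exponents of the five indeterminates. -/
abbrev Ninf : Fin 5 → WithTop ℕ+ := fun _ => ⊤

end

end CharTwo5

namespace CharTwo5

noncomputable section

/-! ### Nontriviality and characteristic of the divided power algebras -/

section Basic

variable {K : Type*} [Field K] [CharP K 2] {ι : Type*} [Fintype ι] [DecidableEq ι]
variable {N : ι → WithTop ℕ+}

/-! Embedding in F(kle). The product of du_4∧df_4 + du_5∧df_5 with du_4∧dg_4 + du_5∧dg_5 is, up to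
signs that are invisible in characteristic 2, du_4∧du_5∧(df_4∧dg_5 + df_5∧dg_4), and divided by the
volume form it is c(D,E) (`wedgeField_Z`). In L_D Z_i(E) - L_E Z_i(D) the terms df_i∧dg_i occur
twice and cancel, which leaves Z_i([D,E]) (`lieForm_Z_sub`). Finally c(D,E) has no components along
∂_4 and ∂_5, so Z_4 and Z_5 kill it. Hence ψ carries the bracket [D,E] + c(D,E) to the bracket of
F(kle); as ψ has the identity as its first component, the Jacobi identity of F(kle) comes back along
ψ, and since c(c(D,E),F) = 0 its part linear in c is the cocycle condition. That c is no coboundary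
is seen on the commuting fields u_1∂_4 and u_2∂_5, where c takes the value ∂_3.

The algebra F(mb). The fields Y_ξ, Y_η, the Y_{u_i} = ∂_{u_i} + η_i∂_{χ_1} + ξ_i∂_{χ_2}, and
∂_{χ_1}, ∂_{χ_2} form a frame, with [Y_{ξ_j}, Y_{η_k}] = Y_{u_i} for distinct i, j, k, [Y_{η_i},
Y_{u_i}] = ∂_{χ_1} and [Y_{ξ_i}, Y_{u_i}] = ∂_{χ_2}. If C_i, F_1, F_2 are the coefficients of D
along Y_{u_i}, ∂_{χ_1}, ∂_{χ_2}, then D preserves the distribution exactly when Y_{ξ_i}F_1 = 0,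
Y_{η_i}F_2 = 0, C_i = Y_{ξ_i}F_2 = Y_{η_i}F_1, D(ξ_i) = Y_{u_i}F_2 and D(η_i) = Y_{u_i}F_1
(`mem_FMb_iff`). So D is governed by the pair F_1, F_2. An integrability condition of this system
restricts at η = ξ = 0 to div D^f = 0. The system is closed under differentiation in η and ξ, so a
solution with zero initial data vanishes; conversely, divergence-free initial data extend to an
explicit solution (`genF1`, `genF2`). This gives the bijection φ. At η = ξ = 0 the η- and
ξ-components of D are ∂_i f_4 and ∂_i f_5; paired with the η- and ξ-derivatives of the components of
E they produce the extra term c in the bracket.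

Codimension 5. For N_∞, let P be a subspace of svect of codimension 5 closed under [D,E] + c(D,E).
If P contained a constant field v ≠ 0, then, since c(v,·) = 0, ad v would act on the
finite-dimensional quotient by P; but ad v is surjective and locally nilpotent on svect, so it would
be bijective and locally nilpotent on the quotient, which would then be 0. Hence the constant fields
form a complement of P, and P contains u_2∂_4 + v and u_3∂_5 + w for suitable constant v, w. Their
deformed bracket is a constant field with ∂_1-coefficient 1, a contradiction
(`finrank_quotient_ne_five`). In svect itself the fields vanishing at the origin form a maximal
subalgebra of codimension 5, because the u_i∂_j with i ≠ j already act irreducibly on the values at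
the origin. -/

instance : Nontrivial (DivPow K ι) := inferInstanceAs (Nontrivial ((ι → ℕ) →₀ K))

instance : Nontrivial (O K N) := (O.val (K := K) (N := N)).toRingHom.domain_nontrivial

instance : CharP (O K N) 2 := CharTwo.of_one_ne_zero_of_two_eq_zero one_ne_zero two_eq_zero

end Basic

/-! ### The cocycle c and the homomorphism into F(kle) -/

section Kle

variable {K : Type*} [Field K] [CharP K 2] {N : Fin 5 → WithTop ℕ+}

theorem cField_X (D E : Der K N) :
    cField D E (X 0) = pd 1 (D (X 3)) * pd 2 (E (X 4)) + pd 1 (D (X 4)) * pd 2 (E (X 3)) +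
      (pd 2 (D (X 3)) * pd 1 (E (X 4)) + pd 2 (D (X 4)) * pd 1 (E (X 3))) ∧
    cField D E (X 1) = pd 0 (D (X 3)) * pd 2 (E (X 4)) + pd 0 (D (X 4)) * pd 2 (E (X 3)) +
      (pd 2 (D (X 3)) * pd 0 (E (X 4)) + pd 2 (D (X 4)) * pd 0 (E (X 3))) ∧
    cField D E (X 2) = pd 0 (D (X 3)) * pd 1 (E (X 4)) + pd 0 (D (X 4)) * pd 1 (E (X 3)) +
      (pd 1 (D (X 3)) * pd 0 (E (X 4)) + pd 1 (D (X 4)) * pd 0 (E (X 3))) ∧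
    cField D E (X 3) = 0 ∧ cField D E (X 4) = 0 := by
  rw [cField_eq]
  simp only [Derivation.add_apply, smul_pd_X]
  simp

/-- The values of c have no components along ∂_4 and ∂_5, the only components that c reads. This
nilpotency of c makes the quadratic part of the Jacobi identity for [D,E] + c(D,E) void. -/
theorem cField_cField_left (D E F : Der K N) : cField (cField D E) F = 0 := by
  rw [cField_eq]
  simp [(cField_X D E).2.2.2]

theorem psi_injective : Function.Injective (psi K N) := fun _ _ h => congrArg Prod.fst h

/-- The derivation L_D commutes with d, so L_D(du_i ∧ dg_i) = df_i ∧ dg_i + du_i ∧ d(D g_i). -/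
theorem lieForm_Z {D : Der K N} (hD : D ∈ vect K N) (i : Fin 5) (E : Der K N) (a b : Fin 5) :
    lieForm D (Z i E) a b = pd a (D (X i)) * pd b (E (X i)) - pd b (D (X i)) * pd a (E (X i)) +
      (pd a (X i) * pd b (D (E (X i))) - pd b (X i) * pd a (D (E (X i)))) := by
  have h : ∀ a b : Fin 5, D (pd a (X b) : O K N) = 0 := fun a b => by
    rw [pd_X]; split_ifs <;> simp
  simp only [lieForm, Z, map_sub, Derivation.leibniz, h, smul_eq_mul, pd_vect hD _ (E (X i))]
  simp only [pd_X, Fin.sum_univ_five]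
  fin_cases i <;> simp <;> split_ifs <;> ring

/-- The two terms df_i ∧ dg_i and -dg_i ∧ df_i add up to 2 df_i ∧ dg_i. Only their vanishing in
characteristic 2 makes Z_i behave as a derivation. -/
theorem lieForm_Z_sub {D E : Der K N} (hD : D ∈ vect K N) (hE : E ∈ vect K N) (i : Fin 5) :
    lieForm D (Z i E) - lieForm E (Z i D) = Z i ⁅D, E⁆ := by
  funext a b
  have h2 : (2 : O K N) = 0 := two_eq_zero
  simp only [Pi.sub_apply, lieForm_Z hD, lieForm_Z hE, Z, Derivation.commutator_apply, map_sub]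
  linear_combination (pd a (D (X i)) * pd b (E (X i)) - pd b (D (X i)) * pd a (E (X i))) * h2

/-- The products with du_4 ∧ du_4 or du_5 ∧ du_5 vanish. The mixed ones contain du_4 ∧ du_5, so only
derivatives along u_1, u_2, u_3 survive, and without signs the determinants become the sum over all
of S_3. -/
theorem wedgeField_Z (D E : Der K N) :
    wedgeField (Z 3 D + Z 4 D) (Z 3 E + Z 4 E) = cField D E := by
  have hc : cField D E ∈ vect K N := (cField_mem D E).1
  obtain ⟨c0, c1, c2, c3, c4⟩ := cField_X D E
  refine vect_ext (wedgeField_mem_vect _ _) hc fun m => ?_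
  rw [wedgeField_X]
  obtain ⟨r0, r1, r2, r3, r4⟩ := wedgeCoeff_values (Z 3 D + Z 4 D) (Z 3 E + Z 4 E)
  fin_cases m <;> simp only [Fin.zero_eta, Fin.isValue, Fin.mk_one, Fin.reduceFinMk]
  · rw [r0, c0]; simp [Z, pd_X]; grind
  · rw [r1, c1]; simp [Z, pd_X]; grind
  · rw [r2, c2]; simp [Z, pd_X]; grind
  · rw [r3, c3]; simp [Z, pd_X]
  · rw [r4, c4]; simp [Z, pd_X]

/-- The form `Z_4(D) + Z_5(D)`. -/
def psiForm (D : svect K N) : dOmega1 K N :=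
  ⟨Z 3 (D : Der K N), Z_mem _ _⟩ + ⟨Z 4 (D : Der K N), Z_mem _ _⟩

theorem psi_apply (D : svect K N) : psi K N D = ((D, psiForm D) : FKle K N) := rfl

theorem wedgeS_psiForm (D E : svect K N) :
    wedgeS (psiForm D) (psiForm E) = (cCochain K N).val D E :=
  Subtype.ext (wedgeField_Z (D : Der K N) (E : Der K N))

theorem lieS_psiForm (D E : svect K N) :
    lieS D (psiForm E) - lieS E (psiForm D) = psiForm (⁅D, E⁆ + (cCochain K N).val D E) := by
  refine Subtype.ext ?_
  obtain ⟨-, -, -, c3, c4⟩ := cField_X (D : Der K N) E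
  -- Z_i sees only the component along ∂_i, so adding c(D,E) changes neither Z_4 nor Z_5.
  have hZ : ∀ i : Fin 5, cField (D : Der K N) E (X i) = 0 →
      Z i ((⁅D, E⁆ + (cCochain K N).val D E : svect K N) : Der K N) =
        Z i ⁅(D : Der K N), (E : Der K N)⁆ := by
    intro i hi
    have : ((⁅D, E⁆ + (cCochain K N).val D E : svect K N) : Der K N) (X i) =
        ⁅(D : Der K N), (E : Der K N)⁆ (X i) + cField (D : Der K N) E (X i) := rfl
    funext a b
    simp only [Z, this, hi, add_zero]
  have h : ∀ F : svect K N, (psiForm F : Form2 K N) = Z 3 (F : Der K N) + Z 4 (F : Der K N) :=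
    fun _ => rfl
  rw [h, hZ 3 c3, hZ 4 c4, ← lieForm_Z_sub D.2.1 E.2.1, ← lieForm_Z_sub D.2.1 E.2.1]
  change lieForm (D : Der K N) (psiForm E : Form2 K N) -
    lieForm (E : Der K N) (psiForm D : Form2 K N) = _
  rw [h, h, lieForm_add_right, lieForm_add_right]
  abel

theorem psi_lie (D E : svect K N) :
    ⁅psi K N D, psi K N E⁆ = psi K N (⁅D, E⁆ + (cCochain K N).val D E) := by
  rw [FKle.lie_def, psi_apply, psi_apply, psi_apply, ← lieS_psiForm, ← wedgeS_psiForm]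

/-- The cocycle condition is the part linear in c of the Jacobi identity for the deformed bracket,
and that identity is inherited from F(kle). -/
theorem cCochain_mem_twoCocycle : cCochain K N ∈
    LieModule.Cohomology.twoCocycle K (svect K N) (svect K N) := by
  rw [LieModule.Cohomology.mem_twoCocycle_iff]
  ext1 D; ext1 E; ext1 F
  rw [LieModule.Cohomology.d₂₃_apply]
  set c : svect K N → svect K N → svect K N := fun D E => (cCochain K N).val D E with hc
  have cadd : ∀ D D' E, c (D + D') E = c D E + c D' E := fun D D' E => by simp [hc]
  have cc : ∀ D E F, c (c D E) F = 0 := fun D E F => Subtype.ext (cField_cField_left _ _ _)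
  have csk : ∀ D E, c D E = - c E D := fun D E =>
    (LieModule.Cohomology.twoCochain_skew (cCochain K N) E D).symm
  have cc' : ∀ D E F, c F (c D E) = 0 := fun D E F => by rw [csk, cc, neg_zero]
  have cadd' : ∀ D D' E, c E (D + D') = c E D + c E D' := fun D D' E => by simp [hc]
  -- The Jacobi identity in F(kle), pulled back along the injection ψ. The terms of degree 0 in c
  -- cancel by the Jacobi identity of svect, those of degree 2 by c(c(D,E),F) = 0.
  have h := leibniz_lie (psi K N D) (psi K N E) (psi K N F)
  simp only [psi_lie] at h
  rw [← map_add] at h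
  have h' := psi_injective h
  change ⁅D, ⁅E, F⁆ + c E F⁆ + c D (⁅E, F⁆ + c E F) = ⁅⁅D, E⁆ + c D E, F⁆ + c (⁅D, E⁆ + c D E) F +
    (⁅E, ⁅D, F⁆ + c D F⁆ + c E (⁅D, F⁆ + c D F)) at h'
  rw [cadd, cadd', cadd', cc, cc', cc', lie_add, add_lie, lie_add, leibniz_lie D E F] at h'
  change ⁅D, c E F⁆ - ⁅E, c D F⁆ + ⁅F, c D E⁆ - c ⁅D, E⁆ F + c ⁅D, F⁆ E - c ⁅E, F⁆ D = 0
  rw [csk ⁅D, F⁆ E, csk ⁅E, F⁆ D, ← lie_skew F (c D E)]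
  rw [← sub_eq_zero] at h'
  refine Eq.trans ?_ h'
  abel

variable (K N) in
/-- The constant term of a function. -/
def constTerm : O K N →ₗ[K] K := (DivPow.coeff 0).comp O.val.toLinearMap

theorem constTerm_one : constTerm K N 1 = 1 := by
  classical
  change DivPow.coeff 0 (O.val (1 : O K N)) = 1
  rw [map_one, DivPow.one_def, DivPow.coeff_mon, if_pos rfl]

theorem constTerm_X_mul (i : Fin 5) (f : O K N) : constTerm K N (X i * f) = 0 := by
  classical
  induction f using O.induction with
  | hm r h =>
    change DivPow.coeff 0 (O.val (X i * O.mk (DivPow.mon r : DivPow K (Fin 5)) (DivPow.mon_mem_trunc K h)))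
      = 0
    rw [map_mul, O.val_mk, X, O.val_mk, DivPow.mon_mul_mon, map_smul, DivPow.coeff_mon, if_neg,
      smul_zero]
    intro h'
    simpa using congrFun h' i
  | ha f g hf hg => rw [mul_add, map_add, hf, hg, add_zero]
  | hs a f hf => rw [mul_smul_comm, map_smul, hf, smul_zero]

variable (K N) in
/-- The divergence-free field `u_i ∂_j` with `i ≠ j`. -/
def uPd (i j : Fin 5) (h : i ≠ j) : svect K N :=
  ⟨X i • pd j, smul_pd_mem_vect _ _, by
    simp only [div, smul_pd_X]
    refine Finset.sum_eq_zero fun k _ => ?_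
    split_ifs with hk
    · subst hk; rw [pd_X, if_neg h.symm]
    · rw [map_zero]⟩

theorem uPd_X (i j k : Fin 5) (h : i ≠ j) :
    (uPd K N i j h : Der K N) (X k) = if j = k then X i else 0 := smul_pd_X _ _ _

theorem uPd_apply (i j : Fin 5) (h : i ≠ j) (a : O K N) :
    (uPd K N i j h : Der K N) a = X i * pd j a := rfl

/-- If c = db, evaluation on a commuting pair leaves c(D,E) = [D, bE] - [E, bD]. For D = u_1∂_4 and
E = u_2∂_5 the left side is ∂_3, while the ∂_3-component of the right side vanishes at the origin
for every b. -/
theorem cCochain_not_coboundary : cCochain K N ∉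
    LinearMap.range (LieModule.Cohomology.d₁₂ K (svect K N) (svect K N)) := by
  rintro ⟨b, hb⟩
  set D := uPd K N 0 3 (by decide) with hD
  set E := uPd K N 1 4 (by decide) with hE
  have h0 : ⁅D, E⁆ = 0 := Subtype.ext <|
    vect_ext ((vect K N).lie_mem D.2.1 E.2.1) (vect K N).zero_mem fun k => by
      change D.1 (E.1 (X k)) - E.1 (D.1 (X k)) = 0
      rw [hD, hE, uPd_X, uPd_X, uPd_apply, uPd_apply]
      split_ifs <;> simp [pd_X]
  have h1 : (LieModule.Cohomology.d₁₂ K (svect K N) (svect K N) b).val D E =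
      (cCochain K N).val D E := by rw [hb]
  have h2 : ⁅D, b E⁆ - ⁅E, b D⁆ - b ⁅D, E⁆ = (cCochain K N).val D E := h1
  rw [h0, map_zero, sub_zero] at h2
  -- D and E kill u_3, so only D(bE(u_3)) and E(bD(u_3)) remain in the ∂_3-component. They are
  -- multiples of u_1 and u_2 and have no constant term, whereas c(D,E) contributes 1.
  have h3 := congrArg (fun F : svect K N => constTerm K N ((F : Der K N) (X 2))) h2
  change constTerm K N ((D.1 ((b E).1 (X 2)) - (b E).1 (D.1 (X 2))) -
    (E.1 ((b D).1 (X 2)) - (b D).1 (E.1 (X 2)))) = constTerm K N (cField D.1 E.1 (X 2)) at h3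
  rw [(cField_X _ _).2.2.1, hD, hE, uPd_apply, uPd_apply] at h3
  simp only [uPd_X] at h3
  simp [pd_X, uPd_apply, constTerm_X_mul, constTerm_one] at h3

end Kle

/-! ### Coefficients of divided power polynomials -/

section Coefficients

namespace DivPow

variable {K ι : Type*} [Field K]

theorem ext_coeff {f g : DivPow K ι} (h : ∀ r, coeff r f = coeff r g) : f = g := Finsupp.ext h

variable [Fintype ι] [DecidableEq ι]

theorem coeff_pd (i : ι) (r : ι → ℕ) (f : DivPow K ι) :
    coeff r (pd i f) = coeff (r + Pi.single i 1) f := by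
  classical
  have h : (coeff r).comp (pdHom i : DivPow K ι →ₗ[K] DivPow K ι) = coeff (r + Pi.single i 1) := by
    refine hom_ext fun s => ?_
    change coeff r (pd i (mon s)) = _
    rw [pd_mon, coeff_mon]
    split_ifs with h1 h2 h2
    · subst h2; simp at h1
    · rw [map_zero]
    · subst h2; rw [add_tsub_cancel_right, coeff_mon, if_pos rfl]
    · rw [coeff_mon, if_neg]
      rintro rfl
      refine h2 (tsub_add_cancel_of_le fun j => ?_).symm
      by_cases hj : j = i
      · subst hj; simp; omega
      · simp [Pi.single_eq_of_ne hj]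
  exact LinearMap.congr_fun h f

theorem coeff_eq_zero_of_mem_trunc [CharP K 2] {N : ι → WithTop ℕ+} {f : DivPow K ι}
    (hf : f ∈ trunc K N) {r : ι → ℕ} (hr : r ∉ Bounded N) : coeff r f = 0 := by
  classical
  refine LinearMap.mem_ker.1 (map_trunc_le K LinearMap.id (LinearMap.ker (coeff r))
    (fun s hs => LinearMap.mem_ker.2 ?_) hf)
  rw [LinearMap.id_apply, coeff_mon, if_neg]
  rintro rfl
  exact hr hs

theorem mem_trunc_top [CharP K 2] (f : DivPow K ι) : f ∈ trunc K (fun _ : ι => ⊤) := by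
  have h : f ∈ Submodule.span K (Set.range (mon : (ι → ℕ) → DivPow K ι)) := by
    rw [span_mon]; trivial
  refine Submodule.span_mono ?_ h
  rintro _ ⟨r, rfl⟩
  exact ⟨r, fun i n hn => absurd hn.symm (WithTop.coe_ne_top), rfl⟩

end DivPow

end Coefficients

/-! ### Restriction to η = ξ = 0, extension back, and vanishing order in η and ξ -/

section Restriction

variable {K : Type*} [Field K] [CharP K 2] {N : Fin 5 → WithTop ℕ+}

theorem coeff_restrHom (s : Fin 5 → ℕ) (f : DivPow K MbIdx) :
    DivPow.coeff s (restrHom K f) = DivPow.coeff (Sum.elim s 0) f := by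
  classical
  have h : (DivPow.coeff s).comp (restrHom K) = DivPow.coeff (Sum.elim s 0) := by
    refine DivPow.hom_ext fun r => ?_
    rw [LinearMap.comp_apply, restrHom, DivPow.lift_mon, DivPow.coeff_mon]
    by_cases h : r = Sum.elim s 0
    · subst h
      simp [DivPow.coeff_mon]
    · rw [if_neg h]
      split_ifs with h1
      · rw [DivPow.coeff_mon, if_neg]
        rintro rfl
        refine h (funext fun a => ?_)
        rcases a with a | a
        · rfl
        · exact h1 a
      · rw [map_zero]
  exact LinearMap.congr_fun h f

theorem restr_val (f : O K (tildeN N)) : O.val (restr K N f) = restrHom K (O.val f) := rfl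

/-- A monomial survives the substitution only if it is free of η and ξ. Exponents add without
cancellation, so a product is free of them exactly when both factors are; the binomial factors at
these places are then 1. -/
theorem restrHom_mul (f g : DivPow K MbIdx) :
    restrHom K (f * g) = restrHom K f * restrHom K g := by
  have h : (DivPow.mulHom (K := K) (ι := MbIdx)).compr₂ (restrHom K) =
      (DivPow.mulHom).compl₁₂ (restrHom K) (restrHom K) := by
    refine DivPow.hom_ext fun r => DivPow.hom_ext fun s => ?_
    rw [LinearMap.compr₂_apply, LinearMap.compl₁₂_apply, ← DivPow.mul_def, ← DivPow.mul_def,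
      DivPow.mon_mul_mon, map_smul]
    simp only [restrHom, DivPow.lift_mon]
    by_cases hr : ∀ a, r (Sum.inr a) = 0
    · by_cases hs : ∀ a, s (Sum.inr a) = 0
      · have hrs : ∀ a, (r + s) (Sum.inr a) = 0 := fun a => by simp [hr a, hs a]
        rw [if_pos hr, if_pos hs, if_pos hrs, DivPow.mon_mul_mon, Fintype.prod_sum_type,
          Finset.prod_eq_one (s := (Finset.univ : Finset (Fin 3 ⊕ Fin 3))), mul_one]
        · rfl
        · intro a _
          rw [hr a, hs a]; rfl
      · rw [if_neg hs, mul_zero, if_neg, smul_zero]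
        exact fun h => hs fun a => (Nat.add_eq_zero_iff.1 (h a)).2
    · rw [if_neg hr, zero_mul, if_neg, smul_zero]
      exact fun h => hr fun a => (Nat.add_eq_zero_iff.1 (h a)).1
  exact LinearMap.congr_fun (LinearMap.congr_fun h f) g

theorem restr_mul (f g : O K (tildeN N)) : restr K N (f * g) = restr K N f * restr K N g :=
  O.ext (by rw [restr_val, map_mul, restrHom_mul, map_mul]; rfl)

theorem restr_X_inr (a : Fin 3 ⊕ Fin 3) : restr K N (X (Sum.inr a)) = 0 := by
  refine O.ext (DivPow.ext_coeff fun r => ?_)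
  classical
  rw [restr_val, coeff_restrHom, X, O.val_mk, DivPow.coeff_mon, if_neg, map_zero, map_zero]
  intro h
  simpa using congrFun h (Sum.inr a)

theorem restr_pd_inl (i : Fin 5) (f : O K (tildeN N)) :
    restr K N (pd (Sum.inl i) f) = pd i (restr K N f) := by
  refine O.ext (DivPow.ext_coeff fun r => ?_)
  rw [restr_val, coeff_restrHom, pd_val, pd_val, DivPow.coeff_pd, DivPow.coeff_pd, restr_val,
    coeff_restrHom]
  congr 2
  funext a
  rcases a with a | a <;> simp [Pi.single_apply]

variable (K) in
/-- Divided power polynomials in `u_1, …, u_5`, as divided power polynomials in the eleven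
indeterminates. -/
def embHom : DivPow K (Fin 5) →ₗ[K] DivPow K MbIdx :=
  DivPow.lift fun s => DivPow.mon (Sum.elim s 0)

theorem embHom_mem {f : DivPow K (Fin 5)} (hf : f ∈ DivPow.trunc K N) :
    embHom K f ∈ DivPow.trunc K (tildeN N) := by
  refine DivPow.map_trunc_le K (embHom K) (Subalgebra.toSubmodule (DivPow.trunc K (tildeN N)))
    (fun r hr => ?_) hf
  rw [embHom, DivPow.lift_mon]
  refine DivPow.mon_mem_trunc K fun a n hn => ?_
  rcases a with a | a
  · exact hr a n hn
  · simp

variable (K N) in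
/-- The functions of `u_1, …, u_5`, as functions of the eleven indeterminates. -/
def emb : O K N →ₗ[K] O K (tildeN N) where
  toFun f := O.mk (embHom K (O.val f)) (embHom_mem (O.val_mem f))
  map_add' f g := O.ext (by
    rw [O.val_mk, map_add O.val, map_add O.val, O.val_mk, O.val_mk, map_add (embHom K)])
  map_smul' a f := O.ext (by
    rw [O.val_mk, map_smul O.val, RingHom.id_apply, map_smul O.val, O.val_mk,
      map_smul (embHom K)])

theorem emb_val (f : O K N) : O.val (emb K N f) = embHom K (O.val f) := rfl

theorem coeff_embHom (r : MbIdx → ℕ) (f : DivPow K (Fin 5)) : DivPow.coeff r (embHom K f) =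
    if ∀ a, r (Sum.inr a) = 0 then DivPow.coeff (fun i => r (Sum.inl i)) f else 0 := by
  classical
  split_ifs with h
  · have h' : (DivPow.coeff r).comp (embHom K) = DivPow.coeff (fun i => r (Sum.inl i)) := by
      refine DivPow.hom_ext fun s => ?_
      rw [LinearMap.comp_apply, embHom, DivPow.lift_mon, DivPow.coeff_mon, DivPow.coeff_mon]
      refine if_congr ⟨?_, ?_⟩ rfl rfl
      · rintro rfl; rfl
      · rintro rfl
        funext a
        rcases a with a | a
        · rfl
        · exact (h a).symm
    exact LinearMap.congr_fun h' f
  · have h' : (DivPow.coeff r).comp (embHom K) = 0 := by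
      refine DivPow.hom_ext fun s => ?_
      rw [LinearMap.comp_apply, embHom, DivPow.lift_mon, DivPow.coeff_mon, if_neg]
      · rfl
      · rintro rfl
        exact h fun a => rfl
    exact LinearMap.congr_fun h' f

theorem restr_emb (f : O K N) : restr K N (emb K N f) = f := by
  refine O.ext (DivPow.ext_coeff fun r => ?_)
  rw [restr_val, coeff_restrHom, emb_val, coeff_embHom]
  exact if_pos fun _ => rfl

theorem pd_inl_emb (i : Fin 5) (f : O K N) : pd (Sum.inl i) (emb K N f) = emb K N (pd i f) := by
  refine O.ext (DivPow.ext_coeff fun r => ?_)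
  rw [pd_val, DivPow.coeff_pd, emb_val, emb_val, coeff_embHom, coeff_embHom, pd_val,
    DivPow.coeff_pd]
  refine if_congr (by simp [Pi.single_apply]) ?_ rfl
  congr 2
  funext j
  simp [Pi.single_apply]

theorem pd_inr_emb (a : Fin 3 ⊕ Fin 3) (f : O K N) : pd (Sum.inr a) (emb K N f) = 0 := by
  refine O.ext (DivPow.ext_coeff fun r => ?_)
  rw [pd_val, DivPow.coeff_pd, emb_val, coeff_embHom, if_neg, map_zero, map_zero]
  intro h
  simpa using h a

/-- The shearing component 1 bounds the exponents of η and ξ by 1. This is the trace left by the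
oddness of these indeterminates. -/
theorem pd_inr_pd_inr (a : Fin 3 ⊕ Fin 3) (f : O K (tildeN N)) :
    pd (Sum.inr a) (pd (Sum.inr a) f) = 0 := by
  refine O.ext (DivPow.ext_coeff fun r => ?_)
  rw [pd_val, pd_val, DivPow.coeff_pd, DivPow.coeff_pd, map_zero, map_zero]
  refine DivPow.coeff_eq_zero_of_mem_trunc (O.val_mem f) fun h => ?_
  have := h (Sum.inr a) 1 rfl
  simp at this

theorem X_inr_mul_self (a : Fin 3 ⊕ Fin 3) :
    (X (Sum.inr a) * X (Sum.inr a) : O K (tildeN N)) = 0 := by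
  refine O.ext ?_
  rw [map_mul, X, O.val_mk, DivPow.mon_mul_mon, map_zero, ← Finset.mul_prod_erase _ _
    (Finset.mem_univ (Sum.inr a : MbIdx))]
  simp [CharTwo.two_eq_zero]

/-- The functions all of whose monomials have degree at least `n` in `η` and `ξ`. -/
def Van : ℕ → O K (tildeN N) → Prop
  | 0, _ => True
  | n + 1, g => restr K N g = 0 ∧ ∀ a, Van n (pd (Sum.inr a) g)

namespace Van

theorem zero (n : ℕ) : Van n (0 : O K (tildeN N)) := by
  induction n with
  | zero => trivial
  | succ n ih => exact ⟨map_zero _, fun a => by rwa [map_zero]⟩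

theorem add {n : ℕ} : ∀ {f g : O K (tildeN N)}, Van n f → Van n g → Van n (f + g) := by
  induction n with
  | zero => exact fun _ _ => trivial
  | succ n ih =>
    exact fun hf hg => ⟨by rw [map_add, hf.1, hg.1, add_zero], fun a => by
      rw [map_add]; exact ih (hf.2 a) (hg.2 a)⟩

theorem of_succ {n : ℕ} : ∀ {f : O K (tildeN N)}, Van (n + 1) f → Van n f := by
  induction n with
  | zero => exact fun _ => trivial
  | succ n ih => exact fun hf => ⟨hf.1, fun a => ih (hf.2 a)⟩

theorem mul {n : ℕ} : ∀ (f : O K (tildeN N)) {g : O K (tildeN N)}, Van n g → Van n (f * g) := by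
  induction n with
  | zero => exact fun _ _ _ => trivial
  | succ n ih =>
    intro f g hg
    refine ⟨by rw [restr_mul, hg.1, mul_zero], fun a => ?_⟩
    rw [Derivation.leibniz, smul_eq_mul, smul_eq_mul, mul_comm g]
    exact (ih f (hg.2 a)).add (ih _ hg.of_succ)

theorem pd_inl {n : ℕ} (i : Fin 5) :
    ∀ {g : O K (tildeN N)}, Van n g → Van n (pd (Sum.inl i) g) := by
  induction n with
  | zero => exact fun _ => trivial
  | succ n ih =>
    intro g hg
    refine ⟨by rw [restr_pd_inl, hg.1, map_zero], fun a => ?_⟩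
    rw [pd_comm]
    exact ih (hg.2 a)

/-- A coefficient of degree d in η, ξ is read off at η = ξ = 0 after d differentiations, each of
which costs one unit of the vanishing order. -/
theorem coeff_eq_zero {n : ℕ} : ∀ {g : O K (tildeN N)}, Van n g → ∀ {r : MbIdx → ℕ},
    ∑ a, r (Sum.inr a) < n → DivPow.coeff r (O.val g) = 0 := by
  induction n with
  | zero => exact fun _ _ h => absurd h (Nat.not_lt_zero _)
  | succ n ih =>
    intro g hg r hr
    by_cases h : ∀ a, r (Sum.inr a) = 0
    · have e : r = Sum.elim (fun i => r (Sum.inl i)) 0 := by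
        funext a
        rcases a with a | a
        · rfl
        · exact h a
      rw [e, ← coeff_restrHom, ← restr_val, hg.1, map_zero, map_zero]
    · push Not at h
      obtain ⟨a, ha⟩ := h
      have e : r = (r - Pi.single (Sum.inr a) 1) + Pi.single (Sum.inr a) 1 := by
        funext j
        by_cases hj : j = Sum.inr a
        · subst hj; simp; omega
        · simp [Pi.single_eq_of_ne hj]
      rw [e, ← DivPow.coeff_pd, ← pd_val]
      refine ih (hg.2 a) (lt_of_lt_of_le (Finset.sum_lt_sum ?_ ⟨a, Finset.mem_univ _, ?_⟩)
        (Nat.lt_succ_iff.1 hr))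
      · intro b _
        exact tsub_le_self
      · simp only [Pi.sub_apply, Pi.single_eq_same]; omega

theorem eq_zero {g : O K (tildeN N)} (h : ∀ n, Van n g) : g = 0 :=
  O.ext (DivPow.ext_coeff fun r => by
    rw [(h (∑ a, r (Sum.inr a) + 1)).coeff_eq_zero (Nat.lt_succ_self _), map_zero, map_zero])

end Van

end Restriction

/-! ### The frame Y and its commutation relations -/

section Frame

-- A cyclic permutation of the three indices is written (i, i+1, i+2) modulo 3. These rules
-- normalise shifts, so that each identity is proved once for a general i.
@[simp] theorem fin3_ne_add_one (i : Fin 3) : ¬ i = i + 1 := by revert i; decide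
@[simp] theorem fin3_ne_add_two (i : Fin 3) : ¬ i = i + 2 := by revert i; decide
@[simp] theorem fin3_add_one_add_one (i : Fin 3) : i + 1 + 1 = i + 2 := by revert i; decide
@[simp] theorem fin3_add_one_add_two (i : Fin 3) : i + 1 + 2 = i := by revert i; decide
@[simp] theorem fin3_add_two_add_one (i : Fin 3) : i + 2 + 1 = i := by revert i; decide
@[simp] theorem fin3_add_two_add_two (i : Fin 3) : i + 2 + 2 = i + 1 := by revert i; decide

theorem fin3_cases {P : Fin 3 → Prop} (i : Fin 3) (h0 : P i) (h1 : P (i + 1)) (h2 : P (i + 2)) :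
    ∀ j, P j := by
  intro j
  have h : j = i ∨ j = i + 1 ∨ j = i + 2 := by clear h0 h1 h2; revert i j; decide
  rcases h with rfl | rfl | rfl <;> assumption

theorem sum_fin3 {M : Type*} [AddCommMonoid M] (f : Fin 3 → M) (i : Fin 3) :
    ∑ j, f j = f i + f (i + 1) + f (i + 2) := by
  rw [Fin.sum_univ_three]
  fin_cases i
  · rfl
  · change f 0 + f 1 + f 2 = f 1 + f 2 + f 0
    abel
  · change f 0 + f 1 + f 2 = f 2 + f 0 + f 1
    abel

@[simp] theorem iu_inj (i j : Fin 3) : iu i = iu j ↔ i = j := by simp [iu]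
@[simp] theorem ichi_inj (i j : Fin 2) : ichi i = ichi j ↔ i = j := by
  revert i j; simp only [ichi]; decide
@[simp] theorem ieta_inj (i j : Fin 3) : ieta i = ieta j ↔ i = j := by simp [ieta]
@[simp] theorem ixi_inj (i j : Fin 3) : ixi i = ixi j ↔ i = j := by simp [ixi]
@[simp] theorem iu_ne_ichi (i : Fin 3) (j : Fin 2) : ¬ iu i = ichi j := by
  revert i j; simp only [iu, ichi]; decide
@[simp] theorem ichi_ne_iu (i : Fin 3) (j : Fin 2) : ¬ ichi j = iu i := by
  revert i j; simp only [iu, ichi]; decide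
@[simp] theorem iu_ne_ieta (i j : Fin 3) : ¬ iu i = ieta j := by simp [iu, ieta]
@[simp] theorem ieta_ne_iu (i j : Fin 3) : ¬ ieta i = iu j := by simp [iu, ieta]
@[simp] theorem iu_ne_ixi (i j : Fin 3) : ¬ iu i = ixi j := by simp [iu, ixi]
@[simp] theorem ixi_ne_iu (i j : Fin 3) : ¬ ixi i = iu j := by simp [iu, ixi]
@[simp] theorem ieta_ne_ixi (i j : Fin 3) : ¬ ieta i = ixi j := by simp [ieta, ixi]
@[simp] theorem ixi_ne_ieta (i j : Fin 3) : ¬ ixi i = ieta j := by simp [ieta, ixi]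
@[simp] theorem ichi_ne_ieta (i : Fin 2) (j : Fin 3) : ¬ ichi i = ieta j := by simp [ichi, ieta]
@[simp] theorem ieta_ne_ichi (i : Fin 2) (j : Fin 3) : ¬ ieta j = ichi i := by simp [ichi, ieta]
@[simp] theorem ichi_ne_ixi (i : Fin 2) (j : Fin 3) : ¬ ichi i = ixi j := by simp [ichi, ixi]
@[simp] theorem ixi_ne_ichi (i : Fin 2) (j : Fin 3) : ¬ ixi j = ichi i := by simp [ichi, ixi]

theorem mbIdx_cases {P : MbIdx → Prop} (hu : ∀ i, P (iu i)) (hc : ∀ s, P (ichi s))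
    (he : ∀ i, P (ieta i)) (hx : ∀ i, P (ixi i)) : ∀ k, P k := by
  rintro (k | k | k)
  · fin_cases k
    · exact hu 0
    · exact hu 1
    · exact hu 2
    · exact hc 0
    · exact hc 1
  · exact he k
  · exact hx k

variable {K : Type*} [Field K] [CharP K 2] {N : Fin 5 → WithTop ℕ+}

theorem sum_mbIdx {M : Type*} [AddCommMonoid M] (f : MbIdx → M) :
    ∑ k, f k = ∑ i : Fin 5, f (Sum.inl i) + (∑ i, f (ieta i) + ∑ i, f (ixi i)) := by
  rw [Fintype.sum_sum_type, Fintype.sum_sum_type]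
  rfl

/-- All signs are replaced by plus, which is legitimate in characteristic 2 and removes the
difference between cyclic and anticyclic index orders. -/
theorem Yeta_apply (i : Fin 3) (g : O K (tildeN N)) : Yeta K N i g = pd (ieta i) g +
    X (ixi (i + 2)) * pd (iu (i + 1)) g + X (ixi (i + 1)) * pd (iu (i + 2)) g +
    (X (ixi (i + 2)) * X (ieta (i + 1)) + X (ixi (i + 1)) * X (ieta (i + 2))) * pd (ichi 0) g +
    X (ixi (i + 1)) * X (ixi (i + 2)) * pd (ichi 1) g := by
  simp only [Yeta, Derivation.add_apply, Derivation.sub_apply, Derivation.smul_apply, smul_eq_mul,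
    CharTwo.sub_eq_add]
  ring

variable (K N) in
/-- `∂_{u_i} + η_i ∂_{χ_1} + ξ_i ∂_{χ_2}`, the bracket of `Y_{ξ_j}` and `Y_{η_k}`. -/
def Yu (i : Fin 3) : Der K (tildeN N) :=
  pd (iu i) + (X (ieta i) : O K (tildeN N)) • pd (ichi 0) +
    (X (ixi i) : O K (tildeN N)) • pd (ichi 1)

theorem Yu_apply (i : Fin 3) (g : O K (tildeN N)) : Yu K N i g =
    pd (iu i) g + X (ieta i) * pd (ichi 0) g + X (ixi i) * pd (ichi 1) g := rfl

theorem pd_mem_vect {ι : Type*} [Fintype ι] [DecidableEq ι] {N : ι → WithTop ℕ+} (i : ι) :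
    (pd i : Der K N) ∈ vect K N := by
  have := smul_pd_mem_vect (1 : O K N) i
  rwa [one_smul] at this

theorem Yxi_mem_vect (i : Fin 3) : Yxi K N i ∈ vect K (tildeN N) := pd_mem_vect _

theorem Yeta_mem_vect (i : Fin 3) : Yeta K N i ∈ vect K (tildeN N) :=
  (vect K (tildeN N)).sub_mem ((vect K (tildeN N)).add_mem ((vect K (tildeN N)).add_mem
    (pd_mem_vect _) ((vect K (tildeN N)).sub_mem (smul_pd_mem_vect _ _) (smul_pd_mem_vect _ _)))
    (smul_pd_mem_vect _ _)) (smul_pd_mem_vect _ _)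

theorem Yeta_xi (i j : Fin 3) : Yeta K N i (X (ixi j)) = 0 := by
  simp [Yeta_apply, pd_X]

theorem Yeta_eta (i j : Fin 3) : Yeta K N i (X (ieta j)) = if i = j then 1 else 0 := by
  simp [Yeta_apply, pd_X]

theorem Yeta_u_self (i : Fin 3) : Yeta K N i (X (iu i)) = 0 := by
  simp [Yeta_apply, pd_X]

theorem Yeta_u_succ (i : Fin 3) : Yeta K N i (X (iu (i + 1))) = X (ixi (i + 2)) := by
  simp [Yeta_apply, pd_X]

theorem Yeta_u_succ' (i : Fin 3) : Yeta K N i (X (iu (i + 2))) = X (ixi (i + 1)) := by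
  simp [Yeta_apply, pd_X]

theorem Yeta_chi_zero (i : Fin 3) : Yeta K N i (X (ichi 0)) =
    X (ixi (i + 2)) * X (ieta (i + 1)) + X (ixi (i + 1)) * X (ieta (i + 2)) := by
  simp [Yeta_apply, pd_X]

theorem Yeta_chi_one (i : Fin 3) : Yeta K N i (X (ichi 1)) =
    X (ixi (i + 1)) * X (ixi (i + 2)) := by
  simp [Yeta_apply, pd_X]

theorem Yxi_Yeta_self (i : Fin 3) (g : O K (tildeN N)) :
    Yxi K N i (Yeta K N i g) = Yeta K N i (Yxi K N i g) := by
  simp only [Yxi, Yeta_apply, map_add, Derivation.leibniz, smul_eq_mul, pd_X, pd_comm (ixi i)]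
  simp

/-- In words of the frame, [Y_{ξ_{i+1}}, Y_{η_i}] is the Y_u carrying the third index. Together with
the companion for i+2 and the relations with `Yu`, this is the only way in which the shape of the
distribution enters later. -/
theorem Yxi_Yeta_succ (i : Fin 3) (g : O K (tildeN N)) :
    Yxi K N (i + 1) (Yeta K N i g) = Yeta K N i (Yxi K N (i + 1) g) + Yu K N (i + 2) g := by
  simp only [Yxi, Yeta_apply, Yu_apply, map_add, Derivation.leibniz, smul_eq_mul, pd_X,
    pd_comm (ixi (i + 1))]
  simp
  ring

theorem Yxi_Yeta_succ' (i : Fin 3) (g : O K (tildeN N)) :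
    Yxi K N (i + 2) (Yeta K N i g) = Yeta K N i (Yxi K N (i + 2) g) + Yu K N (i + 1) g := by
  simp only [Yxi, Yeta_apply, Yu_apply, map_add, Derivation.leibniz, smul_eq_mul, pd_X,
    pd_comm (ixi (i + 2))]
  simp
  ring

theorem Yxi_Yu (a b : Fin 3) (g : O K (tildeN N)) :
    Yxi K N a (Yu K N b g) = Yu K N b (Yxi K N a g) + if a = b then pd (ichi 1) g else 0 := by
  simp only [Yxi, Yu_apply, map_add, Derivation.leibniz, smul_eq_mul, pd_X, pd_comm (ixi a)]
  by_cases h : a = b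
  · subst h; simp; ring
  · simp [h]

theorem Yxi_Yxi_self (a : Fin 3) (g : O K (tildeN N)) : Yxi K N a (Yxi K N a g) = 0 :=
  pd_inr_pd_inr _ _

theorem xi_mul_self (a : Fin 3) : (X (ixi a) * X (ixi a) : O K (tildeN N)) = 0 := X_inr_mul_self _

theorem eta_mul_self (a : Fin 3) : (X (ieta a) * X (ieta a) : O K (tildeN N)) = 0 :=
  X_inr_mul_self _

theorem Yeta_pd_inl (i : Fin 3) (j : Fin 5) (g : O K (tildeN N)) :
    Yeta K N i (pd (Sum.inl j) g) = pd (Sum.inl j) (Yeta K N i g) := by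
  have h : ∀ a : Fin 3 ⊕ Fin 3, pd (Sum.inl j) (X (Sum.inr a) : O K (tildeN N)) = 0 := fun a => by
    rw [pd_X, if_neg (by simp)]
  have h1 : ∀ a, pd (Sum.inl j) (X (ixi a) : O K (tildeN N)) = 0 := fun a => h _
  have h2 : ∀ a, pd (Sum.inl j) (X (ieta a) : O K (tildeN N)) = 0 := fun a => h _
  simp only [Yeta_apply, map_add, Derivation.leibniz, smul_eq_mul, h1, h2, pd_comm _ (Sum.inl j) g]
  ring

theorem Yeta_Yu (a b : Fin 3) (g : O K (tildeN N)) :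
    Yeta K N a (Yu K N b g) = Yu K N b (Yeta K N a g) + if a = b then pd (ichi 0) g else 0 := by
  have h1 : Yeta K N a (pd (iu b) g) = pd (iu b) (Yeta K N a g) := Yeta_pd_inl _ _ _
  have h2 : ∀ s, Yeta K N a (pd (ichi s) g) = pd (ichi s) (Yeta K N a g) :=
    fun s => Yeta_pd_inl _ _ _
  simp only [Yu_apply, map_add, Derivation.leibniz, smul_eq_mul, h1, h2, Yeta_xi, Yeta_eta]
  split_ifs with h
  · simp; ring
  · simp

/-- The square of ∂_{η_i} is zero, ∂_{η_i} commutes with the other summands (their coefficients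
involve only the other η), and among those each cross term occurs twice or contains some ξ_j². -/
theorem Yeta_Yeta_self (i : Fin 3) (g : O K (tildeN N)) : Yeta K N i (Yeta K N i g) = 0 := by
  have h1 : ∀ j, pd (iu j) (Yeta K N i g) = Yeta K N i (pd (iu j) g) :=
    fun _ => (Yeta_pd_inl _ _ _).symm
  have h2 : ∀ s, pd (ichi s) (Yeta K N i g) = Yeta K N i (pd (ichi s) g) :=
    fun _ => (Yeta_pd_inl _ _ _).symm
  have h3 : pd (ieta i) (Yeta K N i g) = Yeta K N i (pd (ieta i) g) := by
    simp only [Yeta_apply, map_add, Derivation.leibniz, smul_eq_mul, pd_X, pd_comm (ieta i)]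
    simp
  have h4 : pd (ieta i) (pd (ieta i) g) = 0 := pd_inr_pd_inr _ _
  have x1 := xi_mul_self (K := K) (N := N) (i + 1)
  have x2 := xi_mul_self (K := K) (N := N) (i + 2)
  rw [Yeta_apply i (Yeta K N i g), h1, h1, h2, h2, h3]
  simp only [Yeta_apply, h4, pd_comm (iu _) (ieta i) g, pd_comm (ichi _) (ieta i) g,
    pd_comm (ichi _) (iu _) g, pd_comm (ichi 1) (ichi 0) g, pd_comm (iu (i + 2)) (iu (i + 1)) g]
  grind

end Frame

/-! ### Coefficients along the frame and the equations defining F(mb) -/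

section Components

variable {K : Type*} [Field K] [CharP K 2] {N : Fin 5 → WithTop ℕ+}

/-- The coefficient of `Yu i` in the decomposition of `D` with respect to the fields `Y`. -/
def mbC (i : Fin 3) (D : Der K (tildeN N)) : O K (tildeN N) :=
  D (X (iu i)) + (X (ixi (i + 1)) * D (X (ieta (i + 2))) + X (ixi (i + 2)) * D (X (ieta (i + 1))))

theorem mbF1_eq (i : Fin 3) (D : Der K (tildeN N)) : mbF1 D = D (X (ichi 0)) +
    (D (X (iu i)) * X (ieta i) + D (X (iu (i + 1))) * X (ieta (i + 1)) +
      D (X (iu (i + 2))) * X (ieta (i + 2))) := by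
  rw [mbF1, sum_fin3 _ i, CharTwo.sub_eq_add]

theorem mbF2_eq (i : Fin 3) (D : Der K (tildeN N)) : mbF2 D = D (X (ichi 1)) +
    (D (X (iu i)) * X (ixi i) + D (X (iu (i + 1))) * X (ixi (i + 1)) +
      D (X (iu (i + 2))) * X (ixi (i + 2))) +
    (D (X (ieta i)) * (X (ixi (i + 1)) * X (ixi (i + 2))) +
      D (X (ieta (i + 1))) * (X (ixi (i + 2)) * X (ixi i)) +
      D (X (ieta (i + 2))) * (X (ixi i) * X (ixi (i + 1)))) := by
  rw [mbF2, sum_fin3 _ i, sum_fin3 _ i, CharTwo.sub_eq_add, CharTwo.sub_eq_add]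
  simp

/-- Any field is ∑ E(ξ_i)Y_{ξ_i} + ∑ E(η_i)Y_{η_i} + ∑ C_i Y_{u_i} + F_1∂_{χ_1} + F_2∂_{χ_2}, with
C_i = `mbC i E`. So C_i, F_1 and F_2 are the coordinates transversal to the distribution. -/
theorem mem_mbDistribution_iff {E : Der K (tildeN N)} : E ∈ mbDistribution K N ↔
    E ∈ vect K (tildeN N) ∧ (∀ i, mbC i E = 0) ∧ mbF1 E = 0 ∧ mbF2 E = 0 := by
  constructor
  · intro h
    induction h using Submodule.span_induction with
    | mem E h =>
      rcases h with ⟨i, rfl⟩ | ⟨i, rfl⟩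
      · refine ⟨Yxi_mem_vect i, fun j => ?_, ?_, ?_⟩
        · simp [mbC, Yxi, pd_X]
        · simp [mbF1, Yxi, pd_X]
        · simp [mbF2, Yxi, pd_X]
      · refine ⟨Yeta_mem_vect i, fin3_cases i ?_ ?_ ?_, ?_, ?_⟩
        · simp [mbC, Yeta_u_self, Yeta_eta]
        · simp [mbC, Yeta_u_succ, Yeta_eta, CharTwo.add_self_eq_zero]
        · simp [mbC, Yeta_u_succ', Yeta_eta, CharTwo.add_self_eq_zero]
        · rw [mbF1_eq i, Yeta_u_self, Yeta_u_succ, Yeta_u_succ', Yeta_chi_zero, zero_mul, zero_add,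
            CharTwo.add_self_eq_zero]
        · rw [mbF2_eq i, Yeta_u_self, Yeta_u_succ, Yeta_u_succ', Yeta_chi_one]
          simp [Yeta_eta]
          grind
    | zero => exact ⟨(vect K (tildeN N)).zero_mem, by simp [mbC], by simp [mbF1], by simp [mbF2]⟩
    | add E F _ _ hE hF =>
      refine ⟨(vect K (tildeN N)).add_mem hE.1 hF.1, fun i => ?_, ?_, ?_⟩
      · rw [← add_zero (0 : O K (tildeN N))]
        nth_rewrite 1 [← hE.2.1 i]
        rw [← hF.2.1 i]
        simp only [mbC, Derivation.add_apply]; ring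
      · rw [← add_zero (0 : O K (tildeN N))]
        nth_rewrite 1 [← hE.2.2.1]
        rw [← hF.2.2.1]
        simp only [mbF1_eq 0, Derivation.add_apply]; ring
      · rw [← add_zero (0 : O K (tildeN N))]
        nth_rewrite 1 [← hE.2.2.2]
        rw [← hF.2.2.2]
        simp only [mbF2_eq 0, Derivation.add_apply]; ring
    | smul a E _ hE =>
      refine ⟨?_, fun i => ?_, ?_, ?_⟩
      · obtain ⟨f, rfl⟩ := hE.1
        exact ⟨fun k => a * f k, by simp only [Finset.smul_sum, mul_smul]⟩
      · rw [← mul_zero a, ← hE.2.1 i]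
        simp only [mbC, Derivation.smul_apply, smul_eq_mul]; ring
      · rw [← mul_zero a, ← hE.2.2.1]
        simp only [mbF1_eq 0, Derivation.smul_apply, smul_eq_mul]; ring
      · rw [← mul_zero a, ← hE.2.2.2]
        simp only [mbF2_eq 0, Derivation.smul_apply, smul_eq_mul]; ring
  · rintro ⟨hE, hC, h1, h2⟩
    have hmem : ∑ i, (E (X (ixi i)) • Yxi K N i + E (X (ieta i)) • Yeta K N i) ∈
        mbDistribution K N :=
      Submodule.sum_mem _ fun i _ => Submodule.add_mem _
        (Submodule.smul_mem _ _ (Submodule.subset_span (Or.inl ⟨i, rfl⟩)))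
        (Submodule.smul_mem _ _ (Submodule.subset_span (Or.inr ⟨i, rfl⟩)))
    have hv : ∑ i, (E (X (ixi i)) • Yxi K N i + E (X (ieta i)) • Yeta K N i) ∈
        vect K (tildeN N) := by
      have hs : ∀ (a : O K (tildeN N)) {F : Der K (tildeN N)}, F ∈ vect K (tildeN N) →
          a • F ∈ vect K (tildeN N) := by
        rintro a _ ⟨f, rfl⟩
        exact ⟨fun k => a * f k, by simp only [Finset.smul_sum, mul_smul]⟩
      exact (vect K (tildeN N)).toSubmodule.sum_mem fun i _ => (vect K (tildeN N)).add_mem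
        (hs _ (Yxi_mem_vect i)) (hs _ (Yeta_mem_vect i))
    -- When the transversal coordinates vanish, they express the u- and χ-components of E through
    -- its η-components, which agree on both sides by construction.
    convert hmem using 1
    have hu : ∀ i, E (X (iu i)) = X (ixi (i + 1)) * E (X (ieta (i + 2))) +
        X (ixi (i + 2)) * E (X (ieta (i + 1))) := fun i => CharTwo.add_eq_zero.1 (hC i)
    refine vect_ext hE hv (mbIdx_cases ?_ ?_ ?_ ?_)
    · intro i
      rw [sum_fin3 _ i, hu]
      have e1 := Yeta_u_succ (K := K) (N := N) (i + 2)
      have e2 := Yeta_u_succ' (K := K) (N := N) (i + 1)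
      simp only [fin3_add_two_add_one, fin3_add_one_add_two, fin3_add_two_add_two,
        fin3_add_one_add_one] at e1 e2
      simp only [Derivation.add_apply, Derivation.smul_apply, smul_eq_mul, Yeta_u_self, e1, e2,
        Yxi, pd_X]
      simp
      ring
    · rw [Fin.forall_fin_two]
      constructor
      · rw [mbF1_eq 0, CharTwo.add_eq_zero] at h1
        rw [h1, sum_fin3 _ 0, hu, hu, hu]
        simp only [Derivation.add_apply, Derivation.smul_apply, smul_eq_mul, Yeta_chi_zero,
          Yxi, pd_X]
        simp
        ring
      · rw [mbF2_eq 0, add_assoc, CharTwo.add_eq_zero] at h2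
        rw [h2, sum_fin3 _ 0, hu, hu, hu]
        simp only [Derivation.add_apply, Derivation.smul_apply, smul_eq_mul, Yeta_chi_one,
          Yxi, pd_X]
        simp
        grind
    · intro i
      rw [sum_fin3 _ i]
      simp only [Derivation.add_apply, Derivation.smul_apply, smul_eq_mul, Yeta_eta, Yxi, pd_X]
      simp
    · intro i
      rw [sum_fin3 _ i]
      simp only [Derivation.add_apply, Derivation.smul_apply, smul_eq_mul, Yeta_xi, Yxi, pd_X]
      simp

/-- The generators suffice because [D, aE] = D(a)E + a[D,E]. -/
theorem mem_FMb_iff_lie {D : Der K (tildeN N)} : D ∈ FMb K N ↔ D ∈ vect K (tildeN N) ∧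
    ∀ i, ⁅D, Yxi K N i⁆ ∈ mbDistribution K N ∧ ⁅D, Yeta K N i⁆ ∈ mbDistribution K N := by
  constructor
  · rintro ⟨hD, h⟩
    exact ⟨hD, fun i => ⟨h _ (Submodule.subset_span (Or.inl ⟨i, rfl⟩)),
      h _ (Submodule.subset_span (Or.inr ⟨i, rfl⟩))⟩⟩
  · rintro ⟨hD, h⟩
    refine ⟨hD, fun Y hY => ?_⟩
    induction hY using Submodule.span_induction with
    | mem E h' =>
      rcases h' with ⟨i, rfl⟩ | ⟨i, rfl⟩
      · exact (h i).1
      · exact (h i).2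
    | zero =>
      have : ⁅D, (0 : Der K (tildeN N))⁆ = 0 := lie_zero D
      rw [this]
      exact Submodule.zero_mem _
    | add E F _ _ hE hF =>
      have : ⁅D, E + F⁆ = ⁅D, E⁆ + ⁅D, F⁆ := lie_add D E F
      rw [this]
      exact Submodule.add_mem _ hE hF
    | smul a E hE' hE =>
      have : ⁅D, a • E⁆ = D a • E + a • ⁅D, E⁆ := by
        ext x
        simp only [Derivation.commutator_apply, Derivation.add_apply, Derivation.smul_apply,
          smul_eq_mul, Derivation.leibniz]
        ring
      rw [this]
      exact Submodule.add_mem _ (Submodule.smul_mem _ _ hE') (Submodule.smul_mem _ _ hE)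

/-- Here and in the next lemmas, a transversal coordinate of [D,Y] is Y applied to that coordinate
of D, plus the coordinate of D along a frame field whose bracket with Y produces the direction in
question: D(η) and D(ξ) feed into C through [Y_ξ, Y_η] = Y_u, and C_i feeds into F_2 and F_1 through
[Y_{ξ_i}, Y_{u_i}] and [Y_{η_i}, Y_{u_i}]. -/
theorem mbC_lie_Yxi_self (i : Fin 3) (D : Der K (tildeN N)) :
    mbC i ⁅D, Yxi K N i⁆ = Yxi K N i (mbC i D) := by
  simp only [mbC, Derivation.commutator_apply, Yxi, pd_X, map_add, Derivation.leibniz, smul_eq_mul,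
    CharTwo.sub_eq_add]
  simp

theorem mbC_lie_Yxi_succ (i : Fin 3) (D : Der K (tildeN N)) :
    mbC i ⁅D, Yxi K N (i + 1)⁆ = Yxi K N (i + 1) (mbC i D) + D (X (ieta (i + 2))) := by
  simp only [mbC, Derivation.commutator_apply, Yxi, pd_X, map_add, Derivation.leibniz, smul_eq_mul,
    CharTwo.sub_eq_add]
  simp
  grind

theorem mbC_lie_Yxi_succ' (i : Fin 3) (D : Der K (tildeN N)) :
    mbC i ⁅D, Yxi K N (i + 2)⁆ = Yxi K N (i + 2) (mbC i D) + D (X (ieta (i + 1))) := by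
  simp only [mbC, Derivation.commutator_apply, Yxi, pd_X, map_add, Derivation.leibniz, smul_eq_mul,
    CharTwo.sub_eq_add]
  simp
  grind

theorem mbF1_lie_Yxi (i : Fin 3) (D : Der K (tildeN N)) :
    mbF1 ⁅D, Yxi K N i⁆ = Yxi K N i (mbF1 D) := by
  simp only [mbF1_eq i, Derivation.commutator_apply, Yxi, pd_X, map_add, Derivation.leibniz,
    smul_eq_mul, CharTwo.sub_eq_add]
  simp
  grind

theorem mbF2_lie_Yxi (i : Fin 3) (D : Der K (tildeN N)) :
    mbF2 ⁅D, Yxi K N i⁆ = Yxi K N i (mbF2 D) + mbC i D := by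
  simp only [mbF2_eq i, mbC, Derivation.commutator_apply, Yxi, pd_X, map_add, Derivation.leibniz,
    smul_eq_mul, CharTwo.sub_eq_add]
  simp
  grind

theorem mbC_lie_Yeta_self (i : Fin 3) (D : Der K (tildeN N)) :
    mbC i ⁅D, Yeta K N i⁆ = Yeta K N i (mbC i D) := by
  simp only [mbC, Derivation.commutator_apply, Yeta_eta, Yeta_xi, Yeta_u_self, map_add,
    Derivation.leibniz, smul_eq_mul, CharTwo.sub_eq_add]
  simp

theorem mbC_lie_Yeta_succ (i : Fin 3) (D : Der K (tildeN N)) :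
    mbC (i + 1) ⁅D, Yeta K N i⁆ = Yeta K N i (mbC (i + 1) D) + D (X (ixi (i + 2))) := by
  simp only [mbC, Derivation.commutator_apply, Yeta_eta, Yeta_xi, Yeta_u_succ, map_add,
    Derivation.leibniz, smul_eq_mul, CharTwo.sub_eq_add]
  simp
  ring

theorem mbC_lie_Yeta_succ' (i : Fin 3) (D : Der K (tildeN N)) :
    mbC (i + 2) ⁅D, Yeta K N i⁆ = Yeta K N i (mbC (i + 2) D) + D (X (ixi (i + 1))) := by
  simp only [mbC, Derivation.commutator_apply, Yeta_eta, Yeta_xi, Yeta_u_succ', map_add,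
    Derivation.leibniz, smul_eq_mul, CharTwo.sub_eq_add]
  simp
  ring

theorem mbF1_lie_Yeta (i : Fin 3) (D : Der K (tildeN N)) :
    mbF1 ⁅D, Yeta K N i⁆ = Yeta K N i (mbF1 D) + mbC i D := by
  simp only [mbF1_eq i, mbC, Derivation.commutator_apply, Yeta_eta, Yeta_xi, Yeta_u_self,
    Yeta_u_succ, Yeta_u_succ', Yeta_chi_zero, map_add, Derivation.leibniz,
    smul_eq_mul, CharTwo.sub_eq_add]
  simp
  grind

theorem mbF2_lie_Yeta (i : Fin 3) (D : Der K (tildeN N)) :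
    mbF2 ⁅D, Yeta K N i⁆ = Yeta K N i (mbF2 D) := by
  simp only [mbF2_eq i, Derivation.commutator_apply, Yeta_eta, Yeta_xi, Yeta_u_self,
    Yeta_u_succ, Yeta_u_succ', Yeta_chi_one, map_add, Derivation.leibniz,
    smul_eq_mul, CharTwo.sub_eq_add]
  simp
  grind

/-- Setting the transversal coordinates of all [D, Y_ξ] and [D, Y_η] to zero gives the equations for
F_1, F_2 and C_i directly. The remaining components follow by commuting: for instance D(ξ_i) is Y_η
of some C_j = Y_{ξ_j}F_2, and since Y_ηF_2 = 0 only the commutator Y_{u_i}F_2 is left. Thus D is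
determined by F_1 and F_2. -/
theorem mem_FMb_iff {D : Der K (tildeN N)} : D ∈ FMb K N ↔ D ∈ vect K (tildeN N) ∧
    (∀ i, Yxi K N i (mbF1 D) = 0) ∧ (∀ i, Yeta K N i (mbF2 D) = 0) ∧
    (∀ i, mbC i D = Yxi K N i (mbF2 D)) ∧ (∀ i, mbC i D = Yeta K N i (mbF1 D)) ∧
    (∀ i, D (X (ixi i)) = Yu K N i (mbF2 D)) ∧ (∀ i, D (X (ieta i)) = Yu K N i (mbF1 D)) := by
  rw [mem_FMb_iff_lie]
  constructor
  · rintro ⟨hD, h⟩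
    simp only [mem_mbDistribution_iff] at h
    have h1 : ∀ i, Yxi K N i (mbF1 D) = 0 := fun i => by rw [← mbF1_lie_Yxi]; exact (h i).1.2.2.1
    have h2 : ∀ i, Yeta K N i (mbF2 D) = 0 := fun i => by
      rw [← mbF2_lie_Yeta]; exact (h i).2.2.2.2
    have h3 : ∀ i, mbC i D = Yxi K N i (mbF2 D) := fun i => by
      rw [eq_comm, ← CharTwo.add_eq_zero, ← mbF2_lie_Yxi]; exact (h i).1.2.2.2
    have h4 : ∀ i, mbC i D = Yeta K N i (mbF1 D) := fun i => by
      rw [eq_comm, ← CharTwo.add_eq_zero, ← mbF1_lie_Yeta]; exact (h i).2.2.2.1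
    refine ⟨hD, h1, h2, h3, h4, fun i => ?_, fun i => ?_⟩
    -- The indices are shifted so that the bracket with Y_{η_{i+1}}, in its coordinate C_{i+2},
    -- picks up the third component D(ξ_i).
    · have e := (h (i + 1)).2.2.1 (i + 1 + 1)
      rw [mbC_lie_Yeta_succ, h3, fin3_add_one_add_one, fin3_add_one_add_two] at e
      have e' := Yxi_Yeta_succ (i + 1) (mbF2 D)
      rw [h2, map_zero, fin3_add_one_add_one, fin3_add_one_add_two] at e'
      rw [← CharTwo.add_eq_zero.1 e, ← CharTwo.add_eq_zero.1 e'.symm]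
    · have e := (h (i + 1 + 1)).1.2.1 (i + 1)
      rw [mbC_lie_Yxi_succ, h4, fin3_add_one_add_one, fin3_add_one_add_two] at e
      have e' := Yxi_Yeta_succ (i + 1) (mbF1 D)
      rw [h1, map_zero, zero_add, fin3_add_one_add_one, fin3_add_one_add_two] at e'
      rw [← CharTwo.add_eq_zero.1 e, e']
  · rintro ⟨hD, h1, h2, h3, h4, h5, h6⟩
    have hl : ∀ {E : Der K (tildeN N)}, E ∈ vect K (tildeN N) → ⁅D, E⁆ ∈ vect K (tildeN N) :=
      fun hE => (vect K (tildeN N)).lie_mem hD hE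
    refine ⟨hD, fun i => ⟨mem_mbDistribution_iff.2 ⟨hl (Yxi_mem_vect i), ?_, ?_, ?_⟩,
      mem_mbDistribution_iff.2 ⟨hl (Yeta_mem_vect i), ?_, ?_, ?_⟩⟩⟩
    · refine fin3_cases i ?_ ?_ ?_
      · rw [mbC_lie_Yxi_self, h3, Yxi_Yxi_self]
      · have e := mbC_lie_Yxi_succ' (i + 1) D
        rw [fin3_add_one_add_two, fin3_add_one_add_one] at e
        have e' := Yxi_Yeta_succ' (i + 1) (mbF1 D)
        rw [fin3_add_one_add_two, fin3_add_one_add_one, h1, map_zero, zero_add] at e'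
        rw [e, h4, e', h6, CharTwo.add_self_eq_zero]
      · have e := mbC_lie_Yxi_succ (i + 2) D
        rw [fin3_add_two_add_one, fin3_add_two_add_two] at e
        have e' := Yxi_Yeta_succ (i + 2) (mbF1 D)
        rw [fin3_add_two_add_one, fin3_add_two_add_two, h1, map_zero, zero_add] at e'
        rw [e, h4, e', h6, CharTwo.add_self_eq_zero]
    · rw [mbF1_lie_Yxi, h1]
    · rw [mbF2_lie_Yxi, h3, CharTwo.add_self_eq_zero]
    · refine fin3_cases i ?_ ?_ ?_
      · rw [mbC_lie_Yeta_self, h4, Yeta_Yeta_self]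
      · have e' := Yxi_Yeta_succ i (mbF2 D)
        rw [h2, map_zero] at e'
        rw [mbC_lie_Yeta_succ, h3, h5, ← e']
      · have e' := Yxi_Yeta_succ' i (mbF2 D)
        rw [h2, map_zero] at e'
        rw [mbC_lie_Yeta_succ', h3, h5, ← e']
    · rw [mbF1_lie_Yeta, h4, CharTwo.add_self_eq_zero]
    · rw [mbF2_lie_Yeta, h2]

end Components

/-! ### The map φ: divergence, injectivity and the deformed bracket -/

section RestrictedFields

variable {K : Type*} [Field K] [CharP K 2] {N : Fin 5 → WithTop ℕ+}

@[simp] theorem restr_X_eta (i : Fin 3) : restr K N (X (ieta i)) = 0 := restr_X_inr _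

@[simp] theorem restr_X_xi (i : Fin 3) : restr K N (X (ixi i)) = 0 := restr_X_inr _

theorem restr_pd_u (i : Fin 3) (f : O K (tildeN N)) :
    restr K N (pd (iu i) f) = pd (i.castLE (by norm_num)) (restr K N f) := restr_pd_inl _ _

theorem restr_pd_chi_zero (f : O K (tildeN N)) :
    restr K N (pd (ichi 0) f) = pd 3 (restr K N f) := restr_pd_inl _ _

theorem restr_pd_chi_one (f : O K (tildeN N)) :
    restr K N (pd (ichi 1) f) = pd 4 (restr K N f) := restr_pd_inl _ _

theorem restr_Yeta (i : Fin 3) (f : O K (tildeN N)) :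
    restr K N (Yeta K N i f) = restr K N (pd (ieta i) f) := by
  simp [Yeta_apply, restr_mul]

theorem restr_Yu (i : Fin 3) (f : O K (tildeN N)) :
    restr K N (Yu K N i f) = pd (i.castLE (by norm_num)) (restr K N f) := by
  simp [Yu_apply, restr_mul, restr_pd_u]

theorem restr_mbC (i : Fin 3) (D : Der K (tildeN N)) :
    restr K N (mbC i D) = restr K N (D (X (iu i))) := by
  simp [mbC, restr_mul]

theorem restr_mbF1 (D : Der K (tildeN N)) : restr K N (mbF1 D) = restr K N (D (X (ichi 0))) := by
  simp [mbF1_eq 0, restr_mul]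

theorem restr_mbF2 (D : Der K (tildeN N)) : restr K N (mbF2 D) = restr K N (D (X (ichi 1))) := by
  simp [mbF2_eq 0, restr_mul]

/-- At η = ξ = 0 the equation C_i = Y_{η_i}F_1 identifies ∂_{η_i}F_1 with g_{u_i}. So D^f is simply
the restriction of the u- and χ-components of D, which is the form used from here on. -/
theorem mbFun_apply {D : Der K (tildeN N)} (hD : D ∈ FMb K N) (j : Fin 5) :
    mbFun D j = restr K N (D (X (Sum.inl j))) := by
  obtain ⟨-, -, -, -, h4, -, -⟩ := mem_FMb_iff.1 hD
  have h : ∀ i, restr K N (pd (ieta i) (mbF1 D)) = restr K N (D (X (iu i))) := fun i => by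
    rw [← restr_Yeta, ← h4, restr_mbC]
  fin_cases j
  · exact h 0
  · exact h 1
  · exact h 2
  · exact restr_mbF1 D
  · exact restr_mbF2 D

/-- The integrability condition of the system. Two fields Y_ξ are applied to Y_ηF_2 = 0 and moved
past Y_η with the frame relations; the commutators left over are the five terms. Its restriction to
η = ξ = 0 is div D^f = 0. -/
theorem sum_Yu_mbC {D : Der K (tildeN N)} (hD : D ∈ FMb K N) :
    Yu K N 0 (mbC 0 D) + Yu K N 1 (mbC 1 D) + Yu K N 2 (mbC 2 D) + pd (ichi 0) (mbF1 D) +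
      pd (ichi 1) (mbF2 D) = 0 := by
  obtain ⟨-, h1, h2, h3, h4, -, -⟩ := mem_FMb_iff.1 hD
  have e1 : Yxi K N 2 (Yeta K N 0 (mbF2 D)) = Yeta K N 0 (Yxi K N 2 (mbF2 D)) + Yu K N 1 (mbF2 D) :=
    Yxi_Yeta_succ' 0 _
  have e2 : Yxi K N 1 (Yeta K N 0 (mbC 2 D)) = Yeta K N 0 (Yxi K N 1 (mbC 2 D)) +
      Yu K N 2 (mbC 2 D) :=
    Yxi_Yeta_succ 0 _
  have e3 : Yxi K N 1 (Yeta K N 2 (mbF1 D)) = Yeta K N 2 (Yxi K N 1 (mbF1 D)) + Yu K N 0 (mbF1 D) :=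
    Yxi_Yeta_succ' 2 _
  have e4 := Yxi_Yu 1 1 (mbF2 D)
  have e5 := Yeta_Yu 0 0 (mbF1 D)
  rw [h2, map_zero, ← h3] at e1
  rw [h1, map_zero, zero_add, ← h4] at e3
  rw [e3, e5, if_pos rfl, ← h4] at e2
  rw [if_pos rfl, ← h3] at e4
  have e6 := congrArg (Yxi K N 1) e1
  rw [map_zero, map_add, e2, e4] at e6
  rw [e6]
  ring

theorem restr_FMb_mem {D : Der K (tildeN N)} (hD : D ∈ FMb K N) :
    ∑ j, mbFun D j • (pd j : Der K N) ∈ svect K N := by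
  refine ⟨⟨_, rfl⟩, ?_⟩
  have h := congrArg (restr K N) (sum_Yu_mbC hD)
  simp only [map_add, restr_Yu, restr_mbC, restr_pd_chi_zero, restr_pd_chi_one, restr_mbF1,
    restr_mbF2, map_zero] at h
  have hX : ∀ j, (∑ j, mbFun D j • (pd j : Der K N)) (X j) = restr K N (D (X (Sum.inl j))) :=
    fun j => (sum_smul_pd_X _ j).trans (mbFun_apply hD j)
  rw [div, Fin.sum_univ_five, hX, hX, hX, hX, hX]
  exact h

variable (K N) in
/-- The map `X^f ↦ D^f`. -/
def phi : FMb K N →ₗ[K] svect K N where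
  toFun D := ⟨∑ j, mbFun (D : Der K (tildeN N)) j • pd j, restr_FMb_mem D.2⟩
  map_add' D E := Subtype.ext (by
    change ∑ j, mbFun ((D + E : FMb K N) : Der K (tildeN N)) j • (pd j : Der K N) =
      ∑ j, mbFun (D : Der K (tildeN N)) j • pd j + ∑ j, mbFun (E : Der K (tildeN N)) j • pd j
    simp only [mbFun_apply (D + E).2, mbFun_apply D.2, mbFun_apply E.2, ← Finset.sum_add_distrib,
      ← add_smul, ← map_add]
    rfl)
  map_smul' a D := Subtype.ext (by
    change ∑ j, mbFun ((a • D : FMb K N) : Der K (tildeN N)) j • (pd j : Der K N) =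
      a • ∑ j, mbFun (D : Der K (tildeN N)) j • pd j
    simp only [mbFun_apply (a • D).2, mbFun_apply D.2, Finset.smul_sum, ← smul_assoc, ← map_smul]
    rfl)

theorem phi_coe (D : FMb K N) :
    (phi K N D : Der K N) = ∑ j, mbFun (D : Der K (tildeN N)) j • pd j := rfl

theorem phi_X (D : FMb K N) (j : Fin 5) :
    (phi K N D : Der K N) (X j) = restr K N ((D : Der K (tildeN N)) (X (Sum.inl j))) := by
  rw [phi_coe, sum_smul_pd_X, mbFun_apply D.2]

/-- A uniqueness argument: F_1, F_2 and the C_i vanish at η = ξ = 0, and their derivatives in η and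
ξ are expressed through the same functions and their derivatives along u and χ. Hence the vanishing
order in η, ξ exceeds every bound. -/
theorem phi_injective : Function.Injective (phi K N) := by
  rw [injective_iff_map_eq_zero]
  intro D hD
  obtain ⟨hv, h1, h2, h3, h4, h5, h6⟩ := mem_FMb_iff.1 D.2
  have hX : ∀ j, restr K N ((D : Der K (tildeN N)) (X (Sum.inl j))) = 0 := fun j => by
    rw [← phi_X, hD]; rfl
  have hu : ∀ i, restr K N ((D : Der K (tildeN N)) (X (iu i))) = 0 := fun i => hX _
  have hc : ∀ s, restr K N ((D : Der K (tildeN N)) (X (ichi s))) = 0 := fun i => hX _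
  -- ∂_{η_i} differs from Y_{η_i} by derivations along u and χ with function coefficients, and these
  -- do not lower the vanishing order.
  have heta : ∀ (i : Fin 3) (g : O K (tildeN N)), pd (ieta i) g = Yeta K N i g +
      (X (ixi (i + 2)) * pd (iu (i + 1)) g + X (ixi (i + 1)) * pd (iu (i + 2)) g +
      (X (ixi (i + 2)) * X (ieta (i + 1)) + X (ixi (i + 1)) * X (ieta (i + 2))) * pd (ichi 0) g +
      X (ixi (i + 1)) * X (ixi (i + 2)) * pd (ichi 1) g) := fun i g => by
    rw [Yeta_apply]; grind
  have hVeta : ∀ {n : ℕ} {g : O K (tildeN N)} (i : Fin 3), Van n g → Van n (Yeta K N i g) →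
      Van n (pd (ieta i) g) := by
    intro n g i hg h
    rw [heta]
    exact h.add ((((Van.pd_inl _ hg).mul _).add ((Van.pd_inl _ hg).mul _)).add
      ((Van.pd_inl _ hg).mul _) |>.add ((Van.pd_inl _ hg).mul _))
  have hVu : ∀ {n : ℕ} {g : O K (tildeN N)} (i : Fin 3), Van n g → Van n (Yu K N i g) := by
    intro n g i hg
    rw [Yu_apply]
    exact ((Van.pd_inl _ hg).add ((Van.pd_inl _ hg).mul _)).add ((Van.pd_inl _ hg).mul _)
  have hV : ∀ n, Van n (mbF1 (D : Der K (tildeN N))) ∧ Van n (mbF2 (D : Der K (tildeN N))) ∧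
      ∀ i, Van n (mbC i (D : Der K (tildeN N))) := by
    intro n
    induction n with
    | zero => exact ⟨trivial, trivial, fun _ => trivial⟩
    | succ n ih =>
      obtain ⟨v1, v2, vC⟩ := ih
      refine ⟨⟨by rw [restr_mbF1, hc], ?_⟩, ⟨by rw [restr_mbF2, hc], ?_⟩,
        fun i => ⟨by rw [restr_mbC, hu], ?_⟩⟩
      · rintro (i | i)
        · exact hVeta i v1 (by rw [← h4]; exact vC i)
        · change Van n (Yxi K N i _)
          rw [h1]; exact Van.zero n
      · rintro (i | i)
        · exact hVeta i v2 (by rw [h2]; exact Van.zero n)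
        · change Van n (Yxi K N i _)
          rw [← h3]; exact vC i
      · rintro (b | a)
        -- Y_{η_b}C_i and Y_{ξ_a}C_i are either 0, when the indices agree, or some Y_uF_2,
        -- respectively Y_uF_1. For this C_i is written as Y_{ξ_i}F_2 in the first case with
        -- distinct indices and as Y_{η_i}F_1 in the second.
        · refine hVeta b (vC i) ?_
          revert i
          refine fin3_cases b ?_ ?_ ?_
          · rw [h4, Yeta_Yeta_self]; exact Van.zero n
          · have e := Yxi_Yeta_succ b (mbF2 (D : Der K (tildeN N)))
            rw [h2, map_zero, ← h3] at e
            rw [CharTwo.add_eq_zero.1 e.symm]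
            exact hVu _ v2
          · have e := Yxi_Yeta_succ' b (mbF2 (D : Der K (tildeN N)))
            rw [h2, map_zero, ← h3] at e
            rw [CharTwo.add_eq_zero.1 e.symm]
            exact hVu _ v2
        · change Van n (Yxi K N a _)
          revert a
          refine fin3_cases i ?_ ?_ ?_
          · rw [h3, Yxi_Yxi_self]; exact Van.zero n
          · rw [h4, Yxi_Yeta_succ, h1, map_zero, zero_add]; exact hVu _ v1
          · rw [h4, Yxi_Yeta_succ', h1, map_zero, zero_add]; exact hVu _ v1
  have z1 : mbF1 (D : Der K (tildeN N)) = 0 := Van.eq_zero fun n => (hV n).1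
  have z2 : mbF2 (D : Der K (tildeN N)) = 0 := Van.eq_zero fun n => (hV n).2.1
  have zx : ∀ i, (D : Der K (tildeN N)) (X (ixi i)) = 0 := fun i => by rw [h5, z2, map_zero]
  have ze : ∀ i, (D : Der K (tildeN N)) (X (ieta i)) = 0 := fun i => by rw [h6, z1, map_zero]
  have zu : ∀ i, (D : Der K (tildeN N)) (X (iu i)) = 0 := fun i => by
    have := h4 i
    rw [z1, map_zero] at this
    simpa [mbC, ze] using this
  refine Subtype.ext (vect_ext hv (vect K (tildeN N)).zero_mem (mbIdx_cases zu ?_ ze zx))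
  rw [Fin.forall_fin_two]
  constructor
  · simpa [mbF1_eq 0, zu] using z1
  · simpa [mbF2_eq 0, zu, ze] using z2

/-- D(η_i) = Y_{u_i}F_1 and D(ξ_i) = Y_{u_i}F_2 restrict to ∂_i f_4 and ∂_i f_5. So D does not act
on restrictions through D^f alone, and the remainder is the origin of c. -/
theorem restr_apply_FMb (D : FMb K N) (g : O K (tildeN N)) :
    restr K N ((D : Der K (tildeN N)) g) = (phi K N D : Der K N) (restr K N g) +
      (∑ i : Fin 3, pd (i.castLE (by norm_num)) ((phi K N D : Der K N) (X 3)) *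
        restr K N (pd (ieta i) g) +
      ∑ i : Fin 3, pd (i.castLE (by norm_num)) ((phi K N D : Der K N) (X 4)) *
        restr K N (pd (ixi i) g)) := by
  obtain ⟨hv, -, -, -, -, h5, h6⟩ := mem_FMb_iff.1 D.2
  have e3 : (phi K N D : Der K N) (X 3) = restr K N (mbF1 (D : Der K (tildeN N))) := by
    rw [phi_X, restr_mbF1]; rfl
  have e4 : (phi K N D : Der K N) (X 4) = restr K N (mbF2 (D : Der K (tildeN N))) := by
    rw [phi_X, restr_mbF2]; rfl
  rw [vect_apply hv, vect_apply (phi K N D).2.1, map_sum, sum_mbIdx]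
  simp only [restr_mul, h5, h6, restr_Yu, e3, e4, restr_pd_inl, phi_X]

/-- At η = ξ = 0 the derivative ∂_{η_j}g_{u_i} equals Y_{η_j}C_i = Y_{η_j}Y_{ξ_i}F_2, and since
Y_{η_j}F_2 = 0 only the commutator Y_uF_2 with the third index survives. -/
theorem restr_pd_eta_u (E : FMb K N) (i : Fin 3) :
    restr K N (pd (ieta i) ((E : Der K (tildeN N)) (X (iu i)))) = 0 ∧
    restr K N (pd (ieta (i + 1)) ((E : Der K (tildeN N)) (X (iu i)))) =
      pd ((i + 2).castLE (by norm_num)) ((phi K N E : Der K N) (X 4)) ∧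
    restr K N (pd (ieta (i + 2)) ((E : Der K (tildeN N)) (X (iu i)))) =
      pd ((i + 1).castLE (by norm_num)) ((phi K N E : Der K N) (X 4)) := by
  obtain ⟨hv, h1, h2, h3, h4, -, -⟩ := mem_FMb_iff.1 E.2
  have e4 : (phi K N E : Der K N) (X 4) = restr K N (mbF2 (E : Der K (tildeN N))) := by
    rw [phi_X, restr_mbF2]; rfl
  have hC : ∀ j, restr K N (pd (ieta j) ((E : Der K (tildeN N)) (X (iu i)))) =
      restr K N (Yeta K N j (mbC i (E : Der K (tildeN N)))) := by
    intro j
    rw [restr_Yeta]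
    simp [mbC, restr_mul, pd_X]
  refine ⟨?_, ?_, ?_⟩
  · rw [hC, h4, Yeta_Yeta_self, map_zero]
  · have e := Yxi_Yeta_succ' (i + 1) (mbF2 (E : Der K (tildeN N)))
    rw [h2, map_zero, ← h3, fin3_add_one_add_two, fin3_add_one_add_one] at e
    rw [hC, CharTwo.add_eq_zero.1 e.symm, restr_Yu, e4]
  · have e := Yxi_Yeta_succ (i + 2) (mbF2 (E : Der K (tildeN N)))
    rw [h2, map_zero, ← h3, fin3_add_two_add_one, fin3_add_two_add_two] at e
    rw [hC, CharTwo.add_eq_zero.1 e.symm, restr_Yu, e4]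

/-- For a ≠ i the derivative of C_i along ξ_a is Y_uF_1 = E(η_b) with b the third index, and it
cancels against the derivative of the summand ξ_a E(η_b) by which C_i differs from g_{u_i}. -/
theorem restr_pd_xi_u (E : FMb K N) (i a : Fin 3) :
    restr K N (pd (ixi a) ((E : Der K (tildeN N)) (X (iu i)))) = 0 := by
  obtain ⟨hv, h1, h2, h3, h4, -, h6⟩ := mem_FMb_iff.1 E.2
  have hu : (E : Der K (tildeN N)) (X (iu i)) = mbC i (E : Der K (tildeN N)) +
    (X (ixi (i + 1)) * (E : Der K (tildeN N)) (X (ieta (i + 2))) +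
      X (ixi (i + 2)) * (E : Der K (tildeN N)) (X (ieta (i + 1)))) := by
    rw [mbC]; grind
  have hC : ∀ a, pd (ixi a) (mbC i (E : Der K (tildeN N))) =
    Yxi K N a (Yeta K N i (mbF1 (E : Der K (tildeN N)))) := fun a => by rw [← h4]; rfl
  rw [hu]
  revert a
  refine fin3_cases i ?_ ?_ ?_
  · rw [map_add, hC, Yxi_Yeta_self, h1]
    simp [pd_X, restr_mul]
  · rw [map_add, hC, Yxi_Yeta_succ, h1, h6, h6]
    simp [pd_X, restr_mul, CharTwo.add_self_eq_zero]
  · rw [map_add, hC, Yxi_Yeta_succ', h1, h6, h6]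
    simp [pd_X, restr_mul, CharTwo.add_self_eq_zero]

/-- The derivative of F_1 along η_i, or of F_2 along ξ_i, is g_{u_i} at η = ξ = 0 and cancels
against the term g_{u_i}η_i, respectively g_{u_i}ξ_i. The other derivatives vanish termwise.
Therefore c has no components along ∂_4 and ∂_5. -/
theorem restr_pd_inr_chi (E : FMb K N) (s : Fin 2) (a : Fin 3 ⊕ Fin 3) :
    restr K N (pd (Sum.inr a) ((E : Der K (tildeN N)) (X (ichi s)))) = 0 := by
  obtain ⟨hv, h1, h2, h3, h4, -, -⟩ := mem_FMb_iff.1 E.2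
  revert s
  rw [Fin.forall_fin_two]
  rcases a with i | i
  · constructor
    · have e : (E : Der K (tildeN N)) (X (ichi 0)) = mbF1 (E : Der K (tildeN N)) +
          ((E : Der K (tildeN N)) (X (iu i)) * X (ieta i) +
          (E : Der K (tildeN N)) (X (iu (i + 1))) * X (ieta (i + 1)) +
          (E : Der K (tildeN N)) (X (iu (i + 2))) * X (ieta (i + 2))) := by
        rw [mbF1_eq i]; grind
      have h := restr_Yeta i (mbF1 (E : Der K (tildeN N)))
      rw [← h4, restr_mbC] at h
      change restr K N (pd (ieta i) _) = 0
      rw [e, map_add, map_add, ← h]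
      simp [pd_X, restr_mul, CharTwo.add_self_eq_zero]
    · have e : (E : Der K (tildeN N)) (X (ichi 1)) = mbF2 (E : Der K (tildeN N)) +
          ((E : Der K (tildeN N)) (X (iu i)) * X (ixi i) +
          (E : Der K (tildeN N)) (X (iu (i + 1))) * X (ixi (i + 1)) +
          (E : Der K (tildeN N)) (X (iu (i + 2))) * X (ixi (i + 2)) +
          ((E : Der K (tildeN N)) (X (ieta i)) * (X (ixi (i + 1)) * X (ixi (i + 2))) +
          (E : Der K (tildeN N)) (X (ieta (i + 1))) * (X (ixi (i + 2)) * X (ixi i)) +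
          (E : Der K (tildeN N)) (X (ieta (i + 2))) * (X (ixi i) * X (ixi (i + 1))))) := by
        rw [mbF2_eq i]; grind
      have h := restr_Yeta i (mbF2 (E : Der K (tildeN N)))
      rw [h2, map_zero] at h
      change restr K N (pd (ieta i) _) = 0
      rw [e, map_add, map_add, ← h]
      simp [pd_X, restr_mul]
  · constructor
    · have e : (E : Der K (tildeN N)) (X (ichi 0)) = mbF1 (E : Der K (tildeN N)) +
          ((E : Der K (tildeN N)) (X (iu i)) * X (ieta i) +
          (E : Der K (tildeN N)) (X (iu (i + 1))) * X (ieta (i + 1)) +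
          (E : Der K (tildeN N)) (X (iu (i + 2))) * X (ieta (i + 2))) := by
        rw [mbF1_eq i]; grind
      have h : pd (ixi i) (mbF1 (E : Der K (tildeN N))) = 0 := h1 i
      change restr K N (pd (ixi i) _) = 0
      rw [e, map_add, map_add, h]
      simp [pd_X, restr_mul]
    · have e : (E : Der K (tildeN N)) (X (ichi 1)) = mbF2 (E : Der K (tildeN N)) +
          ((E : Der K (tildeN N)) (X (iu i)) * X (ixi i) +
          (E : Der K (tildeN N)) (X (iu (i + 1))) * X (ixi (i + 1)) +
          (E : Der K (tildeN N)) (X (iu (i + 2))) * X (ixi (i + 2)) +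
          ((E : Der K (tildeN N)) (X (ieta i)) * (X (ixi (i + 1)) * X (ixi (i + 2))) +
          (E : Der K (tildeN N)) (X (ieta (i + 1))) * (X (ixi (i + 2)) * X (ixi i)) +
          (E : Der K (tildeN N)) (X (ieta (i + 2))) * (X (ixi i) * X (ixi (i + 1))))) := by
        rw [mbF2_eq i]; grind
      have h : pd (ixi i) (mbF2 (E : Der K (tildeN N))) = mbC i (E : Der K (tildeN N)) :=
        (h3 i).symm
      change restr K N (pd (ixi i) _) = 0
      rw [e, map_add, map_add, h, restr_mbC]
      simp [pd_X, restr_mul, CharTwo.add_self_eq_zero]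

theorem mb_correction_chi (s : Fin 2) (D E : FMb K N) :
    (∑ i : Fin 3, pd (i.castLE (by norm_num)) ((phi K N D : Der K N) (X 3)) *
      restr K N (pd (ieta i) ((E : Der K (tildeN N)) (X (ichi s)))) +
    ∑ i : Fin 3, pd (i.castLE (by norm_num)) ((phi K N D : Der K N) (X 4)) *
      restr K N (pd (ixi i) ((E : Der K (tildeN N)) (X (ichi s))))) = 0 := by
  have h1 : ∀ i, restr K N (pd (ieta i) ((E : Der K (tildeN N)) (X (ichi s)))) = 0 :=
    fun i => restr_pd_inr_chi E s _
  have h2 : ∀ i, restr K N (pd (ixi i) ((E : Der K (tildeN N)) (X (ichi s)))) = 0 :=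
    fun i => restr_pd_inr_chi E s _
  simp [h1, h2]

/-- This is one half of the component of c along ∂_{u_i}, the terms with f_4 and g_5; the half with
f_5 and g_4 appears when D and E are exchanged in the commutator. -/
theorem mb_correction_u (i : Fin 3) (D E : FMb K N) :
    (∑ j : Fin 3, pd (j.castLE (by norm_num)) ((phi K N D : Der K N) (X 3)) *
      restr K N (pd (ieta j) ((E : Der K (tildeN N)) (X (iu i)))) +
    ∑ j : Fin 3, pd (j.castLE (by norm_num)) ((phi K N D : Der K N) (X 4)) *
      restr K N (pd (ixi j) ((E : Der K (tildeN N)) (X (iu i))))) =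
    pd ((i + 1).castLE (by norm_num)) ((phi K N D : Der K N) (X 3)) *
      pd ((i + 2).castLE (by norm_num)) ((phi K N E : Der K N) (X 4)) +
    pd ((i + 2).castLE (by norm_num)) ((phi K N D : Der K N) (X 3)) *
      pd ((i + 1).castLE (by norm_num)) ((phi K N E : Der K N) (X 4)) := by
  obtain ⟨e0, e1, e2⟩ := restr_pd_eta_u E i
  simp only [restr_pd_xi_u, sum_fin3 _ i, e0, e1, e2]
  ring

theorem phi_lie (D E : FMb K N) : phi K N ⁅D, E⁆ =
    ⁅phi K N D, phi K N E⁆ + (cCochain K N).val (phi K N D) (phi K N E) := by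
  refine Subtype.ext (vect_ext (phi K N ⁅D, E⁆).2.1
    (⁅phi K N D, phi K N E⁆ + (cCochain K N).val (phi K N D) (phi K N E)).2.1 fun j => ?_)
  change _ = ⁅(phi K N D : Der K N), (phi K N E : Der K N)⁆ (X j) +
    cField (phi K N D : Der K N) (phi K N E : Der K N) (X j)
  rw [phi_X]
  change restr K N ((D : Der K (tildeN N)) ((E : Der K (tildeN N)) _) -
    (E : Der K (tildeN N)) ((D : Der K (tildeN N)) _)) = _
  rw [map_sub, restr_apply_FMb D ((E : Der K (tildeN N)) (X (Sum.inl j))),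
    restr_apply_FMb E ((D : Der K (tildeN N)) (X (Sum.inl j))), Derivation.commutator_apply, ← phi_X,
    ← phi_X]
  have h2 : (2 : O K N) = 0 := two_eq_zero
  obtain ⟨c0, c1, c2, c3, c4⟩ := cField_X (phi K N D : Der K N) (phi K N E : Der K N)
  have v0 : Fin.castLE (show 3 ≤ 5 by norm_num) 0 = 0 := rfl
  have v1 : Fin.castLE (show 3 ≤ 5 by norm_num) 1 = 1 := rfl
  have v2 : Fin.castLE (show 3 ≤ 5 by norm_num) 2 = 2 := rfl
  have w0 : (Sum.inl 0 : MbIdx) = iu 0 := rfl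
  have w1 : (Sum.inl 1 : MbIdx) = iu 1 := rfl
  have w2 : (Sum.inl 2 : MbIdx) = iu 2 := rfl
  have w3 : (Sum.inl 3 : MbIdx) = ichi 0 := rfl
  have w4 : (Sum.inl 4 : MbIdx) = ichi 1 := rfl
  have s1 : (1 : Fin 3) + 1 = 2 ∧ (1 : Fin 3) + 2 = 0 ∧ (2 : Fin 3) + 1 = 0 ∧
      (2 : Fin 3) + 2 = 1 := by
    decide
  fin_cases j <;> simp only [Fin.zero_eta, Fin.isValue, Fin.mk_one, Fin.reduceFinMk]
  · rw [c0, w0, mb_correction_u, mb_correction_u, zero_add, zero_add, v1, v2]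
    linear_combination -(pd 1 ((phi K N E : Der K N) (X 3)) * pd 2 ((phi K N D : Der K N) (X 4)) +
      pd 2 ((phi K N E : Der K N) (X 3)) * pd 1 ((phi K N D : Der K N) (X 4))) * h2
  · rw [c1, w1, mb_correction_u, mb_correction_u, s1.1, s1.2.1, v0, v2]
    linear_combination -(pd 0 ((phi K N E : Der K N) (X 3)) * pd 2 ((phi K N D : Der K N) (X 4)) +
      pd 2 ((phi K N E : Der K N) (X 3)) * pd 0 ((phi K N D : Der K N) (X 4))) * h2
  · rw [c2, w2, mb_correction_u, mb_correction_u, s1.2.2.1, s1.2.2.2, v0, v1]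
    linear_combination -(pd 0 ((phi K N E : Der K N) (X 3)) * pd 1 ((phi K N D : Der K N) (X 4)) +
      pd 1 ((phi K N E : Der K N) (X 3)) * pd 0 ((phi K N D : Der K N) (X 4))) * h2
  · rw [c3, w3, mb_correction_chi, mb_correction_chi]; ring
  · rw [c4, w4, mb_correction_chi, mb_correction_chi]; ring

end RestrictedFields

/-! ### Surjectivity of φ: explicit generating functions -/

section Surjectivity

variable {K : Type*} [Field K] [CharP K 2] {N : Fin 5 → WithTop ℕ+}

variable (K N) in
/-- The field `∂_{u_i} + η_i ∂_{χ_1}`. -/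
def Pu (i : Fin 3) : Der K (tildeN N) :=
  pd (iu i) + (X (ieta i) : O K (tildeN N)) • pd (ichi 0)

theorem Pu_apply (i : Fin 3) (g : O K (tildeN N)) :
    Pu K N i g = pd (iu i) g + X (ieta i) * pd (ichi 0) g := rfl

theorem Yeta_eq_Pu (i : Fin 3) (g : O K (tildeN N)) : Yeta K N i g = pd (ieta i) g +
    X (ixi (i + 2)) * Pu K N (i + 1) g + X (ixi (i + 1)) * Pu K N (i + 2) g +
    X (ixi (i + 1)) * X (ixi (i + 2)) * pd (ichi 1) g := by
  rw [Yeta_apply, Pu_apply, Pu_apply]; ring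

theorem Pu_Pu (i j : Fin 3) (g : O K (tildeN N)) :
    Pu K N i (Pu K N j g) = Pu K N j (Pu K N i g) := by
  simp only [Pu_apply, map_add, Derivation.leibniz, smul_eq_mul, pd_X, pd_comm (iu j) (iu i) g,
    pd_comm (ichi 0) (iu _) g]
  simp
  ring

theorem Pu_pd_chi (i : Fin 3) (s : Fin 2) (g : O K (tildeN N)) :
    pd (ichi s) (Pu K N i g) = Pu K N i (pd (ichi s) g) := by
  simp only [Pu_apply, map_add, Derivation.leibniz, smul_eq_mul, pd_X, pd_comm (ichi s) (iu i) g,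
    pd_comm (ichi s) (ichi 0) g]
  simp

theorem pd_eta_Pu (i j : Fin 3) (g : O K (tildeN N)) : pd (ieta i) (Pu K N j g) =
    Pu K N j (pd (ieta i) g) + if i = j then pd (ichi 0) g else 0 := by
  simp only [Pu_apply, map_add, Derivation.leibniz, smul_eq_mul, pd_X, pd_comm (ieta i)]
  by_cases h : i = j
  · subst h; simp; ring
  · simp [h]

theorem pd_xi_Pu (i j : Fin 3) (g : O K (tildeN N)) :
    pd (ixi i) (Pu K N j g) = Pu K N j (pd (ixi i) g) := by
  simp only [Pu_apply, map_add, Derivation.leibniz, smul_eq_mul, pd_X, pd_comm (ixi i)]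
  simp

/-- The function `F_1` determined by `f_4`, `f_5` and `f_1, f_2, f_3`. -/
def genF1 (p q : O K (tildeN N)) (h : Fin 3 → O K (tildeN N)) : O K (tildeN N) :=
  p + (X (ieta 0) * h 0 + X (ieta 1) * h 1 + X (ieta 2) * h 2) +
    (X (ieta 0) * X (ieta 1) * pd (iu 2) q + X (ieta 1) * X (ieta 2) * pd (iu 0) q +
      X (ieta 2) * X (ieta 0) * pd (iu 1) q) +
    X (ieta 0) * X (ieta 1) * X (ieta 2) * pd (ichi 0) q

theorem genF1_eq (p q : O K (tildeN N)) (h : Fin 3 → O K (tildeN N)) (i : Fin 3) :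
    genF1 p q h = p + (X (ieta i) * h i + X (ieta (i + 1)) * h (i + 1) +
      X (ieta (i + 2)) * h (i + 2)) + (X (ieta i) * X (ieta (i + 1)) * pd (iu (i + 2)) q +
      X (ieta (i + 1)) * X (ieta (i + 2)) * pd (iu i) q +
      X (ieta (i + 2)) * X (ieta i) * pd (iu (i + 1)) q) +
    X (ieta i) * X (ieta (i + 1)) * X (ieta (i + 2)) * pd (ichi 0) q := by
  have s1 : (1 : Fin 3) + 1 = 2 ∧ (1 : Fin 3) + 2 = 0 ∧ (2 : Fin 3) + 1 = 0 ∧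
      (2 : Fin 3) + 2 = 1 := by
    decide
  rw [genF1]
  fin_cases i <;> simp only [Fin.zero_eta, Fin.isValue, Fin.mk_one, Fin.reduceFinMk, zero_add, s1]
  · ring
  · ring

/-- The function `F_2` determined by `F_1` and `f_5`. -/
def genF2 (q F : O K (tildeN N)) : O K (tildeN N) :=
  q + (X (ixi 0) * pd (ieta 0) F + X (ixi 1) * pd (ieta 1) F + X (ixi 2) * pd (ieta 2) F) +
    (X (ixi 0) * X (ixi 1) * Pu K N 2 F + X (ixi 1) * X (ixi 2) * Pu K N 0 F +
      X (ixi 2) * X (ixi 0) * Pu K N 1 F) +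
    X (ixi 0) * X (ixi 1) * X (ixi 2) * pd (ichi 1) F

theorem genF2_eq (q F : O K (tildeN N)) (i : Fin 3) : genF2 q F =
    q + (X (ixi i) * pd (ieta i) F + X (ixi (i + 1)) * pd (ieta (i + 1)) F +
      X (ixi (i + 2)) * pd (ieta (i + 2)) F) +
    (X (ixi i) * X (ixi (i + 1)) * Pu K N (i + 2) F +
      X (ixi (i + 1)) * X (ixi (i + 2)) * Pu K N i F +
      X (ixi (i + 2)) * X (ixi i) * Pu K N (i + 1) F) +
    X (ixi i) * X (ixi (i + 1)) * X (ixi (i + 2)) * pd (ichi 1) F := by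
  have s1 : (1 : Fin 3) + 1 = 2 ∧ (1 : Fin 3) + 2 = 0 ∧ (2 : Fin 3) + 1 = 0 ∧
      (2 : Fin 3) + 2 = 1 := by
    decide
  rw [genF2]
  fin_cases i <;> simp only [Fin.zero_eta, Fin.isValue, Fin.mk_one, Fin.reduceFinMk, zero_add, s1]
  · ring
  · ring

section Generating

variable {p q : O K (tildeN N)} {h : Fin 3 → O K (tildeN N)}

theorem pd_xi_genF1
    (hp : ∀ a, pd (Sum.inr a) p = 0) (hq : ∀ a, pd (Sum.inr a) q = 0)
    (hh : ∀ i a, pd (Sum.inr a) (h i) = 0)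
    (i : Fin 3) : pd (ixi i) (genF1 p q h) = 0 := by
  have p1 : ∀ i, pd (ixi i) p = 0 := fun i => hp _
  have q1 : ∀ i, pd (ixi i) q = 0 := fun i => hq _
  have h1 : ∀ i j, pd (ixi i) (h j) = 0 := fun i j => hh j _
  simp only [genF1_eq p q h i, map_add, Derivation.leibniz, smul_eq_mul, p1, q1, h1, pd_X,
    pd_comm (ixi i) (iu _) q, pd_comm (ixi i) (ichi _) q, map_zero]
  simp

theorem pd_eta_genF1
    (hp : ∀ a, pd (Sum.inr a) p = 0) (hq : ∀ a, pd (Sum.inr a) q = 0)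
    (hh : ∀ i a, pd (Sum.inr a) (h i) = 0)
    (i : Fin 3) : pd (ieta i) (genF1 p q h) = h i +
    (X (ieta (i + 1)) * pd (iu (i + 2)) q + X (ieta (i + 2)) * pd (iu (i + 1)) q) +
    X (ieta (i + 1)) * X (ieta (i + 2)) * pd (ichi 0) q := by
  have p1 : ∀ i, pd (ieta i) p = 0 := fun i => hp _
  have q1 : ∀ i, pd (ieta i) q = 0 := fun i => hq _
  have h1 : ∀ i j, pd (ieta i) (h j) = 0 := fun i j => hh j _
  simp only [genF1_eq p q h i, map_add, Derivation.leibniz, smul_eq_mul, p1, q1, h1, pd_X,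
    pd_comm (ieta i) (iu _) q, pd_comm (ieta i) (ichi _) q, map_zero]
  simp
  ring

/-- This is the vanishing of the coefficients of ξ_{i+1} and ξ_{i+2} in Y_{η_i}F_2. It dictates the
terms of degree 2 and 3 in η of F_1. -/
theorem pd_eta_pd_eta_genF1
    (hp : ∀ a, pd (Sum.inr a) p = 0) (hq : ∀ a, pd (Sum.inr a) q = 0)
    (hh : ∀ i a, pd (Sum.inr a) (h i) = 0)
    (i : Fin 3) :
    pd (ieta i) (pd (ieta (i + 1)) (genF1 p q h)) = Pu K N (i + 2) q ∧
    pd (ieta i) (pd (ieta (i + 2)) (genF1 p q h)) = Pu K N (i + 1) q := by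
  have q1 : ∀ i, pd (ieta i) q = 0 := fun i => hq _
  have h1 : ∀ i j, pd (ieta i) (h j) = 0 := fun i j => hh j _
  simp only [pd_eta_genF1 hp hq hh, Pu_apply, map_add, Derivation.leibniz, smul_eq_mul, q1, h1,
    pd_X, pd_comm (ieta i) (iu _) q, pd_comm (ieta i) (ichi _) q, map_zero]
  constructor
  · simp; ring
  · simp; ring

/-- The coefficient of ξ_{i+1}ξ_{i+2} in Y_{η_i}F_2. At η = 0 it is the divergence condition `hd`;
the terms containing η cancel by the choice of F_1. -/
theorem sum_Pu_genF1
    (hp : ∀ a, pd (Sum.inr a) p = 0) (hq : ∀ a, pd (Sum.inr a) q = 0)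
    (hh : ∀ i a, pd (Sum.inr a) (h i) = 0)
    (hd : pd (iu 0) (h 0) + pd (iu 1) (h 1) + pd (iu 2) (h 2) + pd (ichi 0) p +
      pd (ichi 1) q = 0) (i : Fin 3) :
    Pu K N i (pd (ieta i) (genF1 p q h)) + Pu K N (i + 1) (pd (ieta (i + 1)) (genF1 p q h)) +
      Pu K N (i + 2) (pd (ieta (i + 2)) (genF1 p q h)) + pd (ichi 0) (genF1 p q h) +
      pd (ichi 1) q = 0 := by
  have key : Pu K N 0 (pd (ieta 0) (genF1 p q h)) + Pu K N 1 (pd (ieta 1) (genF1 p q h)) +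
      Pu K N 2 (pd (ieta 2) (genF1 p q h)) + pd (ichi 0) (genF1 p q h) + pd (ichi 1) q = 0 := by
    have s1 : (1 : Fin 3) + 1 = 2 ∧ (1 : Fin 3) + 2 = 0 ∧ (2 : Fin 3) + 1 = 0 ∧
      (2 : Fin 3) + 2 = 1 := by decide
    rw [pd_eta_genF1 hp hq hh, pd_eta_genF1 hp hq hh, pd_eta_genF1 hp hq hh, genF1_eq p q h 0]
    simp only [zero_add, s1, Pu_apply, map_add,
      Derivation.leibniz, smul_eq_mul, pd_X, pd_comm (iu 2) (iu 1) q, pd_comm (iu 2) (iu 0) q,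
      pd_comm (iu 1) (iu 0) q, pd_comm (ichi 0) (iu _) q]
    simp
    have x0 := eta_mul_self (K := K) (N := N) 0
    have x1 := eta_mul_self (K := K) (N := N) 1
    have x2 := eta_mul_self (K := K) (N := N) 2
    grind
  rw [← sum_fin3 (fun i => Pu K N i (pd (ieta i) (genF1 p q h))) i]
  rw [Fin.sum_univ_three]
  exact key

/-- F_1 is free of ξ, so Y_{η_i}F_1 is an explicit polynomial in ξ, and `genF2` integrates the
equations Y_{ξ_i}F_2 = Y_{η_i}F_1 with initial value f_5. -/
theorem Yxi_genF2
    (hp : ∀ a, pd (Sum.inr a) p = 0) (hq : ∀ a, pd (Sum.inr a) q = 0)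
    (hh : ∀ i a, pd (Sum.inr a) (h i) = 0)
    (i : Fin 3) :
    Yxi K N i (genF2 q (genF1 p q h)) = Yeta K N i (genF1 p q h) := by
  have q1 : ∀ i, pd (ixi i) q = 0 := fun i => hq _
  rw [Yxi, genF2_eq _ _ i, Yeta_eq_Pu]
  simp only [map_add, Derivation.leibniz, smul_eq_mul, q1, pd_X, pd_xi_Pu,
    pd_comm (ixi i) (ieta _) (genF1 p q h), pd_comm (ixi i) (ichi _) (genF1 p q h),
    pd_xi_genF1 hp hq hh, map_zero]
  simp
  ring

/-- Compare coefficients in ξ. Those of ξ_{i+1}, ξ_{i+2} and ξ_{i+1}ξ_{i+2} are the two preceding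
facts on F_1; that of ξ_i is ∂_{η_i}²F_1 = 0; the rest cancel in pairs because the fields `Pu`
commute with each other and, for distinct indices, with ∂_{η_i}. -/
theorem Yeta_genF2
    (hp : ∀ a, pd (Sum.inr a) p = 0) (hq : ∀ a, pd (Sum.inr a) q = 0)
    (hh : ∀ i a, pd (Sum.inr a) (h i) = 0)
    (hd : pd (iu 0) (h 0) + pd (iu 1) (h 1) + pd (iu 2) (h 2) + pd (ichi 0) p +
      pd (ichi 1) q = 0) (i : Fin 3) : Yeta K N i (genF2 q (genF1 p q h)) = 0 := by
  have hs := sum_Pu_genF1 hp hq hh hd i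
  obtain ⟨e1, e2⟩ := pd_eta_pd_eta_genF1 hp hq hh i
  have e0 : pd (ieta i) (pd (ieta i) (genF1 p q h)) = 0 := pd_inr_pd_inr _ _
  have q1 : pd (ieta i) q = 0 := hq _
  have x0 := xi_mul_self (K := K) (N := N) i
  have x1 := xi_mul_self (K := K) (N := N) (i + 1)
  have x2 := xi_mul_self (K := K) (N := N) (i + 2)
  rw [genF2_eq _ _ i]
  generalize genF1 p q h = F at *
  simp only [map_add, Derivation.leibniz, smul_eq_mul, Yeta_xi, mul_zero, add_zero]
  simp only [Yeta_eq_Pu, e0, e1, e2, q1, pd_eta_Pu, Pu_pd_chi, Pu_Pu (i + 1) i, Pu_Pu (i + 2) i,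
    Pu_Pu (i + 2) (i + 1), pd_comm (ichi 1) (ieta _) F, if_true, fin3_ne_add_one, fin3_ne_add_two,
    if_false, add_zero, zero_add]
  grind

end Generating

theorem exists_field (gu : Fin 3 → O K (tildeN N)) (gc : Fin 2 → O K (tildeN N))
    (ge gx : Fin 3 → O K (tildeN N)) : ∃ E ∈ vect K (tildeN N), (∀ i, E (X (iu i)) = gu i) ∧
      (∀ s, E (X (ichi s)) = gc s) ∧ (∀ i, E (X (ieta i)) = ge i) ∧
      ∀ i, E (X (ixi i)) = gx i := by
  let g : MbIdx → O K (tildeN N) :=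
    Sum.elim ![gu 0, gu 1, gu 2, gc 0, gc 1] (Sum.elim ge gx)
  refine ⟨∑ k, g k • pd k, ⟨g, rfl⟩, fun i => ?_, fun s => ?_, fun i => ?_, fun i => ?_⟩
  · rw [sum_smul_pd_X]; fin_cases i <;> rfl
  · rw [sum_smul_pd_X]; fin_cases s <;> rfl
  · rw [sum_smul_pd_X]; rfl
  · rw [sum_smul_pd_X]; rfl

theorem exists_mem_FMb {F G : O K (tildeN N)} (h1 : ∀ i, Yxi K N i F = 0)
    (h2 : ∀ i, Yxi K N i G = Yeta K N i F) (h3 : ∀ i, Yeta K N i G = 0) :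
    ∃ E ∈ FMb K N, mbF1 E = F ∧ mbF2 E = G := by
  -- The u-components are solved from C_i = Y_{η_i}F with D(η_j) = Y_{u_j}F already prescribed; the
  -- χ-components below are then solved from the definitions of F_1 and F_2.
  obtain ⟨gu, hgu⟩ : ∃ gu : Fin 3 → O K (tildeN N), ∀ i, gu i = Yeta K N i F +
    (X (ixi (i + 1)) * Yu K N (i + 2) F + X (ixi (i + 2)) * Yu K N (i + 1) F) := ⟨_, fun _ => rfl⟩
  obtain ⟨E, hE, Eu, Ec, Ee, Ex⟩ := exists_field gu
    ![F + (gu 0 * X (ieta 0) + gu (0 + 1) * X (ieta (0 + 1)) + gu (0 + 2) * X (ieta (0 + 2))),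
      G + (gu 0 * X (ixi 0) + gu (0 + 1) * X (ixi (0 + 1)) + gu (0 + 2) * X (ixi (0 + 2)) +
        (Yu K N 0 F * (X (ixi (0 + 1)) * X (ixi (0 + 2))) +
          Yu K N (0 + 1) F * (X (ixi (0 + 2)) * X (ixi 0)) +
          Yu K N (0 + 2) F * (X (ixi 0) * X (ixi (0 + 1)))))]
    (fun i => Yu K N i F) (fun i => Yu K N i G)
  have eC : ∀ i, mbC i E = Yeta K N i F := fun i => by
    rw [mbC, Eu, Ee, Ee, hgu, add_assoc, CharTwo.add_self_eq_zero, add_zero]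
  have eF : mbF1 E = F := by
    rw [mbF1_eq 0, Ec, Eu, Eu, Eu, Matrix.cons_val_zero, add_assoc, CharTwo.add_self_eq_zero,
      add_zero]
  have eG : mbF2 E = G := by
    rw [mbF2_eq 0, Ec, Eu, Eu, Eu, Ee, Ee, Ee, Matrix.cons_val_one, Matrix.cons_val_fin_one,
      add_assoc, add_assoc, CharTwo.add_self_eq_zero, add_zero]
  exact ⟨E, mem_FMb_iff.2 ⟨hE, by rwa [eF], by rwa [eG], fun i => by rw [eC, eG, h2],
    fun i => by rw [eC, eF], fun i => by rw [Ex, eG], fun i => by rw [Ee, eF]⟩, eF, eG⟩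

theorem phi_surjective : Function.Surjective (phi K N) := by
  intro D
  obtain ⟨p, hp'⟩ : ∃ p, p = emb K N ((D : Der K N) (X 3)) := ⟨_, rfl⟩
  obtain ⟨q, hq'⟩ : ∃ q, q = emb K N ((D : Der K N) (X 4)) := ⟨_, rfl⟩
  obtain ⟨h, hh'⟩ : ∃ h : Fin 3 → O K (tildeN N),
    ∀ i, h i = emb K N ((D : Der K N) (X (i.castLE (by norm_num)))) := ⟨_, fun _ => rfl⟩
  have hp : ∀ a, pd (Sum.inr a) p = 0 := fun a => by rw [hp', pd_inr_emb]
  have hq : ∀ a, pd (Sum.inr a) q = 0 := fun a => by rw [hq', pd_inr_emb]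
  have hh : ∀ i a, pd (Sum.inr a) (h i) = 0 := fun i a => by rw [hh', pd_inr_emb]
  have hd : pd (iu 0) (h 0) + pd (iu 1) (h 1) + pd (iu 2) (h 2) + pd (ichi 0) p +
      pd (ichi 1) q = 0 := by
    have e := congrArg (emb K N) D.2.2
    rw [div, Fin.sum_univ_five, map_zero] at e
    simp only [map_add, ← pd_inl_emb] at e
    rw [hh', hh', hh', hp', hq']
    exact e
  obtain ⟨E, hE, eF, eG⟩ := exists_mem_FMb (pd_xi_genF1 hp hq hh) (Yxi_genF2 hp hq hh)
    (Yeta_genF2 hp hq hh hd)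
  refine ⟨⟨E, hE⟩, Subtype.ext (vect_ext (phi K N _).2.1 D.2.1 fun j => ?_)⟩
  rw [phi_coe, sum_smul_pd_X]
  have ru : ∀ i : Fin 3, restr K N (pd (ieta i) (mbF1 E)) =
      (D : Der K N) (X (i.castLE (by norm_num))) := by
    intro i
    rw [eF, pd_eta_genF1 hp hq hh]
    simp [restr_mul, hh', restr_emb]
  fin_cases j
  · exact ru 0
  · exact ru 1
  · exact ru 2
  · change restr K N (mbF1 E) = _
    rw [eF, genF1]
    simp [restr_mul, hp', restr_emb]
  · change restr K N (mbF2 E) = _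
    rw [eG, genF2]
    simp [restr_mul, hq', restr_emb]

variable (K N) in
/-- The linear bijection `X^f ↦ D^f`. -/
def phiEquiv : FMb K N ≃ₗ[K] svect K N :=
  LinearEquiv.ofBijective (phi K N) ⟨phi_injective, phi_surjective⟩

variable (K N) in
/-- The embedding `ψ ∘ φ`. -/
def psiPhi : FMb K N →ₗ⁅K⁆ FKle K N where
  toLinearMap := psi K N ∘ₗ phi K N
  map_lie' {D E} := by
    change psi K N (phi K N ⁅D, E⁆) = ⁅psi K N (phi K N D), psi K N (phi K N E)⁆
    rw [psi_lie, phi_lie]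

end Surjectivity

/-! ### Constant fields, and the maximal subalgebra of fields vanishing at the origin -/

section ConstantFields

variable {K : Type*} [Field K] [CharP K 2] {N : Fin 5 → WithTop ℕ+}

variable (K N) in
/-- The field `∑ v_i ∂_i` with constant coefficients. -/
def constField : (Fin 5 → K) →ₗ[K] svect K N where
  toFun v := ⟨∑ i, algebraMap K (O K N) (v i) • pd i, ⟨_, rfl⟩, by
    simp only [div, sum_smul_pd_X, Derivation.map_algebraMap, Finset.sum_const_zero]⟩
  map_add' v w := Subtype.ext (by
    change ∑ i, algebraMap K (O K N) (v i + w i) • (pd i : Der K N) =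
      ∑ i, algebraMap K (O K N) (v i) • pd i + ∑ i, algebraMap K (O K N) (w i) • pd i
    simp only [map_add, add_smul, Finset.sum_add_distrib])
  map_smul' a v := Subtype.ext (by
    change ∑ i, algebraMap K (O K N) (a * v i) • (pd i : Der K N) =
      a • ∑ i, algebraMap K (O K N) (v i) • pd i
    simp only [map_mul, mul_smul, Finset.smul_sum, algebraMap_smul])

theorem constField_coe (v : Fin 5 → K) :
    (constField K N v : Der K N) = ∑ i, algebraMap K (O K N) (v i) • pd i := rfl

theorem constField_X (v : Fin 5 → K) (j : Fin 5) :
    (constField K N v : Der K N) (X j) = algebraMap K (O K N) (v j) := by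
  rw [constField_coe, sum_smul_pd_X (fun i => algebraMap K (O K N) (v i))]

theorem constField_apply (v : Fin 5 → K) (f : O K N) :
    (constField K N v : Der K N) f = ∑ i, v i • pd i f := by
  rw [constField_coe, sum_smul_pd_apply (fun i => algebraMap K (O K N) (v i))]
  exact Finset.sum_congr rfl fun i _ => by rw [Algebra.smul_def]

theorem constField_pd (v : Fin 5 → K) (j : Fin 5) (f : O K N) :
    (constField K N v : Der K N) (pd j f) = pd j ((constField K N v : Der K N) f) := by
  rw [constField_apply, constField_apply, map_sum]
  exact Finset.sum_congr rfl fun i _ => by rw [Derivation.map_smul, pd_comm]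

/-- Every D kills constants, so ad of a constant field acts coefficientwise; its surjectivity and
local nilpotency reduce to statements about functions. -/
theorem lie_constField_X (v : Fin 5 → K) (D : svect K N) (j : Fin 5) :
    ((⁅constField K N v, D⁆ : svect K N) : Der K N) (X j) =
      (constField K N v : Der K N) ((D : Der K N) (X j)) := by
  change (constField K N v : Der K N) ((D : Der K N) (X j)) -
    (D : Der K N) ((constField K N v : Der K N) (X j)) = _
  rw [constField_X, Derivation.map_algebraMap, sub_zero]

/-- Only derivatives of the coefficients enter c, so constant fields have the same adjoint action in
the deformed algebra. -/
theorem cCochain_constField (v : Fin 5 → K) (D : svect K N) :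
    (cCochain K N).val (constField K N v) D = 0 := by
  refine Subtype.ext ?_
  change cField (constField K N v : Der K N) (D : Der K N) = 0
  rw [cField_eq]
  simp only [constField_X, Derivation.map_algebraMap, zero_mul, add_zero, zero_smul]

theorem svect_ext {D E : svect K N} (h : ∀ j, (D : Der K N) (X j) = (E : Der K N) (X j)) : D = E :=
  Subtype.ext (vect_ext D.2.1 E.2.1 h)

theorem constTerm_algebraMap (a : K) : constTerm K N (algebraMap K (O K N) a) = a := by
  rw [Algebra.algebraMap_eq_smul_one, map_smul, constTerm_one, smul_eq_mul, mul_one]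

theorem constTerm_mul (f g : O K N) :
    constTerm K N (f * g) = constTerm K N f * constTerm K N g := by
  classical
  induction f using O.induction with
  | hm r hr =>
    induction g using O.induction with
    | hm s hs =>
      change DivPow.coeff 0 (O.val (O.mk (DivPow.mon r : DivPow K (Fin 5))
        (DivPow.mon_mem_trunc K hr) * O.mk (DivPow.mon s) (DivPow.mon_mem_trunc K hs))) =
        DivPow.coeff 0 (DivPow.mon r) * DivPow.coeff 0 (DivPow.mon s)
      rw [map_mul, O.val_mk, O.val_mk, DivPow.mon_mul_mon, map_smul, DivPow.coeff_mon,
        DivPow.coeff_mon, DivPow.coeff_mon]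
      by_cases h1 : r = 0
      · subst h1
        by_cases h2 : s = 0
        · subst h2; simp
        · simp [h2]
      · simp [h1]
    | ha f g hf hg => rw [mul_add, map_add, map_add, hf, hg, mul_add]
    | hs a f hf => rw [mul_smul_comm, map_smul, map_smul, hf, smul_eq_mul, smul_eq_mul]; ring
  | ha f f' hf hf' => rw [add_mul, map_add, map_add, hf, hf', add_mul]
  | hs a f hf => rw [smul_mul_assoc, map_smul, map_smul, hf, smul_eq_mul, smul_eq_mul]; ring

variable (K N) in
/-- The value of a divergence-free field at the origin. -/
def valueAtZero : svect K N →ₗ[K] (Fin 5 → K) :=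
  LinearMap.pi fun j =>
    { toFun := fun D => constTerm K N ((D : Der K N) (X j))
      map_add' := fun _ _ => map_add (constTerm K N) _ _
      map_smul' := fun _ _ => map_smul (constTerm K N) _ _ }

theorem valueAtZero_apply (D : svect K N) (j : Fin 5) :
    valueAtZero K N D j = constTerm K N ((D : Der K N) (X j)) := rfl

theorem valueAtZero_constField (v : Fin 5 → K) : valueAtZero K N (constField K N v) = v := by
  funext j
  rw [valueAtZero_apply, constField_X, constTerm_algebraMap]

theorem constTerm_svect_apply (D : svect K N) (f : O K N) :
    constTerm K N ((D : Der K N) f) = ∑ i, valueAtZero K N D i * constTerm K N (pd i f) := by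
  rw [vect_apply D.2.1, map_sum]
  exact Finset.sum_congr rfl fun i _ => by rw [constTerm_mul, valueAtZero_apply]

variable (K N) in
/-- The divergence-free fields that vanish at the origin. -/
def vanishing : LieSubalgebra K (svect K N) where
  toSubmodule := LinearMap.ker (valueAtZero K N)
  lie_mem' {D E} hD hE := by
    have hD' : valueAtZero K N D = 0 := hD
    have hE' : valueAtZero K N E = 0 := hE
    refine LinearMap.mem_ker.2 (funext fun j => ?_)
    change constTerm K N ((D : Der K N) ((E : Der K N) (X j)) -
      (E : Der K N) ((D : Der K N) (X j))) = 0
    rw [map_sub, constTerm_svect_apply, constTerm_svect_apply, hD', hE']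
    simp

theorem mem_vanishing_iff {D : svect K N} : D ∈ vanishing K N ↔ valueAtZero K N D = 0 := Iff.rfl

theorem finrank_quotient_vanishing :
    Module.finrank K (svect K N ⧸ (vanishing K N).toSubmodule) = 5 := by
  have h : Function.Surjective (valueAtZero K N) := fun v => ⟨_, valueAtZero_constField v⟩
  have e := (LinearMap.quotKerEquivOfSurjective _ h).finrank_eq
  rw [Module.finrank_fin_fun] at e
  exact e

theorem valueAtZero_lie_uPd (D : svect K N) (i j : Fin 5) (h : i ≠ j) :
    valueAtZero K N ⁅D, uPd K N i j h⁆ = Pi.single j (valueAtZero K N D i) := by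
  funext k
  change constTerm K N ((D : Der K N) ((uPd K N i j h : Der K N) (X k)) -
    (uPd K N i j h : Der K N) ((D : Der K N) (X k))) = _
  rw [map_sub, uPd_X, uPd_apply, constTerm_X_mul, sub_zero]
  by_cases hk : j = k
  · subst hk
    rw [if_pos rfl, Pi.single_eq_same]; rfl
  · rw [if_neg hk, Pi.single_eq_of_ne (Ne.symm hk), map_zero, map_zero]

/-- A larger subalgebra contains a field with nonzero value at the origin. Brackets with the u_i∂_j,
i ≠ j, which vanish at the origin, turn that value into every basis vector, and a subalgebra that
contains all vanishing fields and realises all values is everything. -/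
theorem isCoatom_vanishing : IsCoatom (vanishing K N) := by
  refine ⟨fun h => ?_, fun P hP => ?_⟩
  · have h1 : constField K N (fun _ => 1) ∈ vanishing K N := by rw [h]; trivial
    rw [mem_vanishing_iff, valueAtZero_constField] at h1
    exact one_ne_zero (congrFun h1 0)
  · obtain ⟨hle, D, hD, hD'⟩ := SetLike.lt_iff_le_and_exists.1 hP
    obtain ⟨i, hi⟩ : ∃ i, valueAtZero K N D i ≠ 0 := Function.ne_iff.1 hD'
    have hu : ∀ i j h, uPd K N i j h ∈ P := fun i j h => hle (by
      rw [mem_vanishing_iff]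
      funext k
      rw [valueAtZero_apply, uPd_X, Pi.zero_apply]
      split_ifs
      · rw [← mul_one (X i), constTerm_X_mul]
      · rw [map_zero])
    have h1 : ∀ j, i ≠ j → ∃ F ∈ P, valueAtZero K N F = Pi.single j 1 := fun j hj =>
      ⟨(valueAtZero K N D i)⁻¹ • ⁅D, uPd K N i j hj⁆, P.smul_mem _ (P.lie_mem hD (hu i j hj)), by
        rw [map_smul, valueAtZero_lie_uPd, ← Pi.single_smul, smul_eq_mul, inv_mul_cancel₀ hi]⟩
    have h2 : ∀ j, ∃ F ∈ P, valueAtZero K N F = Pi.single j 1 := by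
      intro j
      by_cases hj : i = j
      -- Since u_i∂_i is not among the fields used, the basis vector with index i is reached in two
      -- steps through some k ≠ i.
      · subst hj
        obtain ⟨k, hk⟩ := exists_ne i
        obtain ⟨F, hF, hF'⟩ := h1 k hk.symm
        exact ⟨⁅F, uPd K N k i hk⁆, P.lie_mem hF (hu k i hk), by
          rw [valueAtZero_lie_uPd, hF', Pi.single_eq_same]⟩
      · exact h1 j hj
    choose F hF hF' using h2
    refine eq_top_iff.2 fun x _ => ?_
    have hx : x - ∑ j, valueAtZero K N x j • F j ∈ P := hle (by
      rw [mem_vanishing_iff, map_sub, map_sum, sub_eq_zero]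
      simp only [map_smul, hF', ← Pi.single_smul, smul_eq_mul, mul_one]
      exact (Finset.univ_sum_single _).symm)
    have hs : ∑ j, valueAtZero K N x j • F j ∈ P :=
      P.toSubmodule.sum_mem fun j _ => P.smul_mem _ (hF j)
    have := P.add_mem hx hs
    rwa [sub_add_cancel] at this

end ConstantFields

/-! ### The case N_∞: integration, and absence of subalgebras of codimension 5 -/

section Unbounded

variable {K : Type*} [Field K] [CharP K 2]

variable (K) in
/-- The divided monomials of `O(5; N_∞)`. -/
def monInf (r : Fin 5 → ℕ) : O K Ninf := O.mk (DivPow.mon r) (DivPow.mem_trunc_top _)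

theorem pd_monInf (i : Fin 5) (r : Fin 5 → ℕ) :
    pd i (monInf K r) = if r i = 0 then 0 else monInf K (r - Pi.single i 1) := by
  refine O.ext ?_
  rw [pd_val, monInf, O.val_mk, DivPow.pd_mon]
  split_ifs
  · rw [map_zero]
  · rfl

variable (K) in
/-- Integration with respect to `u_i`: the linear map `u^(r) ↦ u^(r + e_i)`. -/
def integrate (i : Fin 5) : O K Ninf →ₗ[K] O K Ninf where
  toFun f := O.mk (DivPow.lift (fun r => DivPow.mon (r + Pi.single i 1)) (O.val f))
    (DivPow.mem_trunc_top _)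
  map_add' f g := O.ext (by
    rw [O.val_mk, map_add O.val, map_add O.val, O.val_mk, O.val_mk, map_add])
  map_smul' a f := O.ext (by
    rw [O.val_mk, map_smul O.val, RingHom.id_apply, map_smul O.val, O.val_mk, map_smul])

theorem integrate_monInf (i : Fin 5) (r : Fin 5 → ℕ) :
    integrate K i (monInf K r) = monInf K (r + Pi.single i 1) :=
  O.ext (DivPow.lift_mon _ _)

theorem pd_integrate_self (i : Fin 5) (f : O K Ninf) : pd i (integrate K i f) = f := by
  induction f using O.induction with
  | hm r h =>
    change pd i (integrate K i (monInf K r)) = monInf K r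
    rw [integrate_monInf, pd_monInf, if_neg (by simp), add_tsub_cancel_right]
  | ha f g hf hg => rw [map_add, map_add, hf, hg]
  | hs a f hf => rw [map_smul, Derivation.map_smul, hf]

theorem pd_integrate {i j : Fin 5} (hij : j ≠ i) (f : O K Ninf) :
    pd j (integrate K i f) = integrate K i (pd j f) := by
  induction f using O.induction with
  | hm r h =>
    change pd j (integrate K i (monInf K r)) = integrate K i (pd j (monInf K r))
    rw [integrate_monInf, pd_monInf, pd_monInf, Pi.add_apply, Pi.single_eq_of_ne hij, add_zero]
    split_ifs with h0
    · rw [map_zero]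
    · rw [integrate_monInf]
      congr 1
      funext k
      by_cases hk : k = j
      · subst hk; simp [Pi.single_eq_of_ne hij]
      · simp [Pi.single_eq_of_ne hk]
  | ha f g hf hg => rw [map_add, map_add, map_add, map_add, hf, hg]
  | hs a f hf => rw [map_smul, Derivation.map_smul, Derivation.map_smul, map_smul, hf]

/-- The divergence-free field `∂_j h ∂_1 + ∂_1 h ∂_j`. -/
def potField (j : Fin 5) (h : O K Ninf) : svect K Ninf :=
  ⟨pd j h • pd 0 + pd 0 h • pd j,
    (vect K Ninf).add_mem (smul_pd_mem_vect _ _) (smul_pd_mem_vect _ _), by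
    have e : ∀ (f : O K Ninf) (i : Fin 5), div (f • (pd i : Der K Ninf)) = pd i f := by
      intro f i
      rw [div, Finset.sum_eq_single i]
      · rw [smul_pd_X, if_pos rfl]
      · intro k _ hk
        rw [smul_pd_X, if_neg hk.symm, map_zero]
      · exact fun h => absurd (Finset.mem_univ _) h
    have : div (pd j h • (pd 0 : Der K Ninf) + pd 0 h • pd j) =
        div (pd j h • (pd 0 : Der K Ninf)) + div (pd 0 h • (pd j : Der K Ninf)) := by
      simp only [div, Derivation.add_apply, map_add, Finset.sum_add_distrib]
    rw [this, e, e, pd_comm 0 j, CharTwo.add_self_eq_zero]⟩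

theorem potField_X (j k : Fin 5) (h : O K Ninf) : (potField j h : Der K Ninf) (X k) =
    (if 0 = k then pd j h else 0) + if j = k then pd 0 h else 0 := by
  rw [← smul_pd_X, ← smul_pd_X]; rfl

/-- With unbounded exponents every function can be integrated. The potential ∫f_j du_1 accounts for
the component along ∂_j, j ≥ 2. What remains is a field g∂_1, and divergence-freeness says that g
does not depend on u_1. -/
theorem exists_potential (D : svect K Ninf) : ∃ h1 h2 h3 h4 : O K Ninf,
    D = potField 1 h1 + potField 2 h2 + potField 3 h3 + potField 4 h4 := by
  obtain ⟨f, hf⟩ : ∃ f : Fin 5 → O K Ninf, ∀ j, (D : Der K Ninf) (X j) = f j := ⟨_, fun _ => rfl⟩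
  have hd : pd 0 (f 0) + pd 1 (f 1) + pd 2 (f 2) + pd 3 (f 3) + pd 4 (f 4) = 0 := by
    have := D.2.2
    simpa only [div, Fin.sum_univ_five, hf] using this
  -- The remaining ∂_1-component. Because ∂_1 g = 0, adding ∫g du_2 to the first potential produces
  -- g∂_1 without a new ∂_2-component.
  obtain ⟨g, hg⟩ : ∃ g, g = f 0 + pd 1 (integrate K 0 (f 1)) + pd 2 (integrate K 0 (f 2)) +
    pd 3 (integrate K 0 (f 3)) + pd 4 (integrate K 0 (f 4)) := ⟨_, rfl⟩
  have hg0 : pd 0 g = 0 := by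
    rw [hg, map_add, map_add, map_add, map_add, pd_comm 0 1, pd_comm 0 2, pd_comm 0 3, pd_comm 0 4]
    simp only [pd_integrate_self]
    exact hd
  have h2 : (2 : O K Ninf) = 0 := two_eq_zero
  refine ⟨integrate K 0 (f 1) + integrate K 1 g, integrate K 0 (f 2), integrate K 0 (f 3),
    integrate K 0 (f 4), svect_ext fun j => ?_⟩
  rw [hf]
  change f j = (potField 1 (integrate K 0 (f 1) + integrate K 1 g) : Der K Ninf) (X j) +
    (potField 2 (integrate K 0 (f 2)) : Der K Ninf) (X j) +
    (potField 3 (integrate K 0 (f 3)) : Der K Ninf) (X j) +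
    (potField 4 (integrate K 0 (f 4)) : Der K Ninf) (X j)
  simp only [potField_X, map_add, pd_integrate_self, pd_integrate (show (0 : Fin 5) ≠ 1 by decide),
    hg0, map_zero]
  fin_cases j
  · simp
    rw [hg]; grind
  all_goals simp

/-- Choose i with v_i ≠ 0. Applied to u^(r+e_i), the field gives v_i u^(r) plus monomials of smaller
degree in the other indeterminates, so induction on that degree yields all monomials. -/
theorem constField_surjective {v : Fin 5 → K} (hv : v ≠ 0) :
    Function.Surjective (constField K Ninf v : Der K Ninf) := by
  obtain ⟨i, hi⟩ : ∃ i, v i ≠ 0 := Function.ne_iff.1 hv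
  have hmon : ∀ (n : ℕ) (r : Fin 5 → ℕ), ∑ j ∈ Finset.univ.erase i, r j = n →
      monInf K r ∈ LinearMap.range (constField K Ninf v : Der K Ninf).toLinearMap := by
    intro n
    induction n using Nat.strong_induction_on with
    | _ n ih =>
      intro r hr
      have h1 : (constField K Ninf v : Der K Ninf) (monInf K (r + Pi.single i 1)) =
          v i • monInf K r + ∑ j ∈ Finset.univ.erase i,
            v j • pd j (monInf K (r + Pi.single i 1)) := by
        rw [constField_apply, ← Finset.add_sum_erase _ _ (Finset.mem_univ i), pd_monInf,
          if_neg (by simp), add_tsub_cancel_right]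
      have h2 : ∑ j ∈ Finset.univ.erase i, v j • pd j (monInf K (r + Pi.single i 1)) ∈
          LinearMap.range (constField K Ninf v : Der K Ninf).toLinearMap := by
        refine Submodule.sum_mem _ fun j hj => Submodule.smul_mem _ _ ?_
        have hji := Finset.ne_of_mem_erase hj
        rw [pd_monInf]
        split_ifs with h0
        · exact Submodule.zero_mem _
        · rw [Pi.add_apply, Pi.single_eq_of_ne hji, add_zero] at h0
          refine ih _ ?_ _ rfl
          rw [← hr]
          refine Finset.sum_lt_sum (fun k hk => ?_) ⟨j, hj, ?_⟩
          · simp [Pi.single_eq_of_ne (Finset.ne_of_mem_erase hk)]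
          · simp only [Pi.sub_apply, Pi.add_apply, Pi.single_eq_same, Pi.single_eq_of_ne hji]
            omega
      have h3 : monInf K r = (v i)⁻¹ • ((constField K Ninf v : Der K Ninf)
          (monInf K (r + Pi.single i 1)) - ∑ j ∈ Finset.univ.erase i,
            v j • pd j (monInf K (r + Pi.single i 1))) := by
        rw [h1, add_sub_cancel_right, smul_smul, inv_mul_cancel₀ hi, one_smul]
      rw [h3]
      exact Submodule.smul_mem _ _ (Submodule.sub_mem _ ⟨_, rfl⟩ h2)
  intro f
  change f ∈ LinearMap.range (constField K Ninf v : Der K Ninf).toLinearMap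
  induction f using O.induction with
  | hm r h => exact hmon _ r rfl
  | ha f g hf hg => exact Submodule.add_mem _ hf hg
  | hs a f hf => exact Submodule.smul_mem _ _ hf

theorem constField_pow_monInf (v : Fin 5 → K) (n : ℕ) : ∀ r : Fin 5 → ℕ, ∑ j, r j < n →
    ((constField K Ninf v : Der K Ninf).toLinearMap ^ n) (monInf K r) = 0 := by
  induction n with
  | zero => exact fun r h => absurd h (Nat.not_lt_zero _)
  | succ n ih =>
    intro r hr
    rw [pow_succ, Module.End.mul_apply]
    change ((constField K Ninf v : Der K Ninf).toLinearMap ^ n)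
      ((constField K Ninf v : Der K Ninf) (monInf K r)) = 0
    rw [constField_apply, map_sum]
    refine Finset.sum_eq_zero fun j _ => ?_
    rw [map_smul, pd_monInf]
    split_ifs with h0
    · rw [map_zero, smul_zero]
    · rw [ih, smul_zero]
      refine lt_of_lt_of_le (Finset.sum_lt_sum (fun k _ => ?_) ⟨j, Finset.mem_univ _, ?_⟩)
        (Nat.lt_succ_iff.1 hr)
      · exact tsub_le_self
      · simp only [Pi.sub_apply, Pi.single_eq_same]; omega

theorem exists_constField_pow_eq_zero (v : Fin 5 → K) (f : O K Ninf) :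
    ∃ n, ∀ m, n ≤ m → ((constField K Ninf v : Der K Ninf).toLinearMap ^ m) f = 0 := by
  induction f using O.induction with
  | hm r h =>
    exact ⟨∑ j, r j + 1, fun m hm => constField_pow_monInf v m r (Nat.lt_of_succ_le hm)⟩
  | ha f g hf hg =>
    obtain ⟨n, hn⟩ := hf
    obtain ⟨n', hn'⟩ := hg
    exact ⟨max n n', fun m hm => by
      rw [map_add, hn m ((le_max_left _ _).trans hm), hn' m ((le_max_right _ _).trans hm),
        add_zero]⟩
  | hs a f hf =>
    obtain ⟨n, hn⟩ := hf
    exact ⟨n, fun m hm => by rw [map_smul, hn m hm, smul_zero]⟩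

theorem exists_ad_constField_pow_eq_zero (v : Fin 5 → K) (D : svect K Ninf) :
    ∃ n, (LieAlgebra.ad K (svect K Ninf) (constField K Ninf v) ^ n) D = 0 := by
  choose n hn using fun j => exists_constField_pow_eq_zero v ((D : Der K Ninf) (X j))
  have h : ∀ (m : ℕ) (j : Fin 5),
      (((LieAlgebra.ad K (svect K Ninf) (constField K Ninf v) ^ m) D : svect K Ninf) :
        Der K Ninf) (X j) =
      ((constField K Ninf v : Der K Ninf).toLinearMap ^ m) ((D : Der K Ninf) (X j)) := by
    intro m j
    induction m with
    | zero => rfl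
    | succ m ih =>
      rw [pow_succ', pow_succ', Module.End.mul_apply, Module.End.mul_apply, ← ih]
      exact lie_constField_X v _ j
  refine ⟨∑ j, n j, svect_ext fun j => ?_⟩
  rw [h, hn j _ (Finset.single_le_sum (fun _ _ => Nat.zero_le _) (Finset.mem_univ j))]
  rfl

/-- Surjectivity on functions does not suffice, because the preimage has to be divergence-free.
Constant fields commute with ∂_j, so it is enough to lift the potentials. -/
theorem ad_constField_surjective {v : Fin 5 → K} (hv : v ≠ 0) :
    Function.Surjective (LieAlgebra.ad K (svect K Ninf) (constField K Ninf v)) := by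
  have hpot : ∀ (j : Fin 5) (h : O K Ninf),
      ∃ E, LieAlgebra.ad K (svect K Ninf) (constField K Ninf v) E = potField j h := by
    intro j h
    obtain ⟨k, rfl⟩ := constField_surjective hv h
    refine ⟨potField j k, svect_ext fun l => ?_⟩
    rw [LieAlgebra.ad_apply, lie_constField_X, potField_X, potField_X, map_add]
    split_ifs <;> simp only [constField_pd, map_zero]
  intro D
  obtain ⟨h1, h2, h3, h4, rfl⟩ := exists_potential D
  obtain ⟨E1, e1⟩ := hpot 1 h1
  obtain ⟨E2, e2⟩ := hpot 2 h2
  obtain ⟨E3, e3⟩ := hpot 3 h3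
  obtain ⟨E4, e4⟩ := hpot 4 h4
  exact ⟨E1 + E2 + E3 + E4, by rw [map_add, map_add, map_add, e1, e2, e3, e4]⟩

/-- The map induced by T on the finite-dimensional quotient is surjective, hence injective. So Tx ∈
P forces x ∈ P, and since T^n x = 0 lies in P, so does x. -/
theorem eq_top_of_surjective_of_locally_nilpotent {L : Type*} [AddCommGroup L] [Module K L]
    (P : Submodule K L) [FiniteDimensional K (L ⧸ P)] (T : L →ₗ[K] L) (hP : P ≤ P.comap T)
    (hs : Function.Surjective T) (hn : ∀ x, ∃ n, (T ^ n) x = 0) : P = ⊤ := by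
  have hs' : Function.Surjective (P.mapQ P T hP) := by
    intro y
    obtain ⟨y, rfl⟩ := P.mkQ_surjective y
    obtain ⟨x, rfl⟩ := hs y
    exact ⟨P.mkQ x, rfl⟩
  have hi := LinearMap.injective_iff_surjective.2 hs'
  refine eq_top_iff.2 fun x _ => ?_
  have key : ∀ (n : ℕ) (x : L), (T ^ n) x ∈ P → x ∈ P := by
    intro n
    induction n with
    | zero => exact fun x h => h
    | succ n ih =>
      intro x h
      rw [pow_succ, Module.End.mul_apply] at h
      have h1 : T x ∈ P := ih _ h
      rw [← Submodule.Quotient.mk_eq_zero] at h1 ⊢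
      exact hi (by rw [map_zero]; exact h1)
  obtain ⟨n, hn⟩ := hn x
  exact key n x (by rw [hn]; exact P.zero_mem)

/-- The dimension 5 is used twice: it makes the quotient finite-dimensional, so that P contains no
nonzero constant field, and it equals the dimension of the space of constant fields, which therefore
is a complement of P. -/
theorem finrank_quotient_ne_five (P : Submodule K (svect K Ninf))
    (hP : ∀ D ∈ P, ∀ E ∈ P, ⁅D, E⁆ + (cCochain K Ninf).val D E ∈ P) :
    Module.finrank K (svect K Ninf ⧸ P) ≠ 5 := by
  intro h5
  have hfin : FiniteDimensional K (svect K Ninf ⧸ P) := Module.finite_of_finrank_pos (by omega)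
  have hV : ∀ v : Fin 5 → K, constField K Ninf v ∈ P → v = 0 := by
    intro v hvP
    by_contra hv
    have htop := eq_top_of_surjective_of_locally_nilpotent P
      (LieAlgebra.ad K (svect K Ninf) (constField K Ninf v))
      (fun D hD => by
        have := hP _ hvP D hD
        rwa [cCochain_constField, add_zero] at this)
      (ad_constField_surjective hv) (exists_ad_constField_pow_eq_zero v)
    subst htop
    rw [Module.finrank_zero_of_subsingleton] at h5
    omega
  have hinj : Function.Injective (P.mkQ ∘ₗ constField K Ninf) :=
    (injective_iff_map_eq_zero _).2 fun v hv => hV v ((Submodule.Quotient.mk_eq_zero P).1 hv)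
  have hsurj : Function.Surjective (P.mkQ ∘ₗ constField K Ninf) :=
    (LinearMap.injective_iff_surjective_of_finrank_eq_finrank
      (by rw [h5, Module.finrank_fin_fun])).1 hinj
  have hdec : ∀ D : svect K Ninf, ∃ v, D + constField K Ninf v ∈ P := by
    intro D
    obtain ⟨v, hv⟩ := hsurj (P.mkQ (-D))
    refine ⟨v, ?_⟩
    rw [← Submodule.Quotient.mk_eq_zero, Submodule.Quotient.mk_add]
    change P.mkQ D + (P.mkQ ∘ₗ constField K Ninf) v = 0
    rw [hv, map_neg, add_neg_cancel]
  -- The fields u_2∂_4 and u_3∂_5 commute and c maps them to ∂_1. After correction by constant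
  -- fields both lie in P.
  obtain ⟨v, hv⟩ := hdec (uPd K Ninf 1 3 (by decide))
  obtain ⟨w, hw⟩ := hdec (uPd K Ninf 2 4 (by decide))
  have hvX : ∀ k, ((uPd K Ninf 1 3 (by decide) + constField K Ninf v : svect K Ninf) :
      Der K Ninf) (X k) = (if 3 = k then X 1 else 0) + algebraMap K (O K Ninf) (v k) := fun k => by
    rw [← uPd_X 1 3 k (by decide), ← constField_X]; rfl
  have hwX : ∀ k, ((uPd K Ninf 2 4 (by decide) + constField K Ninf w : svect K Ninf) :
      Der K Ninf) (X k) = (if 4 = k then X 2 else 0) + algebraMap K (O K Ninf) (w k) := fun k => by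
    rw [← uPd_X 2 4 k (by decide), ← constField_X]; rfl
  have hb := hP _ hv _ hw
  -- The deformed bracket of the corrected fields: the entry 1 comes from c, while -w_2 along ∂_4
  -- and v_3 along ∂_5 come from the constant fields differentiating u_2 and u_3. It is a nonzero
  -- constant field in P.
  have hz := hV ![1, 0, 0, -w 1, v 2] (by
    convert hb using 1
    refine svect_ext fun k => ?_
    rw [constField_X]
    generalize hx : (uPd K Ninf 1 3 (by decide) + constField K Ninf v : svect K Ninf) = x at *
    generalize hy : (uPd K Ninf 2 4 (by decide) + constField K Ninf w : svect K Ninf) = y at *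
    change _ = ((x : Der K Ninf) ((y : Der K Ninf) (X k)) -
      (y : Der K Ninf) ((x : Der K Ninf) (X k)))
      + cField (x : Der K Ninf) (y : Der K Ninf) (X k)
    obtain ⟨c0, c1, c2, c3, c4⟩ := cField_X (x : Der K Ninf) (y : Der K Ninf)
    fin_cases k <;> simp only [Fin.zero_eta, Fin.isValue, Fin.mk_one, Fin.reduceFinMk]
    · rw [c0]; simp [hvX, hwX, pd_X]
    · rw [c1]; simp [hvX, hwX, pd_X]
    · rw [c2]; simp [hvX, hwX, pd_X]
    · rw [c3]; simp [hvX, hwX]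
    · rw [c4]; simp [hvX, hwX])
  exact one_ne_zero (congrFun hz 0)

/-- Through φ a subalgebra of F(mb) becomes a subspace of svect closed under the deformed bracket.
So subalgebras of codimension 5, maximal or not, do not exist. -/
theorem finrank_quotient_FMb_ne_five (M : LieSubalgebra K (FMb K Ninf)) :
    Module.finrank K (FMb K Ninf ⧸ M.toSubmodule) ≠ 5 := by
  rw [(Submodule.Quotient.equiv M.toSubmodule (M.toSubmodule.map (phi K Ninf))
    (phiEquiv K Ninf) rfl).finrank_eq]
  refine finrank_quotient_ne_five _ ?_
  rintro _ ⟨D, hD, rfl⟩ _ ⟨E, hE, rfl⟩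
  exact ⟨⁅D, E⁆, M.lie_mem hD hE, phi_lie D E⟩

/-- An isomorphism would pull the fields vanishing at the origin back to a subalgebra of codimension
5. -/
theorem isEmpty_FMb_equiv_svect : IsEmpty (FMb K Ninf ≃ₗ⁅K⁆ svect K Ninf) := by
  refine ⟨fun e => finrank_quotient_FMb_ne_five
    ((vanishing K Ninf).comap (e : FMb K Ninf →ₗ⁅K⁆ svect K Ninf)) ?_⟩
  refine Eq.trans ?_ (finrank_quotient_vanishing (K := K) (N := Ninf))
  exact (Submodule.Quotient.equiv _ _ e.toLinearEquiv
    (Submodule.map_comap_eq_of_surjective e.surjective _)).finrank_eq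

end Unbounded

end

end CharTwo5

theorem mainTheorem1 (K : Type*) [Field K] [IsAlgClosed K] [CharP K 2] :
    (∀ N : Fin 5 → WithTop ℕ+,
      (∃ φ : CharTwo5.FMb K N ≃ₗ[K] CharTwo5.svect K N,
        (∀ D : CharTwo5.FMb K N,
          ((φ D : CharTwo5.svect K N) : CharTwo5.Der K N) =
            ∑ i, CharTwo5.mbFun (D : CharTwo5.Der K (CharTwo5.tildeN N)) i • CharTwo5.pd i) ∧
        (∀ D E : CharTwo5.FMb K N,
          φ ⁅D, E⁆ = ⁅φ D, φ E⁆ + (CharTwo5.cCochain K N).val (φ D) (φ E)) ∧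
        (∃ Φ : CharTwo5.FMb K N →ₗ⁅K⁆ CharTwo5.FKle K N,
          Function.Injective Φ ∧ ∀ D, Φ D = CharTwo5.psi K N (φ D))) ∧
      CharTwo5.cCochain K N ∈
        LieModule.Cohomology.twoCocycle K (CharTwo5.svect K N) (CharTwo5.svect K N) ∧
      CharTwo5.cCochain K N ∉ LinearMap.range
        (LieModule.Cohomology.d₁₂ K (CharTwo5.svect K N) (CharTwo5.svect K N)) ∧
      Function.Injective (CharTwo5.psi K N) ∧
      (∀ D E : CharTwo5.svect K N, ⁅CharTwo5.psi K N D, CharTwo5.psi K N E⁆ =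
        CharTwo5.psi K N (⁅D, E⁆ + (CharTwo5.cCochain K N).val D E))) ∧
    (¬ ∃ M : LieSubalgebra K (CharTwo5.FMb K CharTwo5.Ninf), IsCoatom M ∧
      Module.finrank K (CharTwo5.FMb K CharTwo5.Ninf ⧸ M.toSubmodule) = 5) ∧
    (∃ M : LieSubalgebra K (CharTwo5.svect K CharTwo5.Ninf), IsCoatom M ∧
      Module.finrank K (CharTwo5.svect K CharTwo5.Ninf ⧸ M.toSubmodule) = 5) ∧
    IsEmpty (CharTwo5.FMb K CharTwo5.Ninf ≃ₗ⁅K⁆ CharTwo5.svect K CharTwo5.Ninf) := by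
  refine ⟨fun N => ⟨⟨CharTwo5.phiEquiv K N, CharTwo5.phi_coe, CharTwo5.phi_lie,
      CharTwo5.psiPhi K N, CharTwo5.psi_injective.comp CharTwo5.phi_injective, fun _ => rfl⟩,
    CharTwo5.cCochain_mem_twoCocycle, CharTwo5.cCochain_not_coboundary,
    CharTwo5.psi_injective, CharTwo5.psi_lie⟩,
    fun ⟨M, _, h⟩ => CharTwo5.finrank_quotient_FMb_ne_five M h,
    ⟨CharTwo5.vanishing K CharTwo5.Ninf, CharTwo5.isCoatom_vanishing,
      CharTwo5.finrank_quotient_vanishing⟩,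
    CharTwo5.isEmpty_FMb_equiv_svect⟩
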